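/- **Setting.** Let $n,p,q\in\mathbb Z_{\ge 0}$ and $\mathbb T^n=(\mathbb R/2\pi\mathbb Z)^n$. Let $\tilde{\mathcal G}$ be the Lie algebra of smooth loop vector fields $\tilde a=\sum_j a^{(j)}(x;\lambda)\,\partial/\partial x_j$ with complex coefficients, $x\in\mathbb T^n$, $|\lambda|=1$, with the usual commutator of vector fields for each $\lambda$. Then $\tilde{\mathcal G}=\tilde{\mathcal G}_+\oplus\tilde{\mathcal G}_-$, where $\tilde{\mathcal G}_+$ consists of the loops that extend holomorphically to $|\lambda|<1$, and $\tilde{\mathcal G}_-$ of those that extend holomorphically to $|\lambda|>1$ and vanish at $\lambda=\infty$. Let $P_\pm$ be the projections, $a_+:=P_+a$, $\mathcal R:=(P_+-P_-)/2$ and $[a,b]_{\mathcal R}:=[\mathcal Ra,b]+[a,\mathcal Rb]$. Loop $1$-forms $\tilde l=\sum_j l_j(x;\lambda)\,dx_j$ form the (regular) dual $\tilde{\mathcal G}^*$ through $$(\tilde l,\tilde a)=\frac1{2\pi i}\oint_{|\lambda|=1}(l,a)_{H^q}\,\frac{d\lambda}{\lambda^p},\qquad (l,a)_{H^q}=\sum_{j=1}^n\sum_{|\alpha|\le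 q}\int_{\mathbb T^n}\partial_x^\alpha l_j\,\partial_x^\alpha a^{(j)}\,dx .$$ The coadjoint action is defined by $(ad^*_a\tilde l,b)=-(\tilde l,[a,b])$ for all $b\in\tilde{\mathcal G}$. Let $U\subset\tilde{\mathcal G}^*$ be open. A smooth function on $U$ is a smooth $h:U\to\mathbb C$ with a gradient $\nabla h(\tilde l)\in\tilde{\mathcal G}$ with respect to $(\cdot,\cdot)$ that depends smoothly on $\tilde l\in U$. Put $\{f,g\}_{\mathcal R}(\tilde l)=(\tilde l,[\nabla f(\tilde l),\nabla g(\tilde l)]_{\mathcal R})$. A Casimir function on $U$ is a smooth function $h$ with $ad^*_{\nabla h(\tilde l)}\tilde l=0$ for all $\tilde l\in U$. Smoothness is that of the Fréchet space of smooth loops: smooth finite-parameter families of loops are carried to smooth families. **Proposition.** Let $h^{(y)},h^{(t)}$ be Casimir functions on $U$, and put $X^{(y)}(\tilde l)=-ad^*_{\nabla h^{(y)}(\tilde l)_+}\tilde l$, $X^{(t)}(\tilde l)=-ad^*_{\nabla h^{(t)}(\tilde l)_+}\tilde l$. Then the dynamical systems $$\partial\tilde l/\partial y=X^{(y)}(\tilde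 l),\qquad \partial\tilde l/\partial t=X^{(t)}(\tilde l)$$ are commuting Hamiltonian flows for $\{\cdot,\cdot\}_{\mathcal R}$, that is: 1. $X^{(y)},X^{(t)}$ are smooth vector fields on $U$, and for every smooth function $f$ on $U$ one has $\partial f(\tilde l)/\partial y=\{h^{(y)},f\}_{\mathcal R}(\tilde l)$ along the first system and $\partial f(\tilde l)/\partial t=\{h^{(t)},f\}_{\mathcal R}(\tilde l)$ along the second; 2. on $U$, $\{h^{(y)},h^{(t)}\}_{\mathcal R}=0$ and $[X^{(y)},X^{(t)}]=0$ (the derivative of $X^{(t)}$ along $X^{(y)}$ equals that of $X^{(y)}$ along $X^{(t)}$). Moreover, let $\tilde l(y,t)$ be a smooth family of loop $1$-forms, let $(y,t)\in\mathbb R^2$ be a point with $\tilde l(y,t)\in U$, and for $|\lambda|\le1$ let $\tilde A^{(y)}$, $\tilde A^{(t)}$ be the vector fields $\langle\nabla h^{(y)}(\tilde l)_+,\partial/\partial x\rangle$, $\langle\nabla h^{(t)}(\tilde l)_+,\partial/\partial x\rangle$ on $\mathbb T^n$ at $\lambda$ (evaluated for $|\lambda|<1$ by holomorphic extension). 3.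 For each $\lambda$ with $|\lambda|\le1$ the following are equivalent at $(y,t)$: (a) the Lax relation $\partial\tilde A^{(t)}/\partial y-\partial\tilde A^{(y)}/\partial t+[\tilde A^{(y)},\tilde A^{(t)}]=0$; (b) the operators $\partial/\partial t+\tilde A^{(t)}$ and $\partial/\partial y+\tilde A^{(y)}$ commute on $C^\infty(\mathbb R^2\times\mathbb T^n;\mathbb C)$; (c) the linear system $$(\partial/\partial t+\tilde A^{(t)})\psi=0,\qquad(\partial/\partial y+\tilde A^{(y)})\psi=0,\qquad \psi\in C^\infty(\mathbb R^2\times\mathbb T^n;\mathbb C),$$ is compatible: for every $f\in C^\infty(\mathbb T^n;\mathbb C)$ there is a smooth $\psi$ with $\psi(y,t,\cdot)=f$ that satisfies both equations and their first $y$- and $t$-derivatives at $(y,t)$. Further, if for $(y',t')$ near $(y,t)$ this system has smooth solutions with arbitrary prescribed $x$-gradients at the points of $\{(y,t)\}\times\mathbb T^n$, then (a) holds. 4. If $\tilde l$ satisfies both dynamical systems at $(y,t)$, then the compatibility condition $\partial X^{(y)}(\tilde l)/\partial t=\partial X^{(t)}(\tilde l)/\partial y$ of the flows at $(y,t)$ is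 equivalent to (a) for all $|\lambda|\le1$, to (b) for all $|\lambda|\le1$, and to (c) for all $|\lambda|\le1$; and these conditions hold. -/

import Mathlib

open scoped ContDiff Topology
open Complex MeasureTheory

noncomputable section
namespace LoopTorus

/-- Coefficient vectors of smooth loops on the torus `(ℝ / 2πℤ)ⁿ`: smooth functions of
`(θ, x)`, where `λ = exp (iθ)` runs over the unit circle, that are `2π`-periodic in `θ` and in every
coordinate of `x`. -/
def loopSpace (n : ℕ) : Submodule ℂ (ℝ × (Fin n → ℝ) → Fin n → ℂ) where
  carrier := {f | ContDiff ℝ ∞ f ∧ (∀ θ x, f (θ + 2 * Real.pi, x) = f (θ, x)) ∧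
    ∀ θ x j, f (θ, x + Pi.single j (2 * Real.pi)) = f (θ, x)}
  add_mem' := fun ha hb => ⟨ha.1.add hb.1, fun θ x => by simp [ha.2.1, hb.2.1],
    fun θ x j => by simp [ha.2.2, hb.2.2]⟩
  zero_mem' := ⟨contDiff_const, fun _ _ => rfl, fun _ _ _ => rfl⟩
  smul_mem' := fun c _ ha => ⟨ha.1.const_smul c, fun θ x => by simp [ha.2.1],
    fun θ x j => by simp [ha.2.2]⟩

/-- The space of smooth loops. An element `a` is read as the loop vector field
`∑ j, a j ∂/∂x j`, an element `l` as the loop differential 1-form `∑ j, l j dx j`. -/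
abbrev Loop (n : ℕ) : Type := loopSpace n

/-- The partial derivative `∂f/∂x j`. -/
def pd {n : ℕ} (j : Fin n) (f : (Fin n → ℝ) → ℂ) (x : Fin n → ℝ) : ℂ :=
  fderiv ℝ f x (Pi.single j 1)

/-- The commutator `[A, B]` of the vector fields `∑ j, A j ∂/∂x j` and `∑ j, B j ∂/∂x j`. -/
def fieldBracket {n : ℕ} (A B : (Fin n → ℝ) → Fin n → ℂ) (x : Fin n → ℝ) : Fin n → ℂ :=
  fun k => ∑ j, (A x j * pd j (fun z => B z k) x - B x j * pd j (fun z => A z k) x)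

lemma contDiff_pd {n : ℕ} {f : ℝ × (Fin n → ℝ) → ℂ} (hf : ContDiff ℝ ∞ f) (j : Fin n) :
    ContDiff ℝ ∞ (fun z : ℝ × (Fin n → ℝ) => pd j (fun x => f (z.1, x)) z.2) := by
  unfold pd
  refine ContDiff.fderiv_apply (m := ∞) (f := fun (z : ℝ × (Fin n → ℝ)) x => f (z.1, x))
    ?_ contDiff_snd contDiff_const (by simp)
  exact hf.comp ((contDiff_fst.comp contDiff_fst).prodMk contDiff_snd)

lemma pd_periodic {n : ℕ} {f : (Fin n → ℝ) → ℂ} {v : Fin n → ℝ} (h : ∀ x, f (x + v) = f x)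
    (j : Fin n) (x : Fin n → ℝ) : pd j f (x + v) = pd j f x := by
  unfold pd
  rw [← fderiv_comp_add_right]
  simp [h]

/-- The Lie commutator of loop vector fields, taken for every `λ` on the circle. -/
def bracket {n : ℕ} (a b : Loop n) : Loop n :=
  ⟨fun z => fieldBracket (fun x => a.1 (z.1, x)) (fun x => b.1 (z.1, x)) z.2, by
    refine ⟨?_, fun θ x => ?_, fun θ x j => ?_⟩
    · refine contDiff_pi.2 fun k => ContDiff.sum fun j _ => ?_
      have ha := contDiff_pi.1 a.2.1
      have hb := contDiff_pi.1 b.2.1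
      exact ((ha j).mul (contDiff_pd (hb k) j)).sub ((hb j).mul (contDiff_pd (ha k) j))
    · simp only [a.2.2.1, b.2.2.1]
    · funext k
      unfold fieldBracket
      dsimp only
      refine Finset.sum_congr rfl fun i _ => ?_
      rw [pd_periodic (fun x => by rw [b.2.2.2]), pd_periodic (fun x => by rw [a.2.2.2]),
        a.2.2.2, b.2.2.2]⟩

lemma contDiff_integral_aux {E : Type} [NormedAddCommGroup E] [NormedSpace ℝ E]
    [FiniteDimensional ℝ E] (a b : ℝ) {K : ℝ → ℂ} (hK : Continuous K) (m : ℕ) :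
    ∀ {F : Type} [NormedAddCommGroup F] [NormedSpace ℝ F] [NormedSpace ℂ F] [IsScalarTower ℝ ℂ F]
      [SMulCommClass ℝ ℂ F] [CompleteSpace F]
      {G : E × ℝ → F}, ContDiff ℝ ∞ G →
      ContDiff ℝ m (fun z => ∫ φ in a..b, K φ • G (z, φ)) := by
  have key : ∀ {F : Type} [NormedAddCommGroup F] [NormedSpace ℝ F] [NormedSpace ℂ F]
      [IsScalarTower ℝ ℂ F] [SMulCommClass ℝ ℂ F] [CompleteSpace F]
      {G : E × ℝ → F}, ContDiff ℝ ∞ G → ∀ z,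
      HasFDerivAt (fun z => ∫ φ in a..b, K φ • G (z, φ))
        (∫ φ in a..b, K φ • fderiv ℝ (fun z' => G (z', φ)) z) z := by
    intro F _ _ _ _ _ _ G hG z
    have hd : Continuous (fun w : E × ℝ => fderiv ℝ (fun z' => G (z', w.2)) w.1) := by
      refine (ContDiff.fderiv (m := ∞) (n := 0) (f := fun (w : E × ℝ) z' => G (z', w.2))
        ?_ contDiff_fst (by simp)).continuous
      exact hG.comp (contDiff_snd.prodMk (contDiff_snd.comp contDiff_fst))
    have hc := isCompact_closedBall z 1
    obtain ⟨C, hC⟩ := (hc.prod (isCompact_uIcc (a := a) (b := b))).exists_bound_of_continuousOn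
      (f := fun w : E × ℝ => K w.2 • fderiv ℝ (fun z' => G (z', w.2)) w.1)
      ((hK.comp continuous_snd).smul hd).continuousOn
    refine intervalIntegral.hasFDerivAt_integral_of_dominated_of_fderiv_le
      (F := fun z φ => K φ • G (z, φ))
      (F' := fun z φ => K φ • fderiv ℝ (fun z' => G (z', φ)) z)
      (s := Metric.closedBall z 1) (bound := fun _ => C)
      (Metric.closedBall_mem_nhds z one_pos) ?_ ?_ ?_ ?_ ?_ ?_
    · refine Filter.Eventually.of_forall fun z => Continuous.aestronglyMeasurable ?_
      exact hK.smul (hG.continuous.comp (by fun_prop))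
    · exact (hK.smul (hG.continuous.comp (by fun_prop))).intervalIntegrable _ _
    · exact (hK.smul (hd.comp (by fun_prop : Continuous fun φ : ℝ => (z, φ)))).aestronglyMeasurable
    · exact Filter.Eventually.of_forall fun φ hφ z' hz' =>
        hC (z', φ) ⟨hz', Set.uIoc_subset_uIcc hφ⟩
    · exact intervalIntegrable_const
    · refine Filter.Eventually.of_forall fun φ _ z' _ => ?_
      have : DifferentiableAt ℝ (fun z' => G (z', φ)) z' :=
        ((hG.comp (contDiff_id.prodMk contDiff_const)).differentiable (by simp)).differentiableAt
      exact this.hasFDerivAt.const_smul (K φ)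
  induction m with
  | zero =>
    intro F _ _ _ _ _ _ G hG
    exact contDiff_zero.2 (continuous_iff_continuousAt.2 fun z => (key hG z).continuousAt)
  | succ m ih =>
    intro F _ _ _ _ _ _ G hG
    push_cast
    refine contDiff_succ_iff_hasFDerivAt.2 ⟨_, ?_, key hG⟩
    refine ih (G := fun w : E × ℝ => fderiv ℝ (fun z' => G (z', w.2)) w.1) ?_
    refine (ContDiff.fderiv (m := ∞) (n := ∞) (f := fun (w : E × ℝ) z' => G (z', w.2))
        ?_ contDiff_fst (by simp))
    exact hG.comp (contDiff_snd.prodMk (contDiff_snd.comp contDiff_fst))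

/-- The Fourier coefficients of a `2π`-periodic function. -/
def fc (u : ℝ → ℂ) (k : ℤ) : ℂ :=
  (2 * Real.pi : ℂ)⁻¹ * ∫ φ in (0 : ℝ)..2 * Real.pi, exp (-(k * φ * I)) * u φ

lemma fc_hasSum {u : ℝ → ℂ} (hu : Continuous u) (hp : ∀ θ, u (θ + 2 * Real.pi) = u θ)
    (hs : Summable (fc u)) (θ : ℝ) : HasSum (fun k : ℤ => fc u k * exp (k * θ * I)) (u θ) := by
  have : Fact (0 < 2 * Real.pi) := ⟨Real.two_pi_pos⟩
  have hper : Function.Periodic u (2 * Real.pi) := hp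
  let f : C(AddCircle (2 * Real.pi), ℂ) :=
    ⟨hper.lift, continuous_coinduced_dom.2 hu⟩
  have hf : ∀ x : ℝ, f (x : AddCircle (2 * Real.pi)) = u x := fun x => hper.lift_coe x
  have hc : fourierCoeff f = fc u := by
    funext k
    rw [fourierCoeff_eq_intervalIntegral _ _ 0, fc, zero_add, Complex.real_smul]
    congr 1
    · push_cast; simp
    · refine intervalIntegral.integral_congr fun x _ => ?_
      rw [hf, fourier_coe_apply, smul_eq_mul]
      congr 2
      have : (Real.pi : ℂ) ≠ 0 := by exact_mod_cast Real.pi_ne_zero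
      push_cast
      field_simp
  have := has_pointwise_sum_fourier_series_of_summable (f := f) (by rw [hc]; exact hs) (θ : AddCircle (2 * Real.pi))
  rw [hc, hf] at this
  convert this using 2 with k
  rw [fourier_coe_apply, smul_eq_mul]
  congr 2
  have : (Real.pi : ℂ) ≠ 0 := by exact_mod_cast Real.pi_ne_zero
  push_cast
  field_simp

lemma exp_two_pi_aux (k : ℤ) : exp (-(k * ((2 * Real.pi : ℝ) : ℂ) * I)) = 1 := by
  rw [Complex.exp_eq_one_iff]
  exact ⟨-k, by push_cast; ring⟩

lemma fc_deriv {u : ℝ → ℂ} (hu : ContDiff ℝ ∞ u) (hp : ∀ θ, u (θ + 2 * Real.pi) = u θ) (k : ℤ) :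
    fc (deriv u) k = I * k * fc u k := by
  have h1 : ∀ x : ℝ, HasDerivAt (fun φ : ℝ => exp (-(k * φ * I))) (-(k * I) * exp (-(k * x * I))) x := by
    intro x
    have h0 : HasDerivAt (fun φ : ℝ => (φ : ℂ)) 1 x := Complex.ofRealCLM.hasDerivAt
    have := (h0.const_mul (-(k * I) : ℂ)).cexp
    convert this using 1
    · funext φ; congr 1; ring
    · rw [mul_one, mul_comm]; congr 2; ring
  have hd : Continuous (deriv u) := hu.continuous_deriv (by simp)
  have := intervalIntegral.integral_mul_deriv_eq_deriv_mul (a := 0) (b := 2 * Real.pi)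
    (fun x _ => h1 x) (fun x _ => (hu.differentiable (by simp) x).hasDerivAt)
    (by apply Continuous.intervalIntegrable; fun_prop)
    (hd.intervalIntegrable _ _)
  unfold fc
  rw [this, exp_two_pi_aux]
  have h2 : u (2 * Real.pi) = u 0 := by simpa using hp 0
  rw [h2]
  simp only [mul_assoc, intervalIntegral.integral_const_mul]
  simp
  ring

lemma deriv_per {u : ℝ → ℂ} (hp : ∀ θ, u (θ + 2 * Real.pi) = u θ) (θ : ℝ) :
    deriv u (θ + 2 * Real.pi) = deriv u θ := by
  rw [← deriv_comp_add_const]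
  simp [hp]

lemma fc_deriv2 {u : ℝ → ℂ} (hu : ContDiff ℝ ∞ u) (hp : ∀ θ, u (θ + 2 * Real.pi) = u θ)
    (k : ℤ) (hk : k ≠ 0) : fc u k = -(1 / (k : ℂ) ^ 2) * fc (deriv (deriv u)) k := by
  have hd : ContDiff ℝ ∞ (deriv u) := (contDiff_infty_iff_deriv.1 hu).2
  rw [fc_deriv hd (deriv_per hp), fc_deriv hu hp]
  have : (k : ℂ) ≠ 0 := by exact_mod_cast hk
  field_simp
  linear_combination (fc u k) * I_sq

lemma fc_bound {u : ℝ → ℂ} (hu : Continuous u) : ∃ C, ∀ k, ‖fc u k‖ ≤ C := by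
  obtain ⟨C, hC⟩ := (isCompact_uIcc (a := (0:ℝ)) (b := 2 * Real.pi)).exists_bound_of_continuousOn
    hu.continuousOn
  refine ⟨‖(2 * Real.pi : ℂ)⁻¹‖ * (C * |2 * Real.pi - 0|), fun k => ?_⟩
  unfold fc
  rw [norm_mul]
  gcongr
  refine intervalIntegral.norm_integral_le_of_norm_le_const fun x hx => ?_
  rw [norm_mul]
  have : ‖exp (-(k * x * I))‖ = 1 := by
    have := Complex.norm_exp_ofReal_mul_I (-(k * x))
    rw [← this]; congr 2; push_cast; ring
  rw [this, one_mul]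
  exact hC x (Set.uIoc_subset_uIcc hx)

lemma fc_summable {u : ℝ → ℂ} (hu : ContDiff ℝ ∞ u) (hp : ∀ θ, u (θ + 2 * Real.pi) = u θ) :
    Summable (fun k => ‖fc u k‖) := by
  have hd : ContDiff ℝ ∞ (deriv (deriv u)) :=
    (contDiff_infty_iff_deriv.1 (contDiff_infty_iff_deriv.1 hu).2).2
  obtain ⟨C, hC⟩ := fc_bound hd.continuous
  have hs : Summable (fun k : ℤ => C * (1 / (k : ℝ) ^ 2)) :=
    (Real.summable_one_div_int_pow.2 one_lt_two).mul_left C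
  refine Summable.of_norm_bounded_eventually hs ?_
  have : ({0}ᶜ : Set ℤ) ∈ Filter.cofinite := (Set.finite_singleton 0).compl_mem_cofinite
  filter_upwards [this] with k hk
  rw [norm_norm, fc_deriv2 hu hp k hk, norm_mul, norm_neg]
  rw [mul_comm]
  have h1 : ‖(1 / (k : ℂ) ^ 2)‖ = 1 / (k : ℝ) ^ 2 := by simp
  rw [h1]
  exact mul_le_mul_of_nonneg_right (hC k) (by positivity)

lemma diffContOnCl_powerSeries {c : ℕ → ℂ} (hc : Summable fun k => ‖c k‖) :
    DiffContOnCl ℂ (fun z => ∑' k, c k * z ^ k) (Metric.ball 0 1) := by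
  have hb : ∀ k, ∀ z ∈ Metric.closedBall (0 : ℂ) 1, ‖c k * z ^ k‖ ≤ ‖c k‖ := by
    intro k z hz
    rw [norm_mul, norm_pow]
    have : ‖z‖ ≤ 1 := by simpa using hz
    exact mul_le_of_le_one_right (norm_nonneg _) (pow_le_one₀ (norm_nonneg _) this)
  refine ⟨?_, ?_⟩
  · exact differentiableOn_tsum_of_summable_norm hc (fun k => by fun_prop) Metric.isOpen_ball
      (fun k z hz => hb k z (Metric.ball_subset_closedBall hz))
  · rw [closure_ball _ one_ne_zero]
    exact continuousOn_tsum (fun k => by fun_prop) hc hb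

lemma integral_boundary {f : ℂ → ℂ} (hf : DiffContOnCl ℂ f (Metric.ball 0 1)) :
    ∫ θ in (0 : ℝ)..2 * Real.pi, f (exp (θ * I)) = 2 * Real.pi * f 0 := by
  have h := hf.circleIntegral_sub_inv_smul (w := 0) (by simp)
  rw [circleIntegral] at h
  have h2 : (∫ θ in (0 : ℝ)..2 * Real.pi, I * f (exp (θ * I))) = (2 * Real.pi * I) • f 0 := by
    rw [← h]
    refine intervalIntegral.integral_congr fun θ _ => ?_
    simp [circleMap, deriv_circleMap]
    field_simp
  rw [intervalIntegral.integral_const_mul] at h2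
  have : I ≠ 0 := I_ne_zero
  apply mul_left_cancel₀ this
  rw [h2]; simp; ring

lemma eq_zero_of_both {u : ℝ → ℂ} (hu : Continuous u) (hp : ∀ θ, u (θ + 2 * Real.pi) = u θ)
    {F G : ℂ → ℂ} (hF : DiffContOnCl ℂ F (Metric.ball 0 1))
    (hG : DiffContOnCl ℂ G (Metric.ball 0 1)) (hG0 : G 0 = 0)
    (huF : ∀ θ : ℝ, F (exp (θ * I)) = u θ) (huG : ∀ θ : ℝ, G (exp (-(θ * I))) = u θ) (θ : ℝ) :
    u θ = 0 := by
  have hc : fc u = 0 := by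
    funext k
    have hpow : ∀ m : ℕ, DiffContOnCl ℂ (fun z : ℂ => z ^ m) (Metric.ball 0 1) := fun m =>
      (differentiable_pow m).diffContOnCl
    have hz : ∫ φ in (0 : ℝ)..2 * Real.pi, exp (-(k * φ * I)) * u φ = 0 := by
      rcases lt_or_ge k 0 with hk | hk
      · obtain ⟨m, rfl⟩ : ∃ m : ℕ, k = -((m + 1 : ℕ) : ℤ) := ⟨(-k - 1).toNat, by omega⟩
        have := integral_boundary ((hpow (m + 1)).smul hF)
        simp only [smul_eq_mul] at this
        rw [zero_pow (by omega), zero_mul, mul_zero] at this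
        rw [← this]
        refine intervalIntegral.integral_congr fun φ _ => ?_
        rw [huF, ← Complex.exp_nat_mul]
        congr 2; push_cast; ring
      · obtain ⟨m, rfl⟩ := Int.eq_ofNat_of_zero_le hk
        have := integral_boundary ((hpow m).smul hG)
        simp only [smul_eq_mul] at this
        rw [hG0, mul_zero, mul_zero] at this
        rw [← this]
        have hper : Function.Periodic (fun φ : ℝ => exp (φ * I) ^ m * G (exp (φ * I)))
            (2 * Real.pi) := by
          intro φ
          have : exp (((φ + 2 * Real.pi : ℝ) : ℂ) * I) = exp (φ * I) := by
            push_cast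
            rw [add_mul, Complex.exp_periodic]
          simp only [this]
        have h1 := hper.intervalIntegral_add_eq 0 (-(2 * Real.pi))
        rw [zero_add, neg_add_cancel] at h1
        rw [h1]
        have h2 := intervalIntegral.integral_comp_neg (a := 0) (b := 2 * Real.pi)
          (fun φ : ℝ => exp (φ * I) ^ m * G (exp (φ * I)))
        rw [neg_zero] at h2
        rw [← h2]
        refine intervalIntegral.integral_congr fun φ _ => ?_
        rw [← huG, ← Complex.exp_nat_mul]
        congr 2
        · push_cast; ring
        · congr 1; push_cast; ring
    simp [fc, hz]
  have := fc_hasSum hu hp (by rw [hc]; exact summable_zero) θ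
  rw [hc] at this
  exact this.unique (by simp)

/-- Loops that extend holomorphically to the interior of the unit circle. -/
def plusSpace (n : ℕ) : Submodule ℂ (Loop n) where
  carrier := {a | ∀ x i, ∃ F : ℂ → ℂ, DiffContOnCl ℂ F (Metric.ball 0 1) ∧
    ∀ θ : ℝ, F (exp (θ * I)) = a.1 (θ, x) i}
  add_mem' := fun ha hb x i => by
    obtain ⟨F, hF, hFa⟩ := ha x i
    obtain ⟨G, hG, hGb⟩ := hb x i
    exact ⟨F + G, hF.add hG, fun θ => by simp [hFa, hGb]⟩
  zero_mem' := fun _ _ => ⟨0, diffContOnCl_const, fun _ => rfl⟩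
  smul_mem' := fun c a ha x i => by
    obtain ⟨F, hF, hFa⟩ := ha x i
    exact ⟨c • F, hF.const_smul c, fun θ => by simp [hFa]⟩

/-- Loops that extend holomorphically to the exterior of the unit circle and vanish at `∞`;
the extension is written as a function of `1 / λ`. -/
def minusSpace (n : ℕ) : Submodule ℂ (Loop n) where
  carrier := {a | ∀ x i, ∃ G : ℂ → ℂ, DiffContOnCl ℂ G (Metric.ball 0 1) ∧ G 0 = 0 ∧
    ∀ θ : ℝ, G (exp (-(θ * I))) = a.1 (θ, x) i}
  add_mem' := fun ha hb x i => by
    obtain ⟨F, hF, hF0, hFa⟩ := ha x i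
    obtain ⟨G, hG, hG0, hGb⟩ := hb x i
    exact ⟨F + G, hF.add hG, by simp [hF0, hG0], fun θ => by simp [hFa, hGb]⟩
  zero_mem' := fun _ _ => ⟨0, diffContOnCl_const, rfl, fun _ => rfl⟩
  smul_mem' := fun c a ha x i => by
    obtain ⟨F, hF, hF0, hFa⟩ := ha x i
    exact ⟨c • F, hF.const_smul c, by simp [hF0], fun θ => by simp [hFa]⟩

lemma loop_coord_contDiff {n : ℕ} (a : Loop n) (x : Fin n → ℝ) (i : Fin n) :
    ContDiff ℝ ∞ (fun θ : ℝ => a.1 (θ, x) i) :=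
  (contDiff_pi.1 a.2.1 i).comp (contDiff_id.prodMk contDiff_const)

lemma loop_coord_periodic {n : ℕ} (a : Loop n) (x : Fin n → ℝ) (i : Fin n) (θ : ℝ) :
    a.1 (θ + 2 * Real.pi, x) i = a.1 (θ, x) i := by rw [a.2.2.1]

def splitKernel (φ : ℝ) : ℂ := ∑' k : ℕ, -(1 / ((k + 1 : ℕ) : ℂ) ^ 2) * exp (-((k + 1 : ℕ) * φ * I))

lemma norm_exp_aux (k : ℕ) (φ : ℝ) : ‖exp (-((k : ℂ) * φ * I))‖ = 1 := by
  have := Complex.norm_exp_ofReal_mul_I (-(k * φ))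
  rw [← this]; congr 2; push_cast; ring

lemma kernel_bound (k : ℕ) (φ : ℝ) :
    ‖-(1 / ((k + 1 : ℕ) : ℂ) ^ 2) * exp (-((k + 1 : ℕ) * φ * I))‖ ≤ 1 / ((k + 1 : ℕ) : ℝ) ^ 2 := by
  rw [norm_mul, norm_exp_aux, mul_one, norm_neg, norm_div, norm_pow, norm_one, Complex.norm_natCast]

lemma kernel_summable : Summable (fun k : ℕ => 1 / ((k + 1 : ℕ) : ℝ) ^ 2) :=
  (summable_nat_add_iff 1).2 (Real.summable_one_div_nat_pow.2 one_lt_two)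

lemma continuous_splitKernel : Continuous splitKernel :=
  continuous_tsum (fun k => by fun_prop) kernel_summable kernel_bound

lemma fc_shift {v : ℝ → ℂ} (hp : ∀ θ, v (θ + 2 * Real.pi) = v θ) (k : ℤ) (θ : ℝ) :
    (2 * Real.pi : ℂ)⁻¹ * ∫ φ in (0 : ℝ)..2 * Real.pi, exp (-(k * φ * I)) * v (θ + φ) =
      fc v k * exp (k * θ * I) := by
  have hper : Function.Periodic (fun φ : ℝ => exp (-(k * φ * I)) * v φ) (2 * Real.pi) := by
    intro φ
    dsimp only
    rw [hp]
    congr 1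
    have : -((k : ℂ) * ((φ + 2 * Real.pi : ℝ) : ℂ) * I) =
      -(k * φ * I) + -(k * ((2 * Real.pi : ℝ) : ℂ) * I) := by push_cast; ring
    rw [this, Complex.exp_add, exp_two_pi_aux, mul_one]
  have h1 := hper.intervalIntegral_add_eq 0 θ
  have h2 := intervalIntegral.integral_comp_add_left (a := 0) (b := 2 * Real.pi)
    (fun φ : ℝ => exp (-(k * φ * I)) * v φ) θ
  rw [zero_add] at h1
  rw [add_zero] at h2
  rw [fc, h1, ← h2, mul_assoc, ← intervalIntegral.integral_mul_const]
  congr 1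
  refine intervalIntegral.integral_congr fun φ _ => ?_
  have : exp (-((k : ℂ) * φ * I)) = exp (-(k * ((θ + φ : ℝ) : ℂ) * I)) * exp (k * θ * I) := by
    rw [← Complex.exp_add]; congr 1; push_cast; ring
  rw [this]
  ring

def splitPlus (u w : ℝ → ℂ) (θ : ℝ) : ℂ :=
  (2 * Real.pi : ℂ)⁻¹ * ((∫ φ in (0 : ℝ)..2 * Real.pi, (1 : ℂ) * u (θ + φ)) +
    ∫ φ in (0 : ℝ)..2 * Real.pi, splitKernel φ * w (θ + φ))

lemma splitPlus_hasSum {u : ℝ → ℂ} (hu : ContDiff ℝ ∞ u) (hp : ∀ θ, u (θ + 2 * Real.pi) = u θ)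
    (θ : ℝ) : HasSum (fun k : ℕ => fc u k * exp (k * θ * I)) (splitPlus u (deriv (deriv u)) θ) := by
  have hd : ContDiff ℝ ∞ (deriv (deriv u)) :=
    (contDiff_infty_iff_deriv.1 (contDiff_infty_iff_deriv.1 hu).2).2
  have hdp := deriv_per (deriv_per hp)
  set w := deriv (deriv u) with hw
  have hcw : Continuous fun φ : ℝ => w (θ + φ) := hd.continuous.comp (by fun_prop)
  obtain ⟨C, hC⟩ := (isCompact_uIcc (a := (0:ℝ)) (b := 2 * Real.pi)).exists_bound_of_continuousOn
    hcw.continuousOn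
  have h1 : HasSum (fun k : ℕ => ∫ φ in (0 : ℝ)..2 * Real.pi,
      (-(1 / ((k + 1 : ℕ) : ℂ) ^ 2) * exp (-((k + 1 : ℕ) * φ * I))) * w (θ + φ))
      (∫ φ in (0 : ℝ)..2 * Real.pi, splitKernel φ * w (θ + φ)) := by
    refine intervalIntegral.hasSum_integral_of_dominated_convergence
      (fun k _ => 1 / ((k + 1 : ℕ) : ℝ) ^ 2 * C) ?_ ?_ ?_ ?_ ?_
    · intro k
      exact (Continuous.mul (by fun_prop) hcw).aestronglyMeasurable
    · intro k
      refine Filter.Eventually.of_forall fun φ hφ => ?_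
      rw [norm_mul]
      exact mul_le_mul (kernel_bound k φ) (hC φ (Set.uIoc_subset_uIcc hφ)) (norm_nonneg _)
        (by positivity)
    · exact Filter.Eventually.of_forall fun φ _ => kernel_summable.mul_right C
    · exact intervalIntegrable_const
    · refine Filter.Eventually.of_forall fun φ _ => ?_
      exact (Summable.of_norm_bounded kernel_summable (kernel_bound · φ)).hasSum.mul_right _
  have h2 : HasSum (fun k : ℕ => fc u (k + 1 : ℕ) * exp ((k + 1 : ℕ) * θ * I))
      ((2 * Real.pi : ℂ)⁻¹ * ∫ φ in (0 : ℝ)..2 * Real.pi, splitKernel φ * w (θ + φ)) := by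
    refine Eq.subst (motive := fun f : ℕ → ℂ => HasSum f _) (funext fun k => ?_)
      (h1.mul_left (2 * Real.pi : ℂ)⁻¹)
    have := fc_shift hdp ((k + 1 : ℕ) : ℤ) θ
    rw [fc_deriv2 hu hp ((k + 1 : ℕ) : ℤ) (by omega), mul_assoc _ (fc _ _)]
    rw [Int.cast_natCast] at this
    rw [← this]
    simp only [mul_assoc, intervalIntegral.integral_const_mul, Int.cast_natCast]
    ring
  have h0 := fc_shift hp 0 θ
  have h3 := (hasSum_nat_add_iff (f := fun k : ℕ => fc u k * exp (k * θ * I)) 1).1 h2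
  simp only [Int.cast_zero, zero_mul, neg_zero, exp_zero, mul_one] at h0
  rw [Finset.sum_range_one, Nat.cast_zero, Nat.cast_zero, zero_mul, zero_mul, exp_zero, mul_one,
    ← h0, ← mul_add, add_comm] at h3
  exact h3

lemma fc_hasSum_neg {u : ℝ → ℂ} (hu : ContDiff ℝ ∞ u) (hp : ∀ θ, u (θ + 2 * Real.pi) = u θ)
    (θ : ℝ) : HasSum (fun k : ℕ => fc u (-(k + 1 : ℕ)) * exp (-((k + 1 : ℕ) * θ * I)))
      (u θ - splitPlus u (deriv (deriv u)) θ) := by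
  have hs := fc_summable hu hp
  have h := fc_hasSum hu.continuous hp hs.of_norm θ
  have h1 := splitPlus_hasSum hu hp θ
  have hsn : Summable (fun k : ℕ => fc u (-(k + 1 : ℕ)) * exp (-((k + 1 : ℕ) * θ * I))) := by
    refine Summable.of_norm ?_
    simp only [norm_mul, norm_exp_aux, mul_one]
    exact hs.comp_injective (i := fun k : ℕ => (-(k + 1 : ℕ) : ℤ)) (fun a b hab => by
      simp at hab; exact hab)
  have h2 := HasSum.of_nat_of_neg_add_one (f := fun k : ℤ => fc u k * exp (k * θ * I))
    (m := splitPlus u (deriv (deriv u)) θ)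
    (m' := ∑' k : ℕ, fc u (-(k + 1 : ℕ)) * exp (-((k + 1 : ℕ) * θ * I))) (by simpa using h1)
    (by
      convert hsn.hasSum using 2 with k
      push_cast
      congr 2
      ring)
  have := h.unique h2
  rw [this, add_sub_cancel_left]
  exact hsn.hasSum

lemma exists_split {n : ℕ} (a : Loop n) :
    ∃ b : Loop n, b ∈ plusSpace n ∧ a - b ∈ minusSpace n := by
  have hd : ContDiff ℝ ∞ (fun z : ℝ × (Fin n → ℝ) => fun i =>
      deriv (deriv fun s : ℝ => a.1 (s, z.2) i) z.1) := by
    refine contDiff_pi.2 fun i => ?_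
    have hai := contDiff_pi.1 a.2.1 i
    have step : ∀ {f : ℝ × (Fin n → ℝ) → ℂ}, ContDiff ℝ ∞ f →
        ContDiff ℝ ∞ (fun z : ℝ × (Fin n → ℝ) => deriv (fun s : ℝ => f (s, z.2)) z.1) := by
      intro f hf
      refine ContDiff.fderiv_apply (m := ∞) (f := fun (z : ℝ × (Fin n → ℝ)) (s : ℝ) => f (s, z.2))
        (k := fun _ => (1 : ℝ)) ?_ contDiff_fst contDiff_const (by simp)
      exact hf.comp (contDiff_snd.prodMk (contDiff_snd.comp contDiff_fst))
    exact step (step hai)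
  set w : ℝ × (Fin n → ℝ) → Fin n → ℂ := fun z i =>
      deriv (deriv fun s : ℝ => a.1 (s, z.2) i) z.1 with hw
  have hsm : ∀ {f : ℝ × (Fin n → ℝ) → Fin n → ℂ}, ContDiff ℝ ∞ f → ∀ {K : ℝ → ℂ}, Continuous K →
      ∀ i, ContDiff ℝ ∞ (fun z : ℝ × (Fin n → ℝ) =>
        ∫ φ in (0 : ℝ)..2 * Real.pi, K φ * f (z.1 + φ, z.2) i) := by
    intro f hf K hK i
    refine contDiff_infty.2 fun m => ?_
    refine contDiff_integral_aux 0 (2 * Real.pi) hK m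
      (G := fun w : (ℝ × (Fin n → ℝ)) × ℝ => f (w.1.1 + w.2, w.1.2) i) ?_
    exact (contDiff_pi.1 hf i).comp (by fun_prop)
  let b : Loop n := ⟨fun z i => splitPlus (fun s => a.1 (s, z.2) i) (fun s => w (s, z.2) i) z.1, by
    refine ⟨?_, fun θ x => ?_, fun θ x j => ?_⟩
    · refine contDiff_pi.2 fun i => ?_
      exact contDiff_const.mul ((hsm a.2.1 continuous_const i).add
        (hsm hd continuous_splitKernel i))
    · funext i
      have hwp : ∀ s, w (s + 2 * Real.pi, x) i = w (s, x) i :=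
        fun s => deriv_per (u := deriv fun s => a.1 (s, x) i)
          (deriv_per (loop_coord_periodic a x i)) s
      have e : ∀ φ : ℝ, θ + 2 * Real.pi + φ = θ + φ + 2 * Real.pi := fun φ => by ring
      simp only [splitPlus, e, hwp, loop_coord_periodic a x i]
    · funext i
      simp only [splitPlus, hw, a.2.2.2]⟩
  refine ⟨b, fun x i => ?_, fun x i => ?_⟩
  · have hu := loop_coord_contDiff a x i
    have hp := loop_coord_periodic a x i
    refine ⟨fun z => ∑' k : ℕ, fc (fun s => a.1 (s, x) i) k * z ^ k,
      diffContOnCl_powerSeries ((fc_summable hu hp).comp_injective Nat.cast_injective), fun θ => ?_⟩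
    refine Eq.trans (tsum_congr fun k => ?_) (splitPlus_hasSum hu hp θ).tsum_eq
    rw [← Complex.exp_nat_mul, mul_assoc]
  · have hu := loop_coord_contDiff a x i
    have hp := loop_coord_periodic a x i
    have hs : Summable (fun k : ℕ => ‖fc (fun s => a.1 (s, x) i) (-(k + 1 : ℕ))‖) :=
      (fc_summable hu hp).comp_injective (i := fun k : ℕ => (-(k + 1 : ℕ) : ℤ))
        (fun a b hab => by simp at hab; exact hab)
    refine ⟨fun z => z * ∑' k : ℕ, fc (fun s => a.1 (s, x) i) (-(k + 1 : ℕ)) * z ^ k,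
      differentiable_id.diffContOnCl.smul (diffContOnCl_powerSeries hs), by simp, fun θ => ?_⟩
    refine Eq.trans ?_ (fc_hasSum_neg hu hp θ).tsum_eq
    refine Eq.trans tsum_mul_left.symm ?_
    refine tsum_congr fun k => ?_
    rw [← Complex.exp_nat_mul, mul_left_comm, ← Complex.exp_add]
    congr 2
    push_cast
    ring

lemma isCompl_plus_minus (n : ℕ) : IsCompl (plusSpace n) (minusSpace n) := by
  constructor
  · rw [Submodule.disjoint_def]
    intro a ha hb
    apply Subtype.ext
    funext z i
    obtain ⟨F, hF, hFa⟩ := ha z.2 i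
    obtain ⟨G, hG, hG0, hGa⟩ := hb z.2 i
    exact eq_zero_of_both (loop_coord_contDiff a z.2 i).continuous (loop_coord_periodic a z.2 i)
      hF hG hG0 hFa hGa z.1
  · rw [codisjoint_iff, Submodule.eq_top_iff']
    intro a
    obtain ⟨b, hb, hab⟩ := exists_split a
    exact Submodule.mem_sup.2 ⟨b, hb, a - b, hab, by abel⟩

/-- The projection of the loop algebra onto its plus part, along its minus part. -/
def Pplus (n : ℕ) : Loop n →ₗ[ℂ] Loop n :=
  (plusSpace n).projection (minusSpace n) (isCompl_plus_minus n)

/-- The projection of the loop algebra onto its minus part, along its plus part. -/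
def Pminus (n : ℕ) : Loop n →ₗ[ℂ] Loop n :=
  (minusSpace n).projection (plusSpace n) (isCompl_plus_minus n).symm

/-- The classical `R`-structure `(P₊ - P₋) / 2`. -/
def Rmap (n : ℕ) : Loop n →ₗ[ℂ] Loop n := (1 / 2 : ℂ) • (Pplus n - Pminus n)

/-- The deformed commutator `[a, b]_R = [R a, b] + [a, R b]`. -/
def bracketR {n : ℕ} (a b : Loop n) : Loop n := bracket (Rmap n a) b + bracket a (Rmap n b)

/-- The multi-indices `α` with `|α| ≤ q`. -/
def multiIndices (n q : ℕ) : Finset (Fin n → ℕ) :=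
  (Fintype.piFinset fun _ => Finset.range (q + 1)).filter fun α => ∑ j, α j ≤ q

/-- The derivative `∂^|α| f / ∂x^α`. -/
def pdPow {n : ℕ} (α : Fin n → ℕ) (f : (Fin n → ℝ) → ℂ) : (Fin n → ℝ) → ℂ :=
  (List.finRange n).foldr (fun j g => (pd j)^[α j] g) f

/-- The (bilinear) Sobolev metric `(f, g)_{H^q}` on torus vector functions. -/
def sobolev {n : ℕ} (q : ℕ) (f g : (Fin n → ℝ) → Fin n → ℂ) : ℂ :=
  ∑ j, ∑ α ∈ multiIndices n q, ∫ x in Set.Icc (0 : Fin n → ℝ) (fun _ => 2 * Real.pi),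
    pdPow α (fun z => f z j) x * pdPow α (fun z => g z j) x

/-- The pairing `(l, a) = (2πi)⁻¹ ∮ (l, a)_{H^q} dλ / λ^p` over the unit circle `λ = exp (iθ)`. -/
def pairing {n : ℕ} (p q : ℕ) (l a : Loop n) : ℂ :=
  (2 * Real.pi * I)⁻¹ * ∫ θ in (0 : ℝ)..2 * Real.pi,
    sobolev q (fun x => l.1 (θ, x)) (fun x => a.1 (θ, x)) / exp (θ * I) ^ p * (I * exp (θ * I))

/-- `m` represents `ad*_a l`: `(m, b) = -(l, [a, b])` for every loop vector field `b`. -/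
def IsCoad {n : ℕ} (p q : ℕ) (a l m : Loop n) : Prop :=
  ∀ b, pairing p q m b = -pairing p q l (bracket a b)

open Classical in
/-- The coadjoint action `ad*_a l` as a loop 1-form. The form that represents it exists and is
unique, so the value `0` in the second branch is never taken. -/
def coad {n : ℕ} (p q : ℕ) (a l : Loop n) : Loop n :=
  if h : ∃ m, IsCoad p q a l m then h.choose else 0

/-- The smooth structure of the Fréchet space of smooth loops: a finite-parameter family of loops
is smooth if it is jointly smooth in the parameters, `θ` and `x`. -/
instance instDiffeologicalSpaceLoop (n : ℕ) : DiffeologicalSpace (Loop n) :=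
  DiffeologicalSpace.ofCorePlotsOn
    { isPlotOn := fun {k} {u} _ P => ContDiffOn ℝ ∞
        (fun w : EuclideanSpace ℝ (Fin k) × (ℝ × (Fin n → ℝ)) => (P w.1).1 w.2) (u ×ˢ Set.univ)
      isPlotOn_congr := fun _ _ _ h => contDiffOn_congr fun w hw => by rw [h hw.1]
      isPlot := fun {k} P => ContDiff ℝ ∞
        (fun w : EuclideanSpace ℝ (Fin k) × (ℝ × (Fin n → ℝ)) => (P w.1).1 w.2)
      isPlotOn_univ := by simp [contDiffOn_univ]
      isPlot_const := fun a => a.2.1.comp contDiff_snd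
      isPlotOn_reparam := by
        intro k m u v hu hv P f h hP hf
        have hg : ContDiffOn ℝ ∞ (fun w : EuclideanSpace ℝ (Fin m) × (ℝ × (Fin n → ℝ)) =>
            (f w.1, w.2)) (v ×ˢ Set.univ) :=
          (hf.comp contDiff_fst.contDiffOn fun _ hw => hw.1).prodMk contDiff_snd.contDiffOn
        exact hP.comp hg fun w hw => ⟨h hw.1, Set.mem_univ _⟩
      locality := fun _ P hP w hw => by
        obtain ⟨v, hv, hwv, hPv⟩ := hP w.1 hw.1
        exact (hPv.contDiffAt ((hv.prod isOpen_univ).mem_nhds ⟨hwv, Set.mem_univ _⟩)).contDiffWithinAt }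

/-- A scalar function on loops is smooth on `U`. -/
def SmoothFunOn {n : ℕ} (U : Set (Loop n)) (h : Loop n → ℂ) : Prop :=
  ∀ (k : ℕ) (P : EuclideanSpace ℝ (Fin k) → Loop n), Diffeology.IsPlot P →
    ContDiffOn ℝ ∞ (fun w => h (P w)) (P ⁻¹' U)

/-- A map from loops to loops is smooth on `U`. -/
def SmoothMapOn {n : ℕ} (U : Set (Loop n)) (X : Loop n → Loop n) : Prop :=
  ∀ (k : ℕ) (P : EuclideanSpace ℝ (Fin k) → Loop n), Diffeology.IsPlot P →
    ContDiffOn ℝ ∞ (fun w : EuclideanSpace ℝ (Fin k) × (ℝ × (Fin n → ℝ)) => (X (P w.1)).1 w.2)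
      ((P ⁻¹' U) ×ˢ Set.univ)

/-- `v` is the gradient of `h` at `l` with respect to the pairing. -/
def HasGrad {n : ℕ} (p q : ℕ) (h : Loop n → ℂ) (l v : Loop n) : Prop :=
  ∀ m : Loop n, HasDerivAt (fun s : ℝ => h (l + (s : ℂ) • m)) (pairing p q m v) 0

open Classical in
/-- The gradient `∇h(l)`; it is unique where it exists. -/
def grad {n : ℕ} (p q : ℕ) (h : Loop n → ℂ) (l : Loop n) : Loop n :=
  if H : ∃ v, HasGrad p q h l v then H.choose else 0

/-- Smooth functions on the open set `U` of loop 1-forms: `h` is smooth, has a gradient in the loop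
algebra at every point of `U`, and the gradient depends smoothly on the point. -/
structure IsSmoothFunctionalOn {n : ℕ} (p q : ℕ) (U : Set (Loop n)) (h : Loop n → ℂ) : Prop where
  smooth : SmoothFunOn U h
  hasGrad : ∀ l ∈ U, ∃ v, HasGrad p q h l v
  smooth_grad : SmoothMapOn U (grad p q h)

/-- Casimir functions on `U`: `ad*_{∇h(l)} l = 0` for every `l` in `U`. -/
structure IsCasimirOn {n : ℕ} (p q : ℕ) (U : Set (Loop n)) (h : Loop n → ℂ) : Prop
    extends IsSmoothFunctionalOn p q U h where
  coad_grad : ∀ l ∈ U, IsCoad p q (grad p q h l) l 0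

/-- The `R`-deformed Lie–Poisson bracket `{f, g}_R (l) = (l, [∇f(l), ∇g(l)]_R)`. -/
def poissonR {n : ℕ} (p q : ℕ) (f g : Loop n → ℂ) (l : Loop n) : ℂ :=
  pairing p q l (bracketR (grad p q f l) (grad p q g l))

/-- The projected gradient `∇h(l)₊`. -/
def gradPlus {n : ℕ} (p q : ℕ) (h : Loop n → ℂ) (l : Loop n) : Loop n :=
  Pplus n (grad p q h l)

/-- The right-hand side `-ad*_{∇h(l)₊} l` of the evolution generated by `h`. -/
def flowField {n : ℕ} (p q : ℕ) (h : Loop n → ℂ) (l : Loop n) : Loop n :=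
  -coad p q (gradPlus p q h l) l

/-- `v` is the derivative at `s` of the curve `c` of loops. -/
def HasLoopDerivAt {n : ℕ} (c : ℝ → Loop n) (v : Loop n) (s : ℝ) : Prop :=
  ∀ z, HasDerivAt (fun r => (c r).1 z) (v.1 z) s

/-- A smooth curve of loops. -/
def IsSmoothCurve {n : ℕ} (c : ℝ → Loop n) : Prop :=
  ContDiff ℝ ∞ (fun w : ℝ × (ℝ × (Fin n → ℝ)) => (c w.1).1 w.2)

/-- A smooth family `l(y, t)` of loops. -/
def IsSmoothFamily {n : ℕ} (L : ℝ → ℝ → Loop n) : Prop :=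
  ContDiff ℝ ∞ (fun w : (ℝ × ℝ) × (ℝ × (Fin n → ℝ)) => (L w.1.1 w.1.2).1 w.2)

/-- The vector fields `X` and `Y` on the space of loop 1-forms commute at `l`: the derivative of
`Y` along `X` and the derivative of `X` along `Y` exist and agree. -/
def CommuteAt {n : ℕ} (X Y : Loop n → Loop n) (l : Loop n) : Prop :=
  ∃ v, HasLoopDerivAt (fun s => Y (l + (s : ℂ) • X l)) v 0 ∧
    HasLoopDerivAt (fun s => X (l + (s : ℂ) • Y l)) v 0

/-- The family `l(y, t)` satisfies `∂l/∂y = X(l)` and `∂l/∂t = Y(l)` at `(y, t)`. -/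
def SolvesAt {n : ℕ} (X Y : Loop n → Loop n) (L : ℝ → ℝ → Loop n) (y t : ℝ) : Prop :=
  HasLoopDerivAt (fun s => L s t) (X (L y t)) y ∧ HasLoopDerivAt (fun s => L y s) (Y (L y t)) t

/-- The compatibility condition `∂/∂t X(l) = ∂/∂y Y(l)` at `(y, t)` of the evolutions
`∂l/∂y = X(l)` and `∂l/∂t = Y(l)`. -/
def CompatibleAt {n : ℕ} (X Y : Loop n → Loop n) (L : ℝ → ℝ → Loop n) (y t : ℝ) : Prop :=
  ∃ v, HasLoopDerivAt (fun s => X (L y s)) v t ∧ HasLoopDerivAt (fun s => Y (L s t)) v y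

/-- The value `a(x; λ)`, `|λ| ≤ 1`, of the holomorphic extension of a loop `a` of the plus part:
the Cauchy integral for `|λ| < 1`, the loop itself for `|λ| = 1`. -/
def extend {n : ℕ} (a : Loop n) (lam : ℂ) (x : Fin n → ℝ) : Fin n → ℂ :=
  if ‖lam‖ < 1 then fun i => (2 * Real.pi * I)⁻¹ * ∫ φ in (0 : ℝ)..2 * Real.pi,
    a.1 (φ, x) i / (exp (φ * I) - lam) * (I * exp (φ * I))
  else a.1 (arg lam, x)

/-- The coefficients at `λ` of the torus vector field `⟨∇h(l)₊, ∂/∂x⟩` along a family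
`l = l(y, t)`. -/
def laxField {n : ℕ} (p q : ℕ) (h : Loop n → ℂ) (L : ℝ → ℝ → Loop n) (lam : ℂ) :
    ℝ → ℝ → (Fin n → ℝ) → Fin n → ℂ :=
  fun y t x => extend (gradPlus p q h (L y t)) lam x

/-- The Lax relation `∂B/∂y - ∂A/∂t + [A, B] = 0` at `(y, t)` for torus vector fields `A` and `B`
that depend on `(y, t)`. -/
def LaxAt {n : ℕ} (A B : ℝ → ℝ → (Fin n → ℝ) → Fin n → ℂ) (y t : ℝ) : Prop :=
  ∀ x, ∃ u v, HasDerivAt (fun s => B s t x) u y ∧ HasDerivAt (fun s => A y s x) v t ∧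
    u - v + fieldBracket (A y t) (B y t) x = 0

/-- The operator `∂/∂y + A` on functions of `(y, t, x)`. -/
def opY {n : ℕ} (A : ℝ → ℝ → (Fin n → ℝ) → Fin n → ℂ) (ψ : ℝ → ℝ → (Fin n → ℝ) → ℂ) :
    ℝ → ℝ → (Fin n → ℝ) → ℂ :=
  fun y t x => deriv (fun s => ψ s t x) y + ∑ j, A y t x j * pd j (ψ y t) x

/-- The operator `∂/∂t + B` on functions of `(y, t, x)`. -/
def opT {n : ℕ} (B : ℝ → ℝ → (Fin n → ℝ) → Fin n → ℂ) (ψ : ℝ → ℝ → (Fin n → ℝ) → ℂ) :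
    ℝ → ℝ → (Fin n → ℝ) → ℂ :=
  fun y t x => deriv (fun s => ψ y s x) t + ∑ j, B y t x j * pd j (ψ y t) x

/-- Smooth complex functions on the torus. -/
def IsTorusFun {n : ℕ} (f : (Fin n → ℝ) → ℂ) : Prop :=
  ContDiff ℝ ∞ f ∧ ∀ x j, f (x + Pi.single j (2 * Real.pi)) = f x

/-- Smooth complex functions of `(y, t, x)` on the product of the plane and the torus. -/
def IsWaveFun {n : ℕ} (ψ : ℝ → ℝ → (Fin n → ℝ) → ℂ) : Prop :=
  ContDiff ℝ ∞ (fun w : (ℝ × ℝ) × (Fin n → ℝ) => ψ w.1.1 w.1.2 w.2) ∧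
    ∀ y t x j, ψ y t (x + Pi.single j (2 * Real.pi)) = ψ y t x

/-- The operators `∂/∂t + B` and `∂/∂y + A` commute at `(y, t)` on all smooth functions. -/
def OpsCommuteAt {n : ℕ} (A B : ℝ → ℝ → (Fin n → ℝ) → Fin n → ℂ) (y t : ℝ) : Prop :=
  ∀ ψ, IsWaveFun ψ → ∀ x, opT B (opY A ψ) y t x = opY A (opT B ψ) y t x

/-- `r` vanishes at `(y, t)`, for all `x`, together with its `y`- and `t`-derivative. -/
def VanishesToFirstOrderAt {n : ℕ} (r : ℝ → ℝ → (Fin n → ℝ) → ℂ) (y t : ℝ) : Prop :=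
  ∀ x, r y t x = 0 ∧ HasDerivAt (fun s => r s t x) 0 y ∧ HasDerivAt (fun s => r y s x) 0 t

/-- The linear system `(∂/∂t + B)ψ = 0 = (∂/∂y + A)ψ` imposes no condition on the value of `ψ` at
`(y, t)`: for every smooth function on the torus there is a smooth `ψ` that takes this value at
`(y, t)` and satisfies both equations and their first `y`- and `t`-derivatives there. -/
def LinearCompatibleAt {n : ℕ} (A B : ℝ → ℝ → (Fin n → ℝ) → Fin n → ℂ) (y t : ℝ) : Prop :=
  ∀ f, IsTorusFun f → ∃ ψ, IsWaveFun ψ ∧ ψ y t = f ∧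
    VanishesToFirstOrderAt (opT B ψ) y t ∧ VanishesToFirstOrderAt (opY A ψ) y t

/-- The linear system `(∂/∂t + B)ψ = 0 = (∂/∂y + A)ψ` has, for parameters near `(y, t)`, smooth
solutions with every prescribed `x`-gradient at every point `x` of the torus at `(y, t)`. -/
def HasCompleteSolutionsAt {n : ℕ} (A B : ℝ → ℝ → (Fin n → ℝ) → Fin n → ℂ) (y t : ℝ) : Prop :=
  ∀ (x : Fin n → ℝ) (ξ : Fin n → ℂ), ∃ ψ, IsWaveFun ψ ∧
    (∀ᶠ w : ℝ × ℝ in nhds (y, t), ∀ x', opT B ψ w.1 w.2 x' = 0 ∧ opY A ψ w.1 w.2 x' = 0) ∧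
    ∀ j, pd j (ψ y t) x = ξ j

end LoopTorus

end

open LoopTorus

/-! The dynamics follow the Adler–Kostant–Symes scheme. Let `h`, `h'` be Casimir functions with
gradients `a = ∇h(l)`, `b = ∇h'(l)`. The Casimir identity `(l, [∇h(l), c]) = 0` can be
differentiated in `l`, and the derivative of a gradient is symmetric for the pairing because it is a
second derivative. Together they show that when `l` moves in the direction `ad*_v l`, the gradient
`a` moves by `[v, a]` (`IsCasimirOn.hasLoopDerivAt_grad`). Two choices of `v` matter. For `v = b`
the point does not move, hence `[a, b] = 0` (`IsCasimirOn.bracket_grad_eq_zero`). For `v = -b₊` the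
direction is the vector field of `h'`, so `a₊` moves by `-[b₊, a]₊`.

Both halves of the loop algebra are subalgebras, so `[a - a₊, b - b₊]₊ = 0` and `[a₊, b₊]₊ = [a₊,
b₊]`. Expanding the first relation with `[a, b] = 0` yields the zero-curvature identity `-[a₊, b]₊ +
[b₊, a]₊ + [a₊, b₊] = 0` (`IsCasimirOn.gradPlus_curvature`). Acting on `l` through `ad*`, it says
that the two vector fields commute (`IsCasimirOn.flow_commute`); evaluated at `λ` in the closed
disc, it is the Lax relation (`IsCasimirOn.laxAt`). The Hamiltonian form comes from `R = P₊ - 1/2`: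
the multiple of the identity contributes nothing on Casimir gradients, so `{h, f}_R` is the
derivative of `f` along `-ad*_{a₊} l` (`IsCasimirOn.pairing_flowField`).

For the linear system, the commutator of `∂/∂t + B` and `∂/∂y + A` is a field in the `x`-directions
alone, minus the curvature (`opT_opY_sub`). Test functions whose gradient has a single nonzero
component recover every component of the curvature. Conversely, zero curvature is what makes the
mixed second-order Taylor coefficient of `ψ` well defined, and a Taylor polynomial of order two then
serves as `ψ` (`linearCompatibleAt_of_laxAt`).

Two analytic points support this. First, `ad*_a l` must exist as a smooth loop depending smoothly on
`a` and `l`. Integration by parts turns the Sobolev form into the `L²` form with a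
constant-coefficient operator whose symbol is at least `1`, and Fourier series invert it
(`sobolevOp_sobolevInv`, `coad_eq`); nondegeneracy of the pairing gives uniqueness. Second, loops
carry no norm here. Derivatives are therefore taken through Hadamard factorizations `c s = c s₀ + (s
- s₀) M s` with `M` a smooth family, and families are pushed into `U` by a cutoff reparametrization
(`SmoothFam.exists_localization`). -/

noncomputable section

namespace LoopTorus

/-! ### Calculus of smooth functions on the torus -/

/-- The period box of the torus. -/
abbrev periodBox (n : ℕ) : Set (Fin n → ℝ) := Set.Icc (0 : Fin n → ℝ) (fun _ => 2 * Real.pi)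

/-- Joint smoothness of a family of scalar functions of `x`. -/
def SmoothParam {n : ℕ} {E : Type} [NormedAddCommGroup E] [NormedSpace ℝ E]
    (G : E → (Fin n → ℝ) → ℂ) : Prop :=
  ContDiff ℝ ∞ (fun w : E × (Fin n → ℝ) => G w.1 w.2)

section Param

variable {n : ℕ} {E : Type} [NormedAddCommGroup E] [NormedSpace ℝ E]

lemma SmoothParam.pd {G : E → (Fin n → ℝ) → ℂ} (hG : SmoothParam G) (j : Fin n) :
    SmoothParam (fun e => pd j (G e)) := by
  unfold SmoothParam LoopTorus.pd
  refine ContDiff.fderiv_apply (m := ∞) (f := fun (z : E × (Fin n → ℝ)) x => G z.1 x)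
    ?_ contDiff_snd contDiff_const (by simp)
  exact hG.comp ((contDiff_fst.comp contDiff_fst).prodMk contDiff_snd)

lemma SmoothParam.mul {G H : E → (Fin n → ℝ) → ℂ} (hG : SmoothParam G) (hH : SmoothParam H) :
    SmoothParam (fun e x => G e x * H e x) := ContDiff.mul hG hH

lemma SmoothParam.add {G H : E → (Fin n → ℝ) → ℂ} (hG : SmoothParam G) (hH : SmoothParam H) :
    SmoothParam (fun e x => G e x + H e x) := ContDiff.add hG hH

lemma SmoothParam.pd_iterate {G : E → (Fin n → ℝ) → ℂ} (hG : SmoothParam G) (j : Fin n) (m : ℕ) :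
    SmoothParam (fun e => (LoopTorus.pd j)^[m] (G e)) := by
  induction m with
  | zero => exact hG
  | succ m ih => simpa only [Function.iterate_succ_apply'] using ih.pd j

lemma SmoothParam.section_contDiff {G : E → (Fin n → ℝ) → ℂ} (hG : SmoothParam G) (e : E) :
    ContDiff ℝ ∞ (G e) := hG.comp (contDiff_const.prodMk contDiff_id)

end Param

variable {n : ℕ}

lemma _root_.ContDiff.pd {f : (Fin n → ℝ) → ℂ} (hf : ContDiff ℝ ∞ f) (j : Fin n) :
    ContDiff ℝ ∞ (LoopTorus.pd j f) :=
  ContDiff.fderiv_apply (m := ∞) (f := fun (_ : Fin n → ℝ) x => f x)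
    (hf.comp contDiff_snd) contDiff_id contDiff_const (by simp)

lemma hasDerivAt_line {f : (Fin n → ℝ) → ℂ} (hf : ContDiff ℝ ∞ f) (j : Fin n) (x : Fin n → ℝ) :
    HasDerivAt (fun s : ℝ => f (x + s • Pi.single j 1)) (pd j f x) 0 := by
  have h1 : HasFDerivAt f (fderiv ℝ f x) (x + (0 : ℝ) • Pi.single j 1) := by
    simpa using (hf.differentiable (by simp) x).hasFDerivAt
  have h2 : HasDerivAt (fun s : ℝ => x + s • (Pi.single j 1 : Fin n → ℝ)) (Pi.single j 1) 0 := by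
    simpa using ((hasDerivAt_id (0 : ℝ)).smul_const (Pi.single j 1 : Fin n → ℝ)).const_add x
  exact h1.comp_hasDerivAt (0 : ℝ) h2

lemma pd_add {f g : (Fin n → ℝ) → ℂ} (hf : ContDiff ℝ ∞ f) (hg : ContDiff ℝ ∞ g) (j : Fin n)
    (x : Fin n → ℝ) : pd j (fun z => f z + g z) x = pd j f x + pd j g x := by
  unfold pd
  rw [fderiv_fun_add (hf.differentiable (by simp) x) (hg.differentiable (by simp) x)]
  rfl

lemma pd_sub {f g : (Fin n → ℝ) → ℂ} (hf : ContDiff ℝ ∞ f) (hg : ContDiff ℝ ∞ g) (j : Fin n)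
    (x : Fin n → ℝ) : pd j (fun z => f z - g z) x = pd j f x - pd j g x := by
  unfold pd
  rw [fderiv_fun_sub (hf.differentiable (by simp) x) (hg.differentiable (by simp) x)]
  rfl

lemma pd_sum {ι : Type*} {s : Finset ι} {f : ι → (Fin n → ℝ) → ℂ}
    (hf : ∀ i ∈ s, ContDiff ℝ ∞ (f i)) (j : Fin n) (x : Fin n → ℝ) :
    pd j (fun z => ∑ i ∈ s, f i z) x = ∑ i ∈ s, pd j (f i) x := by
  unfold pd
  rw [fderiv_fun_sum fun i hi => (hf i hi).differentiable (by simp) x]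
  simp

lemma pd_mul {f g : (Fin n → ℝ) → ℂ} (hf : ContDiff ℝ ∞ f) (hg : ContDiff ℝ ∞ g) (j : Fin n)
    (x : Fin n → ℝ) : pd j (fun z => f z * g z) x = f x * pd j g x + g x * pd j f x := by
  unfold pd
  rw [fderiv_fun_mul (hf.differentiable (by simp) x) (hg.differentiable (by simp) x)]
  simp

lemma pd_const_mul (c : ℂ) {f : (Fin n → ℝ) → ℂ} (hf : ContDiff ℝ ∞ f) (j : Fin n)
    (x : Fin n → ℝ) : pd j (fun z => c * f z) x = c * pd j f x := by
  unfold pd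
  rw [fderiv_const_mul (hf.differentiable (by simp) x)]
  simp

lemma pd_comm {f : (Fin n → ℝ) → ℂ} (hf : ContDiff ℝ ∞ f) (i j : Fin n) (x : Fin n → ℝ) :
    pd i (pd j f) x = pd j (pd i f) x := by
  have hd : Differentiable ℝ (fderiv ℝ f) :=
    (hf.fderiv_right (m := ∞) (by simp)).differentiable (by simp)
  have key : ∀ i j : Fin n, pd i (pd j f) x =
      fderiv ℝ (fderiv ℝ f) x (Pi.single i 1) (Pi.single j 1) := by
    intro i j
    unfold pd
    rw [fderiv_clm_apply (hd x) (differentiableAt_const _)]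
    simp
  rw [key, key]
  exact (hf.contDiffAt.isSymmSndFDerivAt (by
    simp only [minSmoothness_of_isRCLikeNormedField]; exact WithTop.coe_le_coe.2 le_top)).eq _ _

lemma pd_translate (f : (Fin n → ℝ) → ℂ) (v : Fin n → ℝ) (j : Fin n) :
    pd j (fun z => f (v + z)) = fun z => pd j f (v + z) := by
  funext z
  unfold pd
  rw [fderiv_comp_add_left]

namespace IsTorusFun

variable {f g : (Fin n → ℝ) → ℂ}

lemma pd (hf : IsTorusFun f) (j : Fin n) : IsTorusFun (LoopTorus.pd j f) :=
  ⟨hf.1.pd j, fun x i => pd_periodic (fun x => hf.2 x i) j x⟩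

lemma mul (hf : IsTorusFun f) (hg : IsTorusFun g) : IsTorusFun (fun x => f x * g x) :=
  ⟨hf.1.mul hg.1, fun x j => by simp only [hf.2, hg.2]⟩

lemma add (hf : IsTorusFun f) (hg : IsTorusFun g) : IsTorusFun (fun x => f x + g x) :=
  ⟨hf.1.add hg.1, fun x j => by simp only [hf.2, hg.2]⟩

lemma sub (hf : IsTorusFun f) (hg : IsTorusFun g) : IsTorusFun (fun x => f x - g x) :=
  ⟨hf.1.sub hg.1, fun x j => by simp only [hf.2, hg.2]⟩

lemma const (c : ℂ) : IsTorusFun (fun _ : Fin n → ℝ => c) := ⟨contDiff_const, fun _ _ => rfl⟩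

lemma sum {ι : Type*} {s : Finset ι} {f : ι → (Fin n → ℝ) → ℂ} (hf : ∀ i ∈ s, IsTorusFun (f i)) :
    IsTorusFun (fun x => ∑ i ∈ s, f i x) :=
  ⟨ContDiff.sum fun i hi => (hf i hi).1, fun x j => Finset.sum_congr rfl fun i hi => (hf i hi).2 x j⟩

lemma translate (hf : IsTorusFun f) (v : Fin n → ℝ) : IsTorusFun (fun x => f (v + x)) :=
  ⟨hf.1.comp (contDiff_const.add contDiff_id), fun x j => by simp only [← add_assoc, hf.2]⟩

lemma pd_iterate (hf : IsTorusFun f) (j : Fin n) (m : ℕ) : IsTorusFun ((LoopTorus.pd j)^[m] f) := by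
  induction m with
  | zero => exact hf
  | succ m ih => simpa only [Function.iterate_succ_apply'] using ih.pd j

lemma integrableOn (hf : IsTorusFun f) : IntegrableOn f (periodBox n) :=
  hf.1.continuous.continuousOn.integrableOn_compact isCompact_Icc

end IsTorusFun

/-- The divergence theorem for the field `f e_j` on the period box: the values on the two faces
orthogonal to `e_j` agree by periodicity. -/
lemma IsTorusFun.integral_pd {f : (Fin n → ℝ) → ℂ} (hf : IsTorusFun f) (j : Fin n) :
    ∫ x in periodBox n, LoopTorus.pd j f x = 0 := by
  -- The index `j` forces `n > 0`; the divergence theorem lives on boxes in dimension `m + 1`.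
  obtain ⟨m, rfl⟩ : ∃ m, n = m + 1 := ⟨n - 1, by have := j.2; omega⟩
  have hle : (0 : Fin (m + 1) → ℝ) ≤ fun _ => 2 * Real.pi := fun _ => Real.two_pi_pos.le
  have h := integral_divergence_of_hasFDerivAt_off_countable' (0 : Fin (m + 1) → ℝ)
    (fun _ => 2 * Real.pi) hle (fun i => if i = j then f else 0)
    (fun i x => if i = j then fderiv ℝ f x else 0) ∅ Set.countable_empty
    (fun i => by
      split_ifs
      · exact hf.1.continuous.continuousOn
      · exact continuousOn_const)
    (fun x _ i => by
      split_ifs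
      · exact (hf.1.differentiable (by simp) x).hasFDerivAt
      · exact hasFDerivAt_const _ _)
  have e : ∀ x, (∑ i, (if i = j then fderiv ℝ f x else 0) (Pi.single i 1)) = LoopTorus.pd j f x := by
    intro x
    rw [Finset.sum_eq_single j (fun i _ hi => by simp [hi]) (by simp)]
    simp [LoopTorus.pd]
  simp only [e] at h
  rw [h (hf.pd j).integrableOn]
  refine Finset.sum_eq_zero fun i _ => ?_
  split_ifs with hi
  · subst hi
    rw [sub_eq_zero]
    refine integral_congr_ae (Filter.Eventually.of_forall fun x => ?_)
    dsimp only
    have : (Fin.insertNth i (2 * Real.pi) x : Fin (m + 1) → ℝ) =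
        Fin.insertNth i ((0 : Fin (m + 1) → ℝ) i) x + Pi.single i (2 * Real.pi) := by
      funext k
      refine Fin.succAboveCases i ?_ (fun k => ?_) k
      · simp
      · simp
    rw [this, hf.2]
  · simp

lemma IsTorusFun.integral_pd_mul {f g : (Fin n → ℝ) → ℂ} (hf : IsTorusFun f) (hg : IsTorusFun g)
    (j : Fin n) :
    ∫ x in periodBox n, LoopTorus.pd j f x * g x = -∫ x in periodBox n, f x * LoopTorus.pd j g x := by
  have h := (hf.mul hg).integral_pd j
  simp only [pd_mul hf.1 hg.1] at h
  rw [integral_add (hf.mul (hg.pd j)).integrableOn (hg.mul (hf.pd j)).integrableOn] at h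
  rw [eq_neg_iff_add_eq_zero, add_comm, ← h]
  simp only [mul_comm (g _)]

lemma IsTorusFun.integral_pd_iterate_mul {f g : (Fin n → ℝ) → ℂ} (hf : IsTorusFun f)
    (hg : IsTorusFun g) (j : Fin n) (m : ℕ) :
    ∫ x in periodBox n, (LoopTorus.pd j)^[m] f x * g x =
      (-1) ^ m * ∫ x in periodBox n, f x * (LoopTorus.pd j)^[m] g x := by
  induction m generalizing f with
  | zero => simp
  | succ m ih =>
    rw [Function.iterate_succ_apply, ih (hf.pd j), hf.integral_pd_mul (hg.pd_iterate j m),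
      Function.iterate_succ_apply', pow_succ]
    ring

/-! ### The Sobolev form as an `L²` form with a differential operator. -/

/-- The differentiations of `pdPow`, taken in the opposite order. -/
def pdPowAdj (α : Fin n → ℕ) (f : (Fin n → ℝ) → ℂ) : (Fin n → ℝ) → ℂ :=
  (List.finRange n).foldl (fun g j => (pd j)^[α j] g) f

lemma pdPow_induction {Q : ((Fin n → ℝ) → ℂ) → Prop} (hQ : ∀ j f, Q f → Q (pd j f))
    (α : Fin n → ℕ) {f : (Fin n → ℝ) → ℂ} (hf : Q f) : Q (pdPow α f) := by
  have hit : ∀ j m g, Q g → Q ((pd j)^[m] g) := by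
    intro j m g hg
    induction m with
    | zero => exact hg
    | succ m ih => rw [Function.iterate_succ_apply']; exact hQ _ _ ih
  unfold pdPow
  induction List.finRange n with
  | nil => exact hf
  | cons j L ih => exact hit _ _ _ ih

lemma pdPowAdj_induction {Q : ((Fin n → ℝ) → ℂ) → Prop} (hQ : ∀ j f, Q f → Q (pd j f))
    (α : Fin n → ℕ) {f : (Fin n → ℝ) → ℂ} (hf : Q f) : Q (pdPowAdj α f) := by
  have hit : ∀ j m g, Q g → Q ((pd j)^[m] g) := by
    intro j m g hg
    induction m with
    | zero => exact hg
    | succ m ih => rw [Function.iterate_succ_apply']; exact hQ _ _ ih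
  unfold pdPowAdj
  generalize List.finRange n = L
  induction L generalizing f with
  | nil => exact hf
  | cons j L ih => exact ih (hit _ _ _ hf)

lemma IsTorusFun.pdPow {f : (Fin n → ℝ) → ℂ} (hf : IsTorusFun f) (α : Fin n → ℕ) :
    IsTorusFun (pdPow α f) := pdPow_induction (fun j _ h => h.pd j) α hf

lemma IsTorusFun.pdPowAdj {f : (Fin n → ℝ) → ℂ} (hf : IsTorusFun f) (α : Fin n → ℕ) :
    IsTorusFun (pdPowAdj α f) := pdPowAdj_induction (fun j _ h => h.pd j) α hf

/-- Derivatives are moved across outermost first, so they land in the reverse order. Recording that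
order in `pdPowAdj` makes commutation of partial derivatives unnecessary. -/
lemma IsTorusFun.integral_pdPow_mul {f g : (Fin n → ℝ) → ℂ} (hf : IsTorusFun f)
    (hg : IsTorusFun g) (α : Fin n → ℕ) :
    ∫ x in periodBox n, LoopTorus.pdPow α f x * g x =
      (-1) ^ (∑ j, α j) * ∫ x in periodBox n, f x * LoopTorus.pdPowAdj α g x := by
  have hs : ∑ j, α j = ((List.finRange n).map α).sum := by
    rw [← List.sum_ofFn, List.ofFn_eq_map]
  have key : ∀ (L : List (Fin n)) (g : (Fin n → ℝ) → ℂ), IsTorusFun g →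
      IsTorusFun (L.foldr (fun j g => (LoopTorus.pd j)^[α j] g) f) ∧
      ∫ x in periodBox n, L.foldr (fun j g => (LoopTorus.pd j)^[α j] g) f x * g x =
      (-1) ^ (L.map α).sum *
        ∫ x in periodBox n, f x * L.foldl (fun g j => (LoopTorus.pd j)^[α j] g) g x := by
    intro L
    induction L with
    | nil => intro g _; simpa using hf
    | cons j L ih =>
      intro g hg
      have h1 := ih _ (hg.pd_iterate j (α j))
      refine ⟨h1.1.pd_iterate _ _, ?_⟩
      rw [List.foldr_cons, h1.1.integral_pd_iterate_mul hg, h1.2, List.map_cons, List.sum_cons,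
        pow_add, List.foldl_cons, mul_assoc]
  rw [hs]
  exact (key _ g hg).2

/-- The differential operator `∑ (-1)^|α| ∂^(2α)`, the sum over `α ∈ S`. -/
def sobolevOp (S : Finset (Fin n → ℕ)) (f : (Fin n → ℝ) → ℂ) (x : Fin n → ℝ) : ℂ :=
  ∑ α ∈ S, (-1) ^ (∑ j, α j) * pdPowAdj α (pdPow α f) x

lemma IsTorusFun.sobolevOp {f : (Fin n → ℝ) → ℂ} (hf : IsTorusFun f) (S : Finset (Fin n → ℕ)) :
    IsTorusFun (sobolevOp S f) :=
  IsTorusFun.sum fun α _ => (IsTorusFun.const _).mul ((hf.pdPow α).pdPowAdj α)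

/-- All derivatives are moved onto the first argument. The pairing then differs from an `L²` pairing
only by an operator acting on `x`, which is what makes the coadjoint action computable. -/
lemma sobolev_eq (q : ℕ) {f g : (Fin n → ℝ) → Fin n → ℂ} (hf : ∀ j, IsTorusFun fun z => f z j)
    (hg : ∀ j, IsTorusFun fun z => g z j) :
    sobolev q f g = ∑ j, ∫ x in periodBox n,
      sobolevOp (multiIndices n q) (fun z => f z j) x * g x j := by
  unfold sobolev
  refine Finset.sum_congr rfl fun j _ => ?_
  have : ∀ x, sobolevOp (multiIndices n q) (fun z => f z j) x * g x j =
      ∑ α ∈ multiIndices n q, (-1) ^ (∑ j, α j) *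
        (g x j * pdPowAdj α (pdPow α (fun z => f z j)) x) := by
    intro x
    rw [sobolevOp, Finset.sum_mul]
    exact Finset.sum_congr rfl fun _ _ => by ring
  simp only [this]
  rw [integral_finsetSum _ fun α _ =>
    ((IsTorusFun.const _).mul ((hg j).mul (((hf j).pdPow α).pdPowAdj α))).integrableOn]
  refine Finset.sum_congr rfl fun α _ => ?_
  rw [integral_const_mul, ← (hg j).integral_pdPow_mul ((hf j).pdPow α)]
  exact integral_congr_ae (Filter.Eventually.of_forall fun x => mul_comm _ _)

lemma SmoothParam.sobolevOp {E : Type} [NormedAddCommGroup E] [NormedSpace ℝ E]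
    {G : E → (Fin n → ℝ) → ℂ} (hG : SmoothParam G) (S : Finset (Fin n → ℕ)) :
    SmoothParam (fun e => LoopTorus.sobolevOp S (G e)) := by
  have h1 : ∀ α, SmoothParam (fun e => LoopTorus.pdPow α (G e)) := by
    intro α
    unfold LoopTorus.pdPow
    induction List.finRange n with
    | nil => exact hG
    | cons j L ih => exact ih.pd_iterate j (α j)
  have h2 : ∀ α (H : E → (Fin n → ℝ) → ℂ), SmoothParam H →
      SmoothParam (fun e => LoopTorus.pdPowAdj α (H e)) := by
    intro α
    unfold LoopTorus.pdPowAdj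
    induction List.finRange n with
    | nil => exact fun H hH => hH
    | cons j L ih => exact fun H hH => ih _ (hH.pd_iterate j (α j))
  exact ContDiff.sum fun α _ => contDiff_const.mul (h2 α _ (h1 α))

/-- The operator has constant coefficients. This reduces its inversion at a point `x` to Fourier
inversion at the origin for a translated function. -/
lemma sobolevOp_translate (S : Finset (Fin n → ℕ)) (f : (Fin n → ℝ) → ℂ) (v : Fin n → ℝ) :
    sobolevOp S (fun z => f (v + z)) = fun z => sobolevOp S f (v + z) := by
  have hit : ∀ j m (g : (Fin n → ℝ) → ℂ),
      (pd j)^[m] (fun z => g (v + z)) = fun z => (pd j)^[m] g (v + z) := by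
    intro j m g
    induction m with
    | zero => rfl
    | succ m ih => rw [Function.iterate_succ_apply', ih, pd_translate, Function.iterate_succ_apply']
  have h1 : ∀ α, pdPow α (fun z => f (v + z)) = fun z => pdPow α f (v + z) := by
    intro α
    unfold pdPow
    induction List.finRange n with
    | nil => rfl
    | cons j L ih => rw [List.foldr_cons, ih, hit, List.foldr_cons]
  have h2 : ∀ α (g : (Fin n → ℝ) → ℂ),
      pdPowAdj α (fun z => g (v + z)) = fun z => pdPowAdj α g (v + z) := by
    intro α
    unfold pdPowAdj
    induction List.finRange n with
    | nil => exact fun _ => rfl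
    | cons j L ih => intro g; rw [List.foldl_cons, hit, ih, List.foldl_cons]
  funext z
  simp only [sobolevOp, h1, h2]

end LoopTorus

namespace LoopTorus

/-! ### Fourier series on the torus and inversion of elliptic operators -/

section BoxIntegral

variable {n : ℕ} {E : Type} [NormedAddCommGroup E] [NormedSpace ℝ E] [FiniteDimensional ℝ E]

/-- Differentiation under the integral: the derivative of the integrand is continuous, hence bounded
on the product of a closed ball of parameters with the compact box. -/
lemma hasFDerivAt_boxIntegral {K : (Fin n → ℝ) → ℂ} (hK : Continuous K)
    {F : Type} [NormedAddCommGroup F] [NormedSpace ℝ F] [NormedSpace ℂ F]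
    [IsScalarTower ℝ ℂ F] [SMulCommClass ℝ ℂ F] [CompleteSpace F]
    {G : E × (Fin n → ℝ) → F} (hG : ContDiff ℝ ∞ G) (z : E) :
    HasFDerivAt (fun z => ∫ y in periodBox n, K y • G (z, y))
      (∫ y in periodBox n, K y • fderiv ℝ (fun z' => G (z', y)) z) z := by
  have hd : Continuous (fun w : E × (Fin n → ℝ) => fderiv ℝ (fun z' => G (z', w.2)) w.1) := by
    refine (ContDiff.fderiv (m := ∞) (n := 0) (f := fun (w : E × (Fin n → ℝ)) z' => G (z', w.2))
      ?_ contDiff_fst (by simp)).continuous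
    exact hG.comp (contDiff_snd.prodMk (contDiff_snd.comp contDiff_fst))
  have hc := isCompact_closedBall z 1
  obtain ⟨C, hC⟩ := (hc.prod (isCompact_Icc : IsCompact (periodBox n))).exists_bound_of_continuousOn
    (f := fun w : E × (Fin n → ℝ) => K w.2 • fderiv ℝ (fun z' => G (z', w.2)) w.1)
    ((hK.comp continuous_snd).smul hd).continuousOn
  refine hasFDerivAt_integral_of_dominated_of_fderiv_le
    (F := fun z y => K y • G (z, y))
    (F' := fun z y => K y • fderiv ℝ (fun z' => G (z', y)) z)
    (s := Metric.closedBall z 1) (bound := fun _ => C)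
    (Metric.closedBall_mem_nhds z one_pos) ?_ ?_ ?_ ?_ ?_ ?_
  · refine Filter.Eventually.of_forall fun z => Continuous.aestronglyMeasurable ?_
    exact hK.smul (hG.continuous.comp (by fun_prop))
  · exact (hK.smul (hG.continuous.comp (by fun_prop))).continuousOn.integrableOn_compact
      isCompact_Icc
  · exact (hK.smul (hd.comp
      (by fun_prop : Continuous fun y : Fin n → ℝ => (z, y)))).aestronglyMeasurable
  · exact (ae_restrict_iff' measurableSet_Icc).2 (Filter.Eventually.of_forall fun y hy z' hz' =>
      hC (z', y) ⟨hz', hy⟩)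
  · exact continuousOn_const.integrableOn_compact isCompact_Icc
  · refine Filter.Eventually.of_forall fun y z' _ => ?_
    have : DifferentiableAt ℝ (fun z' => G (z', y)) z' :=
      ((hG.comp (contDiff_id.prodMk contDiff_const)).differentiable (by simp)).differentiableAt
    exact this.hasFDerivAt.const_smul (K y)

/-- Induction on the order. The derivative is an integral of the same type with values in a space of
linear maps, so the target `F` has to vary inside the induction. -/
lemma contDiff_boxIntegral_nat {K : (Fin n → ℝ) → ℂ} (hK : Continuous K) (m : ℕ) :
    ∀ {F : Type} [NormedAddCommGroup F] [NormedSpace ℝ F] [NormedSpace ℂ F]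
    [IsScalarTower ℝ ℂ F] [SMulCommClass ℝ ℂ F] [CompleteSpace F]
    {G : E × (Fin n → ℝ) → F}, ContDiff ℝ ∞ G →
    ContDiff ℝ m (fun z => ∫ y in periodBox n, K y • G (z, y)) := by
  induction m with
  | zero =>
    intro F _ _ _ _ _ _ G hG
    exact contDiff_zero.2 (continuous_iff_continuousAt.2 fun z =>
      (hasFDerivAt_boxIntegral hK hG z).continuousAt)
  | succ m ih =>
    intro F _ _ _ _ _ _ G hG
    push_cast
    refine contDiff_succ_iff_hasFDerivAt.2 ⟨_, ?_, hasFDerivAt_boxIntegral hK hG⟩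
    refine ih (G := fun w : E × (Fin n → ℝ) => fderiv ℝ (fun z' => G (z', w.2)) w.1) ?_
    refine (ContDiff.fderiv (m := ∞) (n := ∞) (f := fun (w : E × (Fin n → ℝ)) z' => G (z', w.2))
        ?_ contDiff_fst (by simp))
    exact hG.comp (contDiff_snd.prodMk (contDiff_snd.comp contDiff_fst))

end BoxIntegral

variable {n : ℕ}

/-- The correlation `∫ K(y) f(x + y) dy` over the torus. -/
def boxConv (K : (Fin n → ℝ) → ℂ) (f : (Fin n → ℝ) → ℂ) (x : Fin n → ℝ) : ℂ :=
  ∫ y in periodBox n, K y * f (x + y)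

/-- All derivatives fall on the smooth factor, so continuity of the kernel is enough. This lets a
merely continuous Fourier kernel define an operator that preserves smoothness. -/
lemma SmoothParam.boxConv {E : Type} [NormedAddCommGroup E] [NormedSpace ℝ E]
    [FiniteDimensional ℝ E] {G : E → (Fin n → ℝ) → ℂ} (hG : SmoothParam G)
    {K : (Fin n → ℝ) → ℂ} (hK : Continuous K) :
    SmoothParam (fun e => LoopTorus.boxConv K (G e)) := by
  refine contDiff_infty.2 fun m => ?_
  refine contDiff_boxIntegral_nat hK m
    (G := fun w : (E × (Fin n → ℝ)) × (Fin n → ℝ) => G w.1.1 (w.1.2 + w.2)) ?_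
  exact hG.comp ((contDiff_fst.comp contDiff_fst).prodMk
    ((contDiff_snd.comp contDiff_fst).add contDiff_snd))

lemma IsTorusFun.boxConv {f : (Fin n → ℝ) → ℂ} (hf : IsTorusFun f)
    {K : (Fin n → ℝ) → ℂ} (hK : Continuous K) : IsTorusFun (LoopTorus.boxConv K f) := by
  refine ⟨?_, fun x j => ?_⟩
  · have : SmoothParam (fun _ : ℝ => f) := hf.1.comp contDiff_snd
    exact (this.boxConv hK).section_contDiff 0
  · unfold LoopTorus.boxConv
    refine integral_congr_ae (Filter.Eventually.of_forall fun y => ?_)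
    dsimp only
    rw [add_right_comm, hf.2]

lemma pd_boxConv {f : (Fin n → ℝ) → ℂ} (hf : IsTorusFun f)
    {K : (Fin n → ℝ) → ℂ} (hK : Continuous K) (j : Fin n) :
    pd j (boxConv K f) = boxConv K (pd j f) := by
  funext x
  have hG : ContDiff ℝ ∞ (fun w : (Fin n → ℝ) × (Fin n → ℝ) => f (w.1 + w.2)) :=
    hf.1.comp (contDiff_fst.add contDiff_snd)
  have h := hasFDerivAt_boxIntegral hK hG x
  have h' : fderiv ℝ (boxConv K f) x = _ := h.fderiv
  have hd : Continuous (fun y : Fin n → ℝ => fderiv ℝ (fun z' => f (z' + y)) x) := by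
    simp only [fderiv_comp_add_right]
    exact (hf.1.continuous_fderiv (by simp)).comp (by fun_prop)
  have hi : IntegrableOn (fun y => K y • fderiv ℝ (fun z' => f (z' + y)) x) (periodBox n) :=
    (hK.smul hd).continuousOn.integrableOn_compact isCompact_Icc
  rw [pd, h']
  refine (ContinuousLinearMap.integral_apply hi _).trans ?_
  refine integral_congr_ae (Filter.Eventually.of_forall fun y => ?_)
  simp only [smul_apply, smul_eq_mul, fderiv_comp_add_right, pd]

lemma pdPow_boxConv {f : (Fin n → ℝ) → ℂ} (hf : IsTorusFun f)
    {K : (Fin n → ℝ) → ℂ} (hK : Continuous K) (α : Fin n → ℕ) :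
    pdPow α (boxConv K f) = boxConv K (pdPow α f) ∧
      pdPowAdj α (boxConv K f) = boxConv K (pdPowAdj α f) := by
  have hit : ∀ j m {f : (Fin n → ℝ) → ℂ}, IsTorusFun f →
      (pd j)^[m] (boxConv K f) = boxConv K ((pd j)^[m] f) := by
    intro j m f hf
    induction m with
    | zero => rfl
    | succ m ih => rw [Function.iterate_succ_apply', ih, pd_boxConv (hf.pd_iterate j m) hK,
        Function.iterate_succ_apply']
  constructor
  · have : IsTorusFun (pdPow α f) ∧ pdPow α (boxConv K f) = boxConv K (pdPow α f) := by
      unfold pdPow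
      induction List.finRange n with
      | nil => exact ⟨hf, rfl⟩
      | cons j L ih =>
        refine ⟨ih.1.pd_iterate _ _, ?_⟩
        rw [List.foldr_cons, ih.2, hit _ _ ih.1, List.foldr_cons]
    exact this.2
  · unfold pdPowAdj
    generalize List.finRange n = L
    induction L generalizing f with
    | nil => rfl
    | cons j L ih => rw [List.foldl_cons, hit _ _ hf, ih (hf.pd_iterate _ _), List.foldl_cons]

lemma sobolevOp_boxConv {f : (Fin n → ℝ) → ℂ} (hf : IsTorusFun f)
    {K : (Fin n → ℝ) → ℂ} (hK : Continuous K) (S : Finset (Fin n → ℕ)) (x : Fin n → ℝ) :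
    sobolevOp S (boxConv K f) x = boxConv K (sobolevOp S f) x := by
  have e : boxConv K (sobolevOp S f) x = ∫ y in periodBox n,
      ∑ α ∈ S, (-1) ^ (∑ j, α j) * (K y * pdPowAdj α (pdPow α f) (x + y)) := by
    refine integral_congr_ae (Filter.Eventually.of_forall fun y => ?_)
    simp only [sobolevOp, Finset.mul_sum]
    exact Finset.sum_congr rfl fun _ _ => by ring
  rw [e, integral_finsetSum]
  · refine Finset.sum_congr rfl fun α _ => ?_
    rw [(pdPow_boxConv hf hK α).1, (pdPow_boxConv (hf.pdPow α) hK α).2, integral_const_mul]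
    rfl
  · intro α _
    have h : Continuous (pdPowAdj α (pdPow α f)) := ((hf.pdPow α).pdPowAdj α).1.continuous
    exact Continuous.integrableOn_Icc (by fun_prop)

/-! ### Characters and Fourier coefficients on the torus. -/

/-- The character `exp (i k · y)` of the torus. -/
def character (k : Fin n → ℤ) (y : Fin n → ℝ) : ℂ := exp (I * ∑ j, (k j : ℂ) * y j)

lemma norm_character (k : Fin n → ℤ) (y : Fin n → ℝ) : ‖character k y‖ = 1 := by
  have := Complex.norm_exp_ofReal_mul_I (∑ j, (k j : ℝ) * y j)
  rw [← this, character]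
  congr 2
  push_cast
  ring

lemma isTorusFun_character (k : Fin n → ℤ) : IsTorusFun (character k) := by
  refine ⟨?_, fun x j => ?_⟩
  · unfold character
    refine ContDiff.cexp (contDiff_const.mul (ContDiff.sum fun j _ => contDiff_const.mul ?_))
    exact ofRealCLM.contDiff.comp (contDiff_apply ℝ ℝ j)
  · unfold character
    have : (∑ i, (k i : ℂ) * ((x + Pi.single j (2 * Real.pi) : Fin n → ℝ) i : ℂ)) =
        ∑ i, (k i : ℂ) * (x i : ℂ) + k j * (2 * Real.pi) := by
      simp only [Pi.add_apply, ofReal_add, mul_add, Finset.sum_add_distrib]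
      congr 1
      rw [Finset.sum_eq_single j (fun i _ hi => by simp [hi]) (by simp)]
      simp
    rw [this, Complex.exp_eq_exp_iff_exists_int]
    exact ⟨k j, by ring⟩

lemma pd_character (k : Fin n → ℤ) (j : Fin n) (y : Fin n → ℝ) :
    pd j (character k) y = I * k j * character k y := by
  have h := hasDerivAt_line (isTorusFun_character k).1 j y
  have e : ∀ s : ℝ, character k (y + s • Pi.single j 1) =
      character k y * exp ((s : ℂ) * (I * k j)) := by
    intro s
    rw [character, character, ← Complex.exp_add]
    congr 1
    simp only [Pi.add_apply, Pi.smul_apply, ofReal_add, mul_add, Finset.sum_add_distrib]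
    congr 1
    rw [Finset.sum_eq_single j (fun i _ hi => by simp [hi]) (by simp)]
    simp
    ring
  simp only [e] at h
  have h0 : HasDerivAt (fun φ : ℝ => (φ : ℂ)) 1 (0 : ℝ) := Complex.ofRealCLM.hasDerivAt
  have h2 := (h0.mul_const (I * (k j : ℂ))).cexp.const_mul (character k y)
  rw [h.unique h2]
  simp
  ring

/-- The Fourier coefficients of a function on the torus, up to normalization. -/
def torusCoeff (g : (Fin n → ℝ) → ℂ) (k : Fin n → ℤ) : ℂ :=
  ∫ y in periodBox n, character k y * g y

/-- Integration by parts against the character; since the character is not conjugated, the factor is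
`-i k_j` instead of `i k_j`. -/
lemma torusCoeff_pd {g : (Fin n → ℝ) → ℂ} (hg : IsTorusFun g) (j : Fin n) (k : Fin n → ℤ) :
    torusCoeff (pd j g) k = -(I * k j) * torusCoeff g k := by
  have h := (isTorusFun_character k).integral_pd_mul hg j
  unfold torusCoeff
  rw [← neg_eq_iff_eq_neg.2 h, ← integral_const_mul, ← integral_neg]
  refine integral_congr_ae (Filter.Eventually.of_forall fun y => ?_)
  simp only [pd_character]
  ring

lemma torusCoeff_pd_iterate {g : (Fin n → ℝ) → ℂ} (hg : IsTorusFun g) (j : Fin n)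
    (k : Fin n → ℤ) (m : ℕ) :
    torusCoeff ((pd j)^[m] g) k = (-(I * k j)) ^ m * torusCoeff g k := by
  induction m with
  | zero => simp
  | succ m ih =>
    rw [Function.iterate_succ_apply', torusCoeff_pd (hg.pd_iterate j m), ih, pow_succ]
    ring

lemma torusCoeff_pdPow {g : (Fin n → ℝ) → ℂ} (hg : IsTorusFun g) (α : Fin n → ℕ)
    (k : Fin n → ℤ) :
    torusCoeff (pdPow α g) k = (∏ j, (-(I * k j)) ^ α j) * torusCoeff g k := by
  have : IsTorusFun (pdPow α g) ∧ torusCoeff (pdPow α g) k =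
      ((List.finRange n).map fun j => (-(I * k j)) ^ α j).prod * torusCoeff g k := by
    unfold pdPow
    induction List.finRange n with
    | nil => simpa using hg
    | cons j L ih =>
      refine ⟨ih.1.pd_iterate _ _, ?_⟩
      rw [List.foldr_cons, torusCoeff_pd_iterate ih.1, ih.2, List.map_cons, List.prod_cons,
        mul_assoc]
  rw [this.2, ← List.ofFn_eq_map, List.prod_ofFn]

lemma torusCoeff_pdPowAdj {g : (Fin n → ℝ) → ℂ} (hg : IsTorusFun g) (α : Fin n → ℕ)
    (k : Fin n → ℤ) :
    torusCoeff (pdPowAdj α g) k = (∏ j, (-(I * k j)) ^ α j) * torusCoeff g k := by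
  have : torusCoeff (pdPowAdj α g) k =
      ((List.finRange n).map fun j => (-(I * k j)) ^ α j).prod * torusCoeff g k := by
    unfold pdPowAdj
    generalize List.finRange n = L
    induction L generalizing g with
    | nil => simp
    | cons j L ih =>
      rw [List.foldl_cons, ih (hg.pd_iterate _ _), torusCoeff_pd_iterate hg, List.map_cons,
        List.prod_cons]
      ring
  rw [this, ← List.ofFn_eq_map, List.prod_ofFn]

/-- The symbol of `sobolevOp S`. -/
def sobolevSymbol (S : Finset (Fin n → ℕ)) (k : Fin n → ℤ) : ℝ :=
  ∑ α ∈ S, ∏ j, ((k j : ℝ) ^ 2) ^ α j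

/-- The index `α = 0` contributes `1` and the other terms are nonnegative, so no Fourier mode is
lost and the operator can be inverted. -/
lemma one_le_sobolevSymbol {S : Finset (Fin n → ℕ)} (hS : 0 ∈ S) (k : Fin n → ℤ) :
    1 ≤ sobolevSymbol S k := by
  have := Finset.single_le_sum (s := S) (f := fun α : Fin n → ℕ => ∏ j, ((k j : ℝ) ^ 2) ^ α j)
    (fun α _ => Finset.prod_nonneg fun j _ => by positivity) hS
  refine le_trans (le_of_eq ?_) this
  simp

/-- The sign `(-1)^|α|` cancels the sign in `(-i k)^(2α)`, which leaves a sum of squares as the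
symbol. -/
lemma torusCoeff_sobolevOp {g : (Fin n → ℝ) → ℂ} (hg : IsTorusFun g) (S : Finset (Fin n → ℕ))
    (k : Fin n → ℤ) : torusCoeff (sobolevOp S g) k = sobolevSymbol S k * torusCoeff g k := by
  have e : torusCoeff (sobolevOp S g) k = ∫ y in periodBox n, ∑ α ∈ S, (-1) ^ (∑ j, α j) *
      (character k y * pdPowAdj α (pdPow α g) y) := by
    refine integral_congr_ae (Filter.Eventually.of_forall fun y => ?_)
    simp only [sobolevOp, Finset.mul_sum]
    exact Finset.sum_congr rfl fun _ _ => by ring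
  rw [e, integral_finsetSum _ fun α _ => ((IsTorusFun.const _).mul
    ((isTorusFun_character k).mul ((hg.pdPow α).pdPowAdj α))).integrableOn, sobolevSymbol]
  push_cast
  rw [Finset.sum_mul]
  refine Finset.sum_congr rfl fun α _ => ?_
  rw [integral_const_mul]
  change _ * torusCoeff _ _ = _
  rw [torusCoeff_pdPowAdj (hg.pdPow α), torusCoeff_pdPow hg, ← Finset.prod_pow_eq_pow_sum,
    ← mul_assoc, ← mul_assoc, ← Finset.prod_mul_distrib, ← Finset.prod_mul_distrib]
  congr 1
  refine Finset.prod_congr rfl fun j _ => ?_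
  rw [← mul_pow, ← mul_pow]
  congr 1
  linear_combination (-(k j : ℂ) ^ 2) * I_sq

lemma norm_torusCoeff_le (g : (Fin n → ℝ) → ℂ) :
    ∃ C, ∀ k, ‖torusCoeff g k‖ ≤ C := by
  refine ⟨∫ y in periodBox n, ‖g y‖, fun k => ?_⟩
  refine (norm_integral_le_integral_norm _).trans (le_of_eq ?_)
  simp only [norm_mul, norm_character, one_mul]

/-- The multi-indices with entries `0` and `1`. -/
def binaryIndices (n : ℕ) : Finset (Fin n → ℕ) := Fintype.piFinset fun _ => Finset.range 2

/-- Expanding the product gives one term for each subset of the coordinates. In every dimension this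
symbol grows fast enough to have a summable inverse. -/
lemma sobolevSymbol_binaryIndices (k : Fin n → ℤ) :
    sobolevSymbol (binaryIndices n) k = ∏ j, (1 + (k j : ℝ) ^ 2) := by
  have := Finset.prod_univ_sum (fun _ : Fin n => Finset.range 2)
    (fun j m => ((k j : ℝ) ^ 2) ^ m)
  rw [sobolevSymbol, binaryIndices, ← this]
  simp [Finset.sum_range_succ]

/-- Every finite set of indices lies in the product of its coordinate projections, over which the
sum factors into one-dimensional sums. -/
lemma summable_pi_prod {f : ℤ → ℝ} (hf : Summable f) (h0 : ∀ k, 0 ≤ f k) :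
    Summable (fun k : Fin n → ℤ => ∏ j, f (k j)) := by
  refine summable_of_sum_le (c := ∏ _j : Fin n, ∑' k, f k)
    (fun k => Finset.prod_nonneg fun j _ => h0 _) fun s => ?_
  have hsub : s ⊆ Fintype.piFinset fun j => s.image fun k => k j := fun k hk =>
    Fintype.mem_piFinset.2 fun j => Finset.mem_image_of_mem _ hk
  refine (Finset.sum_le_sum_of_subset_of_nonneg hsub fun k _ _ =>
    Finset.prod_nonneg fun j _ => h0 _).trans ?_
  rw [← Finset.prod_univ_sum (fun j => s.image fun k => k j) (fun _ m => f m)]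
  exact Finset.prod_le_prod (fun j _ => Finset.sum_nonneg fun _ _ => h0 _)
    fun j _ => hf.sum_le_tsum _ fun _ _ => h0 _

lemma summable_inv_binarySymbol :
    Summable (fun k : Fin n → ℤ => (sobolevSymbol (binaryIndices n) k)⁻¹) := by
  simp only [sobolevSymbol_binaryIndices, ← Finset.prod_inv_distrib]
  refine summable_pi_prod (f := fun k : ℤ => (1 + (k : ℝ) ^ 2)⁻¹) ?_ fun k => by positivity
  refine Summable.of_norm_bounded_eventually (Real.summable_one_div_int_pow.2 one_lt_two) ?_
  have : ({0}ᶜ : Set ℤ) ∈ Filter.cofinite := (Set.finite_singleton 0).compl_mem_cofinite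
  filter_upwards [this] with k hk
  have : (0 : ℝ) < (k : ℝ) ^ 2 := by
    have : (k : ℝ) ≠ 0 := by exact_mod_cast hk
    positivity
  rw [Real.norm_of_nonneg (by positivity), one_div]
  exact inv_anti₀ this (by linarith)

/-- Applying the product of the operators `1 - ∂_j²` to `g` leaves bounded coefficients, so those of
`g` decay like the inverse of `∏ (1 + k_j²)`. -/
lemma summable_torusCoeff {g : (Fin n → ℝ) → ℂ} (hg : IsTorusFun g) : Summable (torusCoeff g) := by
  obtain ⟨C, hC⟩ := norm_torusCoeff_le (sobolevOp (binaryIndices n) g)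
  refine Summable.of_norm_bounded (summable_inv_binarySymbol.mul_right C) fun k => ?_
  have h1 : 1 ≤ sobolevSymbol (binaryIndices n) k :=
    one_le_sobolevSymbol (by simp [binaryIndices]) k
  have h2 := hC k
  rw [torusCoeff_sobolevOp hg, norm_mul, Complex.norm_real, Real.norm_of_nonneg (by linarith)] at h2
  rw [inv_mul_eq_div, le_div_iff₀ (by linarith), mul_comm]
  exact h2

lemma periodic_int {g : (Fin n → ℝ) → ℂ} (hg : ∀ x j, g (x + Pi.single j (2 * Real.pi)) = g x)
    (x : Fin n → ℝ) (m : Fin n → ℤ) : g (x + fun j => m j * (2 * Real.pi)) = g x := by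
  have h1 : ∀ j (r : ℤ) x, g (x + Pi.single j (r * (2 * Real.pi))) = g x := by
    intro j r x
    have hp : Function.Periodic (fun s : ℝ => g (x + Pi.single j s)) (2 * Real.pi) := by
      intro s
      dsimp only
      rw [Pi.single_add, ← add_assoc, hg]
    have := hp.int_mul r 0
    simpa using this
  have h2 : ∀ s : Finset (Fin n), g (x + ∑ j ∈ s, Pi.single j (m j * (2 * Real.pi))) = g x := by
    intro s
    induction s using Finset.induction_on with
    | empty => simp
    | insert j s hj ih => rw [Finset.sum_insert hj, add_comm (Pi.single j _), ← add_assoc, h1, ih]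
  have := h2 Finset.univ
  rwa [Finset.univ_sum_single fun j => (m j : ℝ) * (2 * Real.pi)] at this

-- Fourier inversion, needed only at the origin since the other points follow by translation. The
-- function is rescaled to period `1` and descended to the unit torus, where pointwise convergence
-- follows from summable coefficients.
open scoped Pointwise in
lemma hasSum_torusCoeff {g : (Fin n → ℝ) → ℂ} (hg : IsTorusFun g) :
    HasSum (torusCoeff g) ((2 * Real.pi : ℂ) ^ n * g 0) := by
  have hq : IsOpenQuotientMap (Pi.map fun (_ : Fin n) (s : ℝ) => (s : UnitAddCircle)) :=
    IsOpenQuotientMap.piMap fun _ => QuotientAddGroup.isOpenQuotientMap_mk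
  set π : (Fin n → ℝ) → UnitAddTorus (Fin n) := Pi.map fun (_ : Fin n) (s : ℝ) => (s : UnitAddCircle)
  set G : (Fin n → ℝ) → ℂ := fun x => g ((2 * Real.pi) • x) with hG
  have hGc : Continuous G := hg.1.continuous.comp (by fun_prop)
  have hfac : ∀ x y, π x = π y → G x = G y := by
    intro x y hxy
    have h1 : ∀ j, ∃ m : ℤ, (m : ℝ) = y j - x j := by
      intro j
      have h := congrFun hxy j
      have h2 : ((x j : ℝ) : UnitAddCircle) = ((y j : ℝ) : UnitAddCircle) := h
      rw [QuotientAddGroup.eq] at h2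
      obtain ⟨m, hm⟩ := AddSubgroup.mem_zmultiples_iff.1 h2
      refine ⟨m, ?_⟩
      rw [zsmul_one] at hm
      linarith
    choose m hm using h1
    have : (2 * Real.pi) • y = (2 * Real.pi) • x + fun j => (m j : ℝ) * (2 * Real.pi) := by
      funext j
      simp [hm]
      ring
    simp only [hG]
    rw [this, periodic_int hg.2]
  have hlift : ∃ f : C(UnitAddTorus (Fin n), ℂ), ∀ x, f (π x) = G x := by
    refine ⟨hq.isQuotientMap.lift (f := ⟨π, hq.continuous⟩) ⟨G, hGc⟩ hfac, fun x => ?_⟩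
    exact congrFun (congrArg DFunLike.coe (hq.isQuotientMap.lift_comp (f := ⟨π, hq.continuous⟩) ⟨G, hGc⟩ hfac)) x
  obtain ⟨f, hf⟩ := hlift
  have hpi : (2 * Real.pi : ℂ) ≠ 0 := by
    exact_mod_cast Real.two_pi_pos.ne'
  -- The index is negated because `torusCoeff` integrates against the unconjugated character; the
  -- power of `2π` is the Jacobian of the rescaling.
  have hco : ∀ k, UnitAddTorus.mFourierCoeff f (-k) = ((2 * Real.pi : ℂ) ^ n)⁻¹ * torusCoeff g k := by
    intro k
    rw [UnitAddTorus.mFourierCoeff_eq_integral _ _ (fun _ => 0), neg_neg]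
    have hset : {x : Fin n → ℝ | ∀ i, x i ∈ Set.Ioc (0 : ℝ) (0 + 1)} =ᵐ[volume]
        Set.Icc (0 : Fin n → ℝ) 1 := by
      have : {x : Fin n → ℝ | ∀ i, x i ∈ Set.Ioc (0 : ℝ) (0 + 1)} =
        Set.pi Set.univ fun i => Set.Ioc ((0 : Fin n → ℝ) i) ((1 : Fin n → ℝ) i) := by
        ext x; simp
      rw [this]
      exact Measure.univ_pi_Ioc_ae_eq_Icc
    rw [setIntegral_congr_set hset]
    have hI : ∀ x : Fin n → ℝ, UnitAddTorus.mFourier k (fun i => (x i : UnitAddCircle)) •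
        f (fun i => (x i : UnitAddCircle)) =
        (fun y => character k y * g y) ((2 * Real.pi) • x) := by
      intro x
      have := hf x
      change f (fun i => (x i : UnitAddCircle)) = _ at this
      rw [this, smul_eq_mul]
      dsimp only [hG]
      congr 1
      simp only [UnitAddTorus.mFourier, ContinuousMap.coe_mk, fourier_coe_apply, character]
      rw [← Complex.exp_sum]
      congr 1
      rw [Finset.mul_sum]
      refine Finset.sum_congr rfl fun j _ => ?_
      simp
      ring
    simp only [hI]
    rw [Measure.setIntegral_comp_smul_of_pos volume (fun y => character k y * g y) _
      Real.two_pi_pos]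
    have hbox : (2 * Real.pi) • Set.Icc (0 : Fin n → ℝ) 1 = periodBox n := by
      ext x
      rw [Set.mem_smul_set_iff_inv_smul_mem₀ Real.two_pi_pos.ne']
      simp only [Set.mem_Icc, Pi.le_def, Pi.smul_apply, smul_eq_mul, Pi.zero_apply, Pi.one_apply,
        inv_mul_eq_div, div_le_one Real.two_pi_pos, le_div_iff₀ Real.two_pi_pos, zero_mul]
    rw [hbox]
    simp [torusCoeff, Complex.real_smul]
  have hs : Summable (UnitAddTorus.mFourierCoeff f) := by
    rw [← (Equiv.neg (Fin n → ℤ)).summable_iff]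
    refine ((summable_torusCoeff hg).mul_left ((2 * Real.pi : ℂ) ^ n)⁻¹).congr fun k => ?_
    exact (hco k).symm
  have h := UnitAddTorus.hasSum_mFourier_series_apply_of_summable hs (π 0)
  rw [← (Equiv.neg (Fin n → ℤ)).hasSum_iff, hf] at h
  have hm : ∀ k, UnitAddTorus.mFourier k (π 0) = 1 := by
    intro k
    simp [UnitAddTorus.mFourier, π]
  have h1 := h.mul_left ((2 * Real.pi : ℂ) ^ n)
  have hG0 : G 0 = g 0 := by simp [hG]
  rw [hG0] at h1
  refine h1.congr_fun fun k => ?_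
  simp only [Function.comp_apply, Equiv.neg_apply, hco, hm]
  rw [smul_eq_mul, mul_one, ← mul_assoc, mul_inv_cancel₀ (pow_ne_zero _ hpi), one_mul]

/-! ### Inversion of the Sobolev operator. -/

/-- The kernel of the inverse of `sobolevOp S`, applied after `sobolevOp (binaryIndices n)`. -/
def sobolevKernel (S : Finset (Fin n → ℕ)) (y : Fin n → ℝ) : ℂ :=
  ∑' k : Fin n → ℤ, (((2 * Real.pi : ℂ) ^ n)⁻¹ *
    (sobolevSymbol S k * sobolevSymbol (binaryIndices n) k : ℂ)⁻¹) * character k y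

lemma norm_sobolevKernel_term_le {S : Finset (Fin n → ℕ)} (hS : 0 ∈ S) (k : Fin n → ℤ)
    (y : Fin n → ℝ) :
    ‖(((2 * Real.pi : ℂ) ^ n)⁻¹ *
      (sobolevSymbol S k * sobolevSymbol (binaryIndices n) k : ℂ)⁻¹) * character k y‖ ≤
      ‖((2 * Real.pi : ℂ) ^ n)⁻¹‖ * (sobolevSymbol (binaryIndices n) k)⁻¹ := by
  have h1 := one_le_sobolevSymbol hS k
  have h2 : 1 ≤ sobolevSymbol (binaryIndices n) k :=
    one_le_sobolevSymbol (by simp [binaryIndices]) k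
  rw [norm_mul, norm_mul, norm_character, mul_one, norm_inv (_ * _), norm_mul, Complex.norm_real,
    Complex.norm_real, Real.norm_of_nonneg (by linarith), Real.norm_of_nonneg (by linarith)]
  gcongr
  exact le_mul_of_one_le_left (by linarith) h1

/-- The inverse symbol of `S` alone need not be summable (for `q = 0` it is `1`). The additional
factor from `binaryIndices` makes the series converge uniformly, and `sobolevInv` compensates for it
by differentiating `f` first. -/
lemma continuous_sobolevKernel {S : Finset (Fin n → ℕ)} (hS : 0 ∈ S) :
    Continuous (sobolevKernel S) :=
  continuous_tsum (fun k => continuous_const.mul (isTorusFun_character k).1.continuous)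
    (summable_inv_binarySymbol.mul_left _) (norm_sobolevKernel_term_le hS)

/-- The inverse of `sobolevOp S` on smooth functions on the torus. -/
def sobolevInv (S : Finset (Fin n → ℕ)) (f : (Fin n → ℝ) → ℂ) : (Fin n → ℝ) → ℂ :=
  boxConv (sobolevKernel S) (sobolevOp (binaryIndices n) f)

lemma IsTorusFun.sobolevInv {f : (Fin n → ℝ) → ℂ} (hf : IsTorusFun f) {S : Finset (Fin n → ℕ)}
    (hS : 0 ∈ S) : IsTorusFun (sobolevInv S f) :=
  (hf.sobolevOp _).boxConv (continuous_sobolevKernel hS)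

lemma SmoothParam.sobolevInv {E : Type} [NormedAddCommGroup E] [NormedSpace ℝ E]
    [FiniteDimensional ℝ E] {G : E → (Fin n → ℝ) → ℂ} (hG : SmoothParam G)
    {S : Finset (Fin n → ℕ)} (hS : 0 ∈ S) : SmoothParam (fun e => LoopTorus.sobolevInv S (G e)) :=
  (hG.sobolevOp _).boxConv (continuous_sobolevKernel hS)

/-- The kernel series is integrated term by term. On each mode the two symbols produced by the
operators cancel the denominator, and what remains is Fourier inversion at the origin for the
translate of `f` by `x`. -/
lemma boxConv_sobolevKernel {S : Finset (Fin n → ℕ)} (hS : 0 ∈ S) {f : (Fin n → ℝ) → ℂ}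
    (hf : IsTorusFun f) (x : Fin n → ℝ) :
    boxConv (sobolevKernel S) (sobolevOp S (sobolevOp (binaryIndices n) f)) x = f x := by
  have hT := (hf.translate x)
  set h : (Fin n → ℝ) → ℂ := sobolevOp S (sobolevOp (binaryIndices n) fun z => f (x + z)) with hh
  have hc : Continuous h := ((hT.sobolevOp _).sobolevOp S).1.continuous
  have hpi : (2 * Real.pi : ℂ) ≠ 0 := by
    exact_mod_cast Real.two_pi_pos.ne'
  have e : boxConv (sobolevKernel S) (sobolevOp S (sobolevOp (binaryIndices n) f)) x =
      ∫ y in periodBox n, sobolevKernel S y * h y := by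
    rw [hh, sobolevOp_translate, sobolevOp_translate]
    rfl
  obtain ⟨C, hC⟩ := (isCompact_Icc : IsCompact (periodBox n)).exists_bound_of_continuousOn
    hc.continuousOn
  have hsum : HasSum (fun k : Fin n → ℤ => ∫ y in periodBox n, ((((2 * Real.pi : ℂ) ^ n)⁻¹ *
      (sobolevSymbol S k * sobolevSymbol (binaryIndices n) k : ℂ)⁻¹) * character k y) * h y)
      (∫ y in periodBox n, sobolevKernel S y * h y) := by
    have hsb := (summable_inv_binarySymbol (n := n)).mul_left ‖((2 * Real.pi : ℂ) ^ n)⁻¹‖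
    refine hasSum_integral_of_dominated_convergence
      (fun k _ => ‖((2 * Real.pi : ℂ) ^ n)⁻¹‖ * (sobolevSymbol (binaryIndices n) k)⁻¹ * C)
      (fun k => ?_) (fun k => ?_) ?_ ?_ ?_
    · exact ((continuous_const.mul (isTorusFun_character k).1.continuous).mul
        hc).aestronglyMeasurable
    · refine (ae_restrict_iff' measurableSet_Icc).2 (Filter.Eventually.of_forall fun y hy => ?_)
      rw [norm_mul]
      exact mul_le_mul (norm_sobolevKernel_term_le hS k y) (hC y hy) (norm_nonneg _)
        ((norm_nonneg _).trans (norm_sobolevKernel_term_le hS k y))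
    · exact Filter.Eventually.of_forall fun y => hsb.mul_right C
    · exact continuousOn_const.integrableOn_compact isCompact_Icc
    · refine Filter.Eventually.of_forall fun y => ?_
      exact (Summable.of_norm_bounded hsb
        (norm_sobolevKernel_term_le hS · y)).hasSum.mul_right _
  have h2 := (hasSum_torusCoeff hT).mul_left ((2 * Real.pi : ℂ) ^ n)⁻¹
  rw [e]
  refine hsum.unique ?_
  rw [← mul_assoc, inv_mul_cancel₀ (pow_ne_zero _ hpi), one_mul, add_zero] at h2
  refine h2.congr_fun fun k => ?_
  have h3 : torusCoeff h k = _ := torusCoeff_sobolevOp (hT.sobolevOp _) S k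
  rw [torusCoeff_sobolevOp hT] at h3
  have n1 : (sobolevSymbol S k : ℂ) ≠ 0 := by
    exact_mod_cast (zero_lt_one.trans_le (one_le_sobolevSymbol hS k)).ne'
  have n2 : (sobolevSymbol (binaryIndices n) k : ℂ) ≠ 0 := by
    exact_mod_cast (zero_lt_one.trans_le (one_le_sobolevSymbol (by simp [binaryIndices]) k)).ne'
  simp only [mul_assoc, integral_const_mul]
  change _ * (_ * torusCoeff h k) = _
  rw [h3]
  field_simp

/-- Correlation with a kernel commutes with constant-coefficient operators. A right inverse suffices
for constructing the coadjoint action and for nondegeneracy. -/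
lemma sobolevOp_sobolevInv {S : Finset (Fin n → ℕ)} (hS : 0 ∈ S) {f : (Fin n → ℝ) → ℂ}
    (hf : IsTorusFun f) (x : Fin n → ℝ) : sobolevOp S (sobolevInv S f) x = f x := by
  rw [sobolevInv, sobolevOp_boxConv (hf.sobolevOp _) (continuous_sobolevKernel hS),
    boxConv_sobolevKernel hS hf]

end LoopTorus

namespace LoopTorus

/-! ### Smooth families of loops, the pairing and the coadjoint action -/

variable {n : ℕ}

/-- A smooth finite-parameter family of loops. -/
def SmoothFam {E : Type} [NormedAddCommGroup E] [NormedSpace ℝ E] (P : E → Loop n) : Prop :=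
  ContDiff ℝ ∞ (fun w : E × (ℝ × (Fin n → ℝ)) => (P w.1).1 w.2)

section Fam

variable {E : Type} [NormedAddCommGroup E] [NormedSpace ℝ E]
  {F : Type} [NormedAddCommGroup F] [NormedSpace ℝ F]

lemma SmoothFam.comp {P : E → Loop n} (hP : SmoothFam P) {g : F → E} (hg : ContDiff ℝ ∞ g) :
    SmoothFam (fun w => P (g w)) :=
  ContDiff.comp (g := fun w : E × (ℝ × (Fin n → ℝ)) => (P w.1).1 w.2) hP
    ((hg.comp contDiff_fst).prodMk contDiff_snd)

lemma SmoothFam.const (a : Loop n) : SmoothFam (fun _ : E => a) := a.2.1.comp contDiff_snd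

lemma SmoothFam.add {P Q : E → Loop n} (hP : SmoothFam P) (hQ : SmoothFam Q) :
    SmoothFam (fun w => P w + Q w) := ContDiff.add hP hQ

lemma SmoothFam.neg {P : E → Loop n} (hP : SmoothFam P) : SmoothFam (fun w => -P w) :=
  ContDiff.neg hP

lemma SmoothFam.smul {P : E → Loop n} (hP : SmoothFam P) {g : E → ℝ} (hg : ContDiff ℝ ∞ g) :
    SmoothFam (fun w => (g w : ℂ) • P w) := by
  have h : ContDiff ℝ ∞ (fun w : E × (ℝ × (Fin n → ℝ)) => g w.1 • (P w.1).1 w.2) :=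
    (hg.comp contDiff_fst).smul hP
  exact h

lemma SmoothFam.coord {P : E → Loop n} (hP : SmoothFam P) (i : Fin n) :
    SmoothParam (fun (e : E × ℝ) x => (P e.1).1 (e.2, x) i) :=
  (contDiff_pi.1 hP i).comp ((contDiff_fst.comp contDiff_fst).prodMk
    ((contDiff_snd.comp contDiff_fst).prodMk contDiff_snd))

lemma SmoothFam.of_coord {P : E → Loop n}
    (h : ∀ i, SmoothParam (fun (e : E × ℝ) x => (P e.1).1 (e.2, x) i)) : SmoothFam P := by
  refine contDiff_pi.2 fun i => ?_
  exact ContDiff.comp (g := fun w : (E × ℝ) × (Fin n → ℝ) => (P w.1.1).1 (w.1.2, w.2) i) (h i)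
    ((contDiff_fst.prodMk (contDiff_fst.comp contDiff_snd)).prodMk
      (contDiff_snd.comp contDiff_snd))

lemma SmoothFam.eval {P : E → Loop n} (hP : SmoothFam P) (z : ℝ × (Fin n → ℝ)) :
    ContDiff ℝ ∞ (fun e => (P e).1 z) :=
  ContDiff.comp (g := fun w : E × (ℝ × (Fin n → ℝ)) => (P w.1).1 w.2) hP
    (contDiff_id.prodMk contDiff_const)

end Fam

lemma loop_ext {a b : Loop n} (h : ∀ θ x i, a.1 (θ, x) i = b.1 (θ, x) i) : a = b :=
  Subtype.ext (funext fun z => funext fun i => h z.1 z.2 i)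

lemma loop_coord (a : Loop n) (i : Fin n) : SmoothParam (fun (θ : ℝ) x => a.1 (θ, x) i) :=
  contDiff_pi.1 a.2.1 i

lemma loop_torus (a : Loop n) (θ : ℝ) (i : Fin n) : IsTorusFun (fun x => a.1 (θ, x) i) :=
  ⟨(loop_coord a i).section_contDiff θ, fun x j => by simp only [a.2.2.2]⟩

/-- The loop with given components. -/
def ofCoord (G : Fin n → ℝ → (Fin n → ℝ) → ℂ) (hs : ∀ i, SmoothParam (G i))
    (hp : ∀ i θ, G i (θ + 2 * Real.pi) = G i θ) (ht : ∀ i θ, IsTorusFun (G i θ)) : Loop n :=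
  ⟨fun z i => G i z.1 z.2, contDiff_pi.2 hs, fun θ x => by simp only [hp],
    fun θ x j => funext fun i => (ht i θ).2 x j⟩

/-- An operator on functions of `x` that preserves smooth functions on the torus and smooth
families. -/
structure SmoothTorusOp (n : ℕ) where
  toFun : ((Fin n → ℝ) → ℂ) → (Fin n → ℝ) → ℂ
  smooth : ∀ {E : Type} [NormedAddCommGroup E] [NormedSpace ℝ E] [FiniteDimensional ℝ E]
    {G : E → (Fin n → ℝ) → ℂ}, SmoothParam G → SmoothParam fun e => toFun (G e)
  torus : ∀ {f}, IsTorusFun f → IsTorusFun (toFun f)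

/-- The componentwise action of an operator on loops. -/
def SmoothTorusOp.onLoop (O : SmoothTorusOp n) (a : Loop n) : Loop n :=
  ofCoord (fun i θ => O.toFun fun x => a.1 (θ, x) i) (fun i => O.smooth (loop_coord a i))
    (fun i θ => by simp only [a.2.2.1]) (fun i θ => O.torus (loop_torus a θ i))

lemma SmoothTorusOp.onLoop_apply (O : SmoothTorusOp n) (a : Loop n) (θ : ℝ) (x : Fin n → ℝ)
    (i : Fin n) : (O.onLoop a).1 (θ, x) i = O.toFun (fun x => a.1 (θ, x) i) x := rfl

lemma SmoothTorusOp.smoothFam (O : SmoothTorusOp n) {E : Type} [NormedAddCommGroup E]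
    [NormedSpace ℝ E] [FiniteDimensional ℝ E] {P : E → Loop n} (hP : SmoothFam P) :
    SmoothFam (fun e => O.onLoop (P e)) :=
  SmoothFam.of_coord fun i => O.smooth (hP.coord i)

/-- The partial derivative as an operator on loops. -/
def pdOp (j : Fin n) : SmoothTorusOp n := ⟨pd j, fun h => h.pd j, fun h => h.pd j⟩

lemma zero_mem_multiIndices (n q : ℕ) : 0 ∈ multiIndices n q := by simp [multiIndices]

/-- The operator `∑ (-1)^|α| ∂^(2α)`, `|α| ≤ q`, of the Sobolev metric. -/
def metricOp (n q : ℕ) : SmoothTorusOp n :=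
  ⟨sobolevOp (multiIndices n q), fun h => h.sobolevOp _, fun h => h.sobolevOp _⟩

/-- The inverse of `metricOp`. -/
def metricInv (n q : ℕ) : SmoothTorusOp n :=
  ⟨sobolevInv (multiIndices n q), fun h => h.sobolevInv (zero_mem_multiIndices n q),
    fun h => h.sobolevInv (zero_mem_multiIndices n q)⟩

lemma metricOp_metricInv (q : ℕ) (a : Loop n) :
    (metricOp n q).onLoop ((metricInv n q).onLoop a) = a :=
  loop_ext fun θ x i => sobolevOp_sobolevInv (zero_mem_multiIndices n q) (loop_torus a θ i) x

/-- The `L²`-product of two loops for fixed `λ`. -/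
def fiberProd (l a : Loop n) (θ : ℝ) : ℂ :=
  ∑ j, ∫ x in periodBox n, l.1 (θ, x) j * a.1 (θ, x) j

lemma pairing_eq (p q : ℕ) (l a : Loop n) :
    pairing p q l a = (2 * Real.pi * I)⁻¹ * ∫ θ in (0 : ℝ)..2 * Real.pi,
      fiberProd ((metricOp n q).onLoop l) a θ / exp (θ * I) ^ p * (I * exp (θ * I)) := by
  unfold pairing
  congr 1
  refine intervalIntegral.integral_congr fun θ _ => ?_
  rw [sobolev_eq q (loop_torus l θ) (loop_torus a θ)]
  rfl

lemma pairing_symm (p q : ℕ) (l a : Loop n) : pairing p q l a = pairing p q a l := by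
  unfold pairing sobolev
  simp only [mul_comm (pdPow _ (fun z => l.1 _ _) _)]

lemma continuous_fiberProd {E : Type} [NormedAddCommGroup E] [NormedSpace ℝ E]
    [FiniteDimensional ℝ E] {P Q : E → Loop n}
    (hP : SmoothFam P) (hQ : SmoothFam Q) :
    Continuous (fun w : E × ℝ => fiberProd (P w.1) (Q w.1) w.2) := by
  unfold fiberProd
  have := FiniteDimensional.proper_real E
  refine continuous_finsetSum _ fun j _ => ?_
  refine continuous_parametric_integral_of_continuous
    (f := fun (w : E × ℝ) x => (P w.1).1 (w.2, x) j * (Q w.1).1 (w.2, x) j) ?_ isCompact_Icc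
  exact ContDiff.continuous (𝕜 := ℝ) (n := ∞) (ContDiff.mul (hP.coord j) (hQ.coord j))

lemma continuous_fiberProd_const (l a : Loop n) : Continuous (fiberProd l a) :=
  (continuous_fiberProd (SmoothFam.const (E := ℝ) l) (SmoothFam.const a)).comp
    (by fun_prop : Continuous fun θ : ℝ => ((0 : ℝ), θ))

lemma fiberProd_add_right (l a b : Loop n) (θ : ℝ) :
    fiberProd l (a + b) θ = fiberProd l a θ + fiberProd l b θ := by
  unfold fiberProd
  rw [← Finset.sum_add_distrib]
  refine Finset.sum_congr rfl fun j _ => ?_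
  rw [← integral_add ((loop_torus l θ j).mul (loop_torus a θ j)).integrableOn
    ((loop_torus l θ j).mul (loop_torus b θ j)).integrableOn]
  refine integral_congr_ae (Filter.Eventually.of_forall fun x => ?_)
  exact mul_add _ _ _

lemma fiberProd_smul_right (l a : Loop n) (c : ℂ) (θ : ℝ) :
    fiberProd l (c • a) θ = c * fiberProd l a θ := by
  unfold fiberProd
  rw [Finset.mul_sum]
  refine Finset.sum_congr rfl fun j _ => ?_
  rw [← integral_const_mul]
  refine integral_congr_ae (Filter.Eventually.of_forall fun x => ?_)
  exact mul_left_comm _ _ _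

lemma continuous_circleWeight (p : ℕ) {g : ℝ → ℂ} (hg : Continuous g) :
    Continuous (fun θ : ℝ => g θ / exp (θ * I) ^ p * (I * exp (θ * I))) := by
  refine Continuous.mul (hg.div (by fun_prop) fun θ => pow_ne_zero _ (exp_ne_zero _)) (by fun_prop)

lemma pairing_add_right (p q : ℕ) (l a b : Loop n) :
    pairing p q l (a + b) = pairing p q l a + pairing p q l b := by
  simp only [pairing_eq, ← mul_add]
  rw [← intervalIntegral.integral_add
    ((continuous_circleWeight p (continuous_fiberProd_const _ a)).intervalIntegrable _ _)
    ((continuous_circleWeight p (continuous_fiberProd_const _ b)).intervalIntegrable _ _)]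
  congr 1
  refine intervalIntegral.integral_congr fun θ _ => ?_
  simp only [fiberProd_add_right]
  ring

lemma pairing_smul_right (p q : ℕ) (l a : Loop n) (c : ℂ) :
    pairing p q l (c • a) = c * pairing p q l a := by
  simp only [pairing_eq]
  rw [mul_left_comm, ← intervalIntegral.integral_const_mul c]
  congr 1
  refine intervalIntegral.integral_congr fun θ _ => ?_
  simp only [fiberProd_smul_right]
  ring

/-- The pairing as a bilinear form. -/
def pairingForm (p q : ℕ) : Loop n →ₗ[ℂ] Loop n →ₗ[ℂ] ℂ :=
  LinearMap.mk₂ ℂ (pairing p q)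
    (fun a b l => by simp only [pairing_symm p q _ l, pairing_add_right])
    (fun c a l => by simp only [pairing_symm p q _ l, pairing_smul_right, smul_eq_mul])
    (pairing_add_right p q) (fun c l a => pairing_smul_right p q l a c)

lemma pairingForm_apply (p q : ℕ) (l a : Loop n) : pairingForm p q l a = pairing p q l a := rfl

lemma continuous_pairing {E : Type} [NormedAddCommGroup E] [NormedSpace ℝ E]
    [FiniteDimensional ℝ E] (p q : ℕ) (l : Loop n) {P : E → Loop n} (hP : SmoothFam P) : Continuous (fun e => pairing p q l (P e)) := by
  simp only [pairing_eq]
  refine continuous_const.mul ?_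
  refine intervalIntegral.continuous_parametric_intervalIntegral_of_continuous' ?_ _ _
  have h := continuous_fiberProd (SmoothFam.const ((metricOp n q).onLoop l)) hP
  refine Continuous.mul (Continuous.div h (by fun_prop)
    fun w => pow_ne_zero _ (exp_ne_zero _)) (by fun_prop)

/-! ### Nondegeneracy -/

/-- A vanishing integral gives vanishing almost everywhere. By continuity this extends to all of the
box, boundary included, because the box is the closure of its interior. -/
lemma eq_zero_on_box {f : (Fin n → ℝ) → ℝ} (hf : Continuous f) (h0 : ∀ x, 0 ≤ f x)
    (h : ∫ x in periodBox n, f x = 0) {x : Fin n → ℝ} (hx : x ∈ periodBox n) : f x = 0 := by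
  rw [setIntegral_eq_zero_iff_of_nonneg_ae (Filter.Eventually.of_forall h0)
    (hf.continuousOn.integrableOn_compact isCompact_Icc)] at h
  refine Measure.eqOn_of_ae_eq h hf.continuousOn continuousOn_const ?_ hx
  have hne : (interior (periodBox n)).Nonempty := by
    refine ⟨fun _ => Real.pi, mem_interior_iff_mem_nhds.2 (pi_Icc_mem_nhds (fun _ => ?_) fun _ => ?_)⟩
    · exact Real.pi_pos
    · linarith [Real.pi_pos]
  rw [(convex_Icc (𝕜 := ℝ) _ _).closure_interior_eq_closure_of_nonempty_interior hne]
  exact subset_closure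

lemma loop_eq_zero {a : Loop n}
    (h : ∀ θ ∈ Set.Icc 0 (2 * Real.pi), ∀ x ∈ periodBox n, a.1 (θ, x) = 0) : a = 0 := by
  refine loop_ext fun θ x i => ?_
  have hp : Function.Periodic (fun θ => a.1 (θ, x) i) (2 * Real.pi) := loop_coord_periodic a x i
  obtain ⟨θ', hθ', e⟩ := hp.exists_mem_Ico₀ Real.two_pi_pos θ
  rw [e]
  have e2 := periodic_int (g := fun x => a.1 (θ', x) i) (loop_torus a θ' i).2 x fun j => -⌊x j / (2 * Real.pi)⌋
  rw [← e2, h θ' (Set.Ico_subset_Icc_self hθ')]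
  · rfl
  · constructor
    · intro j
      have h1 := Int.floor_le (x j / (2 * Real.pi))
      rw [le_div_iff₀ Real.two_pi_pos] at h1
      simp only [Pi.zero_apply, Pi.add_apply]
      push_cast
      linarith
    · intro j
      have h1 := (Int.lt_floor_add_one (x j / (2 * Real.pi))).le
      rw [div_le_iff₀ Real.two_pi_pos] at h1
      simp only [Pi.add_apply]
      push_cast
      linarith

/-- The loop `exp (i m θ)` times the complex conjugate of `a`. -/
def conjLoop (m : ℤ) (a : Loop n) : Loop n :=
  ⟨fun z i => exp (m * z.1 * I) * (starRingEnd ℂ) (a.1 z i), by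
    refine ⟨contDiff_pi.2 fun i => ContDiff.mul ?_ ?_, fun θ x => ?_, fun θ x j => ?_⟩
    · exact ((contDiff_const.mul (ofRealCLM.contDiff.comp contDiff_fst)).mul contDiff_const).cexp
    · exact conjCLE.contDiff.comp (contDiff_pi.1 a.2.1 i)
    · funext i
      simp only [a.2.2.1]
      congr 1
      rw [Complex.exp_eq_exp_iff_exists_int]
      exact ⟨m, by push_cast; ring⟩
    · simp only [a.2.2.2]⟩

/-- The pairing is bilinear and carries the weight `λ^(-p)`, so positivity has to be built into the
test loop: one is chosen that turns the pairing into the squared `L²` norm of `m`, up to a nonzero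
constant. -/
lemma pairing_nondegenerate (p q : ℕ) {m : Loop n} (h : ∀ b, pairing p q m b = 0) : m = 0 := by
  -- On the circle `dλ / λ^p = i λ^(1-p) dθ`, so the factor `λ^(p-1)` cancels the weight; the
  -- conjugate produces `|m|²`, and `metricInv` undoes the Sobolev operator.
  have h1 := h ((metricInv n q).onLoop (conjLoop (p - 1) m))
  rw [pairing_symm, pairing_eq, metricOp_metricInv] at h1
  set g : ℝ → ℝ := fun θ => ∑ j, ∫ x in periodBox n, ‖m.1 (θ, x) j‖ ^ 2 with hg
  have hfib : ∀ θ : ℝ, fiberProd (conjLoop (p - 1) m) m θ / exp (θ * I) ^ p * (I * exp (θ * I)) =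
      I * (g θ : ℂ) := by
    intro θ
    have h2 : fiberProd (conjLoop (p - 1) m) m θ = exp (((p : ℤ) - 1 : ℤ) * θ * I) * (g θ : ℂ) := by
      rw [hg, fiberProd]
      push_cast
      rw [Finset.mul_sum]
      refine Finset.sum_congr rfl fun j _ => ?_
      rw [← integral_complex_ofReal, ← integral_const_mul]
      refine integral_congr_ae (Filter.Eventually.of_forall fun x => ?_)
      simp only [conjLoop]
      rw [mul_assoc, mul_comm ((starRingEnd ℂ) _), Complex.mul_conj, Complex.normSq_eq_norm_sq]
      push_cast
      ring
    rw [h2]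
    have h3 : exp (((p : ℤ) - 1 : ℤ) * θ * I) * exp (θ * I) = exp (θ * I) ^ p := by
      rw [← Complex.exp_add, ← Complex.exp_nat_mul]
      congr 1
      push_cast
      ring
    have h4 : exp (θ * I) ^ p ≠ 0 := pow_ne_zero _ (exp_ne_zero _)
    field_simp
    rw [mul_right_comm, h3, mul_comm]
  simp only [hfib] at h1
  rw [intervalIntegral.integral_const_mul, intervalIntegral.integral_ofReal] at h1
  have hpi : (2 * Real.pi * I : ℂ)⁻¹ ≠ 0 := by simp [Real.pi_ne_zero]
  have h2 : ∫ θ in (0 : ℝ)..2 * Real.pi, g θ = 0 := by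
    simpa [hpi, Real.pi_ne_zero] using h1
  have hmc : ∀ j, Continuous (fun w : ℝ × (Fin n → ℝ) => ‖m.1 w j‖ ^ 2) := fun j =>
    ((contDiff_pi.1 m.2.1 j).continuous.norm).pow 2
  have hgc : Continuous g := by
    refine continuous_finsetSum _ fun j _ => ?_
    exact continuous_parametric_integral_of_continuous
      (f := fun (θ : ℝ) x => ‖m.1 (θ, x) j‖ ^ 2) (hmc j) isCompact_Icc
  have hnn : ∀ θ j, 0 ≤ ∫ x in periodBox n, ‖m.1 (θ, x) j‖ ^ 2 := fun θ j =>
    integral_nonneg fun x => by positivity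
  have hg0 : ∀ θ, 0 ≤ g θ := fun θ => Finset.sum_nonneg fun j _ => hnn θ j
  refine loop_eq_zero fun θ hθ x hx => funext fun j => ?_
  have hgz : g θ = 0 := by
    by_contra hne
    have := intervalIntegral.integral_pos Real.two_pi_pos hgc.continuousOn (fun θ _ => hg0 θ)
      ⟨θ, hθ, lt_of_le_of_ne (hg0 θ) (Ne.symm hne)⟩
    exact this.ne' h2
  have hj := (Finset.sum_eq_zero_iff_of_nonneg fun j _ => hnn θ j).1 hgz j (Finset.mem_univ _)
  have := eq_zero_on_box ((hmc j).comp (by fun_prop : Continuous fun x : Fin n → ℝ => (θ, x)))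
    (fun x => pow_nonneg (norm_nonneg _) 2) hj hx
  simpa using this

lemma pairing_ext_left (p q : ℕ) {m m' : Loop n} (h : ∀ b, pairing p q m b = pairing p q m' b) :
    m = m' := by
  refine sub_eq_zero.1 (pairing_nondegenerate p q fun b => ?_)
  rw [← pairingForm_apply, map_sub, LinearMap.sub_apply, pairingForm_apply, pairingForm_apply, h,
    sub_self]

lemma pairing_ext_right (p q : ℕ) {m m' : Loop n} (h : ∀ b, pairing p q b m = pairing p q b m') :
    m = m' := pairing_ext_left p q fun b => by rw [pairing_symm, h, pairing_symm]

end LoopTorus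

namespace LoopTorus

/-! ### The commutator of vector fields -/

variable {n : ℕ}

/-- The derivative of `f` along the vector field `A`. -/
def lieD (A : (Fin n → ℝ) → Fin n → ℂ) (f : (Fin n → ℝ) → ℂ) (x : Fin n → ℝ) : ℂ :=
  ∑ j, A x j * pd j f x

lemma fieldBracket_apply (A B : (Fin n → ℝ) → Fin n → ℂ) (x : Fin n → ℝ) (k : Fin n) :
    fieldBracket A B x k = lieD A (fun z => B z k) x - lieD B (fun z => A z k) x := by
  simp only [fieldBracket, lieD, Finset.sum_sub_distrib]

lemma contDiff_lieD {A : (Fin n → ℝ) → Fin n → ℂ} {f : (Fin n → ℝ) → ℂ}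
    (hA : ∀ j, ContDiff ℝ ∞ fun z => A z j) (hf : ContDiff ℝ ∞ f) : ContDiff ℝ ∞ (lieD A f) :=
  ContDiff.sum fun j _ => (hA j).mul (hf.pd j)

lemma lieD_sub (A : (Fin n → ℝ) → Fin n → ℂ) {f g : (Fin n → ℝ) → ℂ}
    (hf : ContDiff ℝ ∞ f) (hg : ContDiff ℝ ∞ g) (x : Fin n → ℝ) :
    lieD A (fun z => f z - g z) x = lieD A f x - lieD A g x := by
  simp only [lieD, pd_sub hf hg, mul_sub, Finset.sum_sub_distrib]

lemma pd_lieD {A : (Fin n → ℝ) → Fin n → ℂ} {f : (Fin n → ℝ) → ℂ}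
    (hA : ∀ j, ContDiff ℝ ∞ fun z => A z j) (hf : ContDiff ℝ ∞ f) (i : Fin n) (x : Fin n → ℝ) :
    pd i (lieD A f) x =
      ∑ j, (A x j * pd i (pd j f) x + pd j f x * pd i (fun z => A z j) x) := by
  unfold lieD
  rw [pd_sum fun j _ => (hA j).mul (hf.pd j)]
  exact Finset.sum_congr rfl fun j _ => pd_mul (hA j) (hf.pd j) i x

/-- In the two compositions the second-order terms agree by symmetry of second derivatives; the
first-order terms are the components of the bracket. -/
lemma lieD_fieldBracket {A B : (Fin n → ℝ) → Fin n → ℂ} {f : (Fin n → ℝ) → ℂ}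
    (hA : ∀ j, ContDiff ℝ ∞ fun z => A z j) (hB : ∀ j, ContDiff ℝ ∞ fun z => B z j)
    (hf : ContDiff ℝ ∞ f) (x : Fin n → ℝ) :
    lieD (fieldBracket A B) f x = lieD A (lieD B f) x - lieD B (lieD A f) x := by
  have e1 : ∀ {A B : (Fin n → ℝ) → Fin n → ℂ}, (∀ j, ContDiff ℝ ∞ fun z => B z j) →
      lieD A (lieD B f) x = ∑ i, ∑ j, A x i * B x j * pd i (pd j f) x +
        ∑ j, lieD A (fun z => B z j) x * pd j f x := by
    intro A B hB
    have : ∑ j, lieD A (fun z => B z j) x * pd j f x =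
        ∑ i, ∑ j, A x i * (pd j f x * pd i (fun z => B z j) x) := by
      rw [Finset.sum_comm]
      refine Finset.sum_congr rfl fun j _ => ?_
      rw [lieD, Finset.sum_mul]
      exact Finset.sum_congr rfl fun i _ => by ring
    rw [this, ← Finset.sum_add_distrib]
    rw [lieD]
    refine Finset.sum_congr rfl fun i _ => ?_
    rw [pd_lieD hB hf, Finset.mul_sum, ← Finset.sum_add_distrib]
    exact Finset.sum_congr rfl fun j _ => by ring
  have e2 : ∑ i, ∑ j, A x i * B x j * pd i (pd j f) x =
      ∑ i, ∑ j, B x i * A x j * pd i (pd j f) x := by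
    rw [Finset.sum_comm]
    refine Finset.sum_congr rfl fun i _ => Finset.sum_congr rfl fun j _ => ?_
    rw [pd_comm hf]
    ring
  rw [e1 hB, e1 hA, e2, lieD]
  simp only [fieldBracket_apply, sub_mul, Finset.sum_sub_distrib]
  ring

/-- Each component of a bracket is a difference of Lie derivatives of components, so the identity
reduces to the commutator formula for Lie derivatives, used three times. -/
lemma fieldBracket_jacobi {A B C : (Fin n → ℝ) → Fin n → ℂ}
    (hA : ∀ j, ContDiff ℝ ∞ fun z => A z j) (hB : ∀ j, ContDiff ℝ ∞ fun z => B z j)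
    (hC : ∀ j, ContDiff ℝ ∞ fun z => C z j) (x : Fin n → ℝ) :
    fieldBracket A (fieldBracket B C) x =
      fieldBracket (fieldBracket A B) C x + fieldBracket B (fieldBracket A C) x := by
  funext k
  simp only [Pi.add_apply, fieldBracket_apply]
  rw [lieD_sub _ (contDiff_lieD hB (hC k)) (contDiff_lieD hC (hB k)),
    lieD_sub _ (contDiff_lieD hA (hB k)) (contDiff_lieD hB (hA k)),
    lieD_sub _ (contDiff_lieD hA (hC k)) (contDiff_lieD hC (hA k))]
  have h1 := lieD_fieldBracket hB hC (hA k) x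
  have h2 := lieD_fieldBracket hA hB (hC k) x
  have h3 := lieD_fieldBracket hA hC (hB k) x
  rw [h1, h2, h3]
  change _ - (lieD B (lieD C fun z => A z k) x - _) = _
  ring

lemma loop_contDiff (a : Loop n) (θ : ℝ) (i : Fin n) : ContDiff ℝ ∞ fun x => a.1 (θ, x) i :=
  (loop_torus a θ i).1

lemma bracket_apply (a b : Loop n) (θ : ℝ) (x : Fin n → ℝ) :
    (bracket a b).1 (θ, x) =
      fieldBracket (fun x => a.1 (θ, x)) (fun x => b.1 (θ, x)) x := rfl

lemma bracket_skew (a b : Loop n) : bracket a b = -bracket b a := by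
  refine loop_ext fun θ x i => ?_
  have : (-bracket b a).1 (θ, x) i = -(bracket b a).1 (θ, x) i := rfl
  rw [this, bracket_apply, bracket_apply, fieldBracket_apply, fieldBracket_apply, neg_sub]

lemma bracket_jacobi (a b c : Loop n) :
    bracket a (bracket b c) = bracket (bracket a b) c + bracket b (bracket a c) := by
  refine loop_ext fun θ x i => ?_
  exact congrFun (fieldBracket_jacobi (loop_contDiff a θ) (loop_contDiff b θ) (loop_contDiff c θ) x) i

lemma bracket_add_right (a b c : Loop n) : bracket a (b + c) = bracket a b + bracket a c := by
  refine loop_ext fun θ x i => ?_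
  have e : (bracket a b + bracket a c).1 (θ, x) i =
    (bracket a b).1 (θ, x) i + (bracket a c).1 (θ, x) i := rfl
  simp only [e, bracket_apply, fieldBracket]
  rw [← Finset.sum_add_distrib]
  refine Finset.sum_congr rfl fun j _ => ?_
  have h := pd_add (loop_contDiff b θ i) (loop_contDiff c θ i) j x
  have h2 : (b + c).1 (θ, x) j = b.1 (θ, x) j + c.1 (θ, x) j := rfl
  change _ * pd j (fun z => b.1 (θ, z) i + c.1 (θ, z) i) x - _ = _
  rw [h, h2]
  ring

lemma bracket_smul_right (r : ℂ) (a b : Loop n) : bracket a (r • b) = r • bracket a b := by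
  refine loop_ext fun θ x i => ?_
  have e : (r • bracket a b).1 (θ, x) i = r * (bracket a b).1 (θ, x) i := rfl
  simp only [e, bracket_apply, fieldBracket]
  rw [Finset.mul_sum]
  refine Finset.sum_congr rfl fun j _ => ?_
  have h := pd_const_mul r (loop_contDiff b θ i) j x
  have h2 : (r • b).1 (θ, x) j = r * b.1 (θ, x) j := rfl
  change _ * pd j (fun z => r * b.1 (θ, z) i) x - _ = _
  rw [h, h2]
  ring

/-- The commutator of loop vector fields as a bilinear map. -/
def bracketForm : Loop n →ₗ[ℂ] Loop n →ₗ[ℂ] Loop n :=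
  LinearMap.mk₂ ℂ bracket
    (fun a b c => by rw [bracket_skew, bracket_add_right, neg_add, ← bracket_skew, ← bracket_skew])
    (fun r a c => by
      rw [bracket_skew, bracket_smul_right, bracket_skew a c]
      exact (smul_neg r _).symm)
    bracket_add_right (fun r a b => bracket_smul_right r a b)

lemma bracketForm_apply (a b : Loop n) : bracketForm a b = bracket a b := rfl

/-! ### The coadjoint action -/

/-- The transpose of `b ↦ -[a, b]` with respect to the `L²`-product. -/
def coadL2 (w a : Loop n) : Loop n :=
  ofCoord (fun k θ x => ∑ j, (pd j (fun x => w.1 (θ, x) k * a.1 (θ, x) j) x +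
      w.1 (θ, x) j * pd k (fun x => a.1 (θ, x) j) x))
    (fun k => ContDiff.sum fun j _ =>
      (((loop_coord w k).mul (loop_coord a j)).pd j).add
        ((loop_coord w j).mul ((loop_coord a j).pd k)))
    (fun k θ => by simp only [w.2.2.1, a.2.2.1])
    (fun k θ => IsTorusFun.sum fun j _ =>
      (((loop_torus w θ k).mul (loop_torus a θ j)).pd j).add
        ((loop_torus w θ j).mul ((loop_torus a θ j).pd k)))

lemma SmoothFam.coadL2 {E : Type} [NormedAddCommGroup E] [NormedSpace ℝ E] {P Q : E → Loop n}
    (hP : SmoothFam P) (hQ : SmoothFam Q) : SmoothFam (fun e => coadL2 (P e) (Q e)) :=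
  SmoothFam.of_coord fun k => ContDiff.sum (s := Finset.univ) fun j _ =>
      (((hP.coord k).mul (hQ.coord j)).pd j).add
        ((hP.coord j).mul ((hQ.coord j).pd k))

/-- The derivative falling on `b` is removed by integration by parts; in the other term the two
summation indices are interchanged so that `b` carries the outer one. -/
lemma fiberProd_bracket (w a b : Loop n) (θ : ℝ) :
    fiberProd w (bracket a b) θ = -fiberProd (coadL2 w a) b θ := by
  have hw := loop_torus w θ
  have ha := loop_torus a θ
  have hb := loop_torus b θ
  have e1 : fiberProd w (bracket a b) θ = ∑ k, ∑ j,
      ((∫ x in periodBox n, (w.1 (θ, x) k * a.1 (θ, x) j) * pd j (fun z => b.1 (θ, z) k) x) -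
        ∫ x in periodBox n, w.1 (θ, x) k * pd j (fun z => a.1 (θ, z) k) x * b.1 (θ, x) j) := by
    refine Finset.sum_congr rfl fun k _ => ?_
    have h1 : ∀ j, IsTorusFun fun x =>
        (w.1 (θ, x) k * a.1 (θ, x) j) * pd j (fun z => b.1 (θ, z) k) x :=
      fun j => ((hw k).mul (ha j)).mul ((hb k).pd j)
    have h2 : ∀ j, IsTorusFun fun x =>
        w.1 (θ, x) k * pd j (fun z => a.1 (θ, z) k) x * b.1 (θ, x) j :=
      fun j => ((hw k).mul ((ha k).pd j)).mul (hb j)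
    simp only [← integral_sub (h1 _).integrableOn (h2 _).integrableOn]
    rw [← integral_finsetSum _ fun j _ => ((h1 j).sub (h2 j)).integrableOn]
    refine integral_congr_ae (Filter.Eventually.of_forall fun x => ?_)
    simp only [bracket_apply, fieldBracket]
    rw [Finset.mul_sum]
    exact Finset.sum_congr rfl fun j _ => by ring
  have e2 : fiberProd (coadL2 w a) b θ = ∑ k, ∑ j,
      ((∫ x in periodBox n, pd j (fun x => w.1 (θ, x) k * a.1 (θ, x) j) x * b.1 (θ, x) k) +
        ∫ x in periodBox n, w.1 (θ, x) j * pd k (fun z => a.1 (θ, z) j) x * b.1 (θ, x) k) := by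
    refine Finset.sum_congr rfl fun k _ => ?_
    have h1 : ∀ j, IsTorusFun fun x =>
        pd j (fun x => w.1 (θ, x) k * a.1 (θ, x) j) x * b.1 (θ, x) k :=
      fun j => (((hw k).mul (ha j)).pd j).mul (hb k)
    have h2 : ∀ j, IsTorusFun fun x =>
        w.1 (θ, x) j * pd k (fun z => a.1 (θ, z) j) x * b.1 (θ, x) k :=
      fun j => ((hw j).mul ((ha j).pd k)).mul (hb k)
    simp only [← integral_add (h1 _).integrableOn (h2 _).integrableOn]
    rw [← integral_finsetSum _ fun j _ => ((h1 j).add (h2 j)).integrableOn]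
    refine integral_congr_ae (Filter.Eventually.of_forall fun x => ?_)
    refine (Finset.sum_mul _ _ _).trans ?_
    exact Finset.sum_congr rfl fun j _ => by ring
  rw [e1, e2]
  simp only [((hw _).mul (ha _)).integral_pd_mul (hb _), Finset.sum_add_distrib,
    Finset.sum_sub_distrib, Finset.sum_neg_distrib]
  rw [Finset.sum_comm (f := fun k j =>
    ∫ x in periodBox n, w.1 (θ, x) j * pd k (fun z => a.1 (θ, z) j) x * b.1 (θ, x) k)]
  ring

/-- With the Sobolev operator absorbed into `l`, the coadjoint action is the `L²` transpose;
`metricInv` returns it to the Sobolev pairing. The circle weight does not depend on `x` and passes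
through. -/
lemma isCoad_metricInv (p q : ℕ) (a l : Loop n) :
    IsCoad p q a l ((metricInv n q).onLoop (coadL2 ((metricOp n q).onLoop l) a)) := by
  intro b
  simp only [pairing_eq, metricOp_metricInv, fiberProd_bracket]
  rw [← mul_neg, ← intervalIntegral.integral_neg]
  congr 1
  refine intervalIntegral.integral_congr fun θ _ => ?_
  ring

lemma IsCoad.unique {p q : ℕ} {a l m m' : Loop n} (h : IsCoad p q a l m) (h' : IsCoad p q a l m') :
    m = m' := pairing_ext_left p q fun b => by rw [h, h']

lemma isCoad_coad (p q : ℕ) (a l : Loop n) : IsCoad p q a l (coad p q a l) := by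
  have h : ∃ m, IsCoad p q a l m := ⟨_, isCoad_metricInv p q a l⟩
  rw [coad, dif_pos h]
  exact h.choose_spec

lemma coad_eq (p q : ℕ) (a l : Loop n) :
    coad p q a l = (metricInv n q).onLoop (coadL2 ((metricOp n q).onLoop l) a) :=
  (isCoad_coad p q a l).unique (isCoad_metricInv p q a l)

lemma pairing_coad (p q : ℕ) (a l b : Loop n) :
    pairing p q (coad p q a l) b = -pairing p q l (bracket a b) := isCoad_coad p q a l b

/-- Uniqueness identifies the chosen representative with the explicit formula, all of whose
ingredients preserve smooth families. -/
lemma SmoothFam.coad {E : Type} [NormedAddCommGroup E] [NormedSpace ℝ E] [FiniteDimensional ℝ E]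
    (p q : ℕ) {P Q : E → Loop n} (hP : SmoothFam P) (hQ : SmoothFam Q) :
    SmoothFam (fun e => coad p q (P e) (Q e)) := by
  simp only [coad_eq]
  exact (metricInv n q).smoothFam (((metricOp n q).smoothFam hQ).coadL2 hP)

/-- The coadjoint action as a bilinear map. -/
def coadForm (p q : ℕ) : Loop n →ₗ[ℂ] Loop n →ₗ[ℂ] Loop n :=
  LinearMap.mk₂ ℂ (coad p q)
    (fun a b l => pairing_ext_left p q fun c => by
      simp only [← pairingForm_apply, map_add, LinearMap.add_apply]
      simp only [pairingForm_apply, pairing_coad]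
      simp only [← pairingForm_apply, ← bracketForm_apply, map_add, LinearMap.add_apply, neg_add])
    (fun r a l => pairing_ext_left p q fun c => by
      simp only [← pairingForm_apply, map_smul, LinearMap.smul_apply]
      simp only [pairingForm_apply, pairing_coad]
      simp only [← pairingForm_apply, ← bracketForm_apply, map_smul, LinearMap.smul_apply,
        smul_neg])
    (fun a l m => pairing_ext_left p q fun c => by
      simp only [← pairingForm_apply, map_add, LinearMap.add_apply]
      simp only [pairingForm_apply, pairing_coad]
      simp only [← pairingForm_apply, map_add, LinearMap.add_apply, neg_add])
    (fun r a l => pairing_ext_left p q fun c => by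
      simp only [← pairingForm_apply, map_smul, LinearMap.smul_apply]
      simp only [pairingForm_apply, pairing_coad]
      simp only [← pairingForm_apply, map_smul, LinearMap.smul_apply, smul_neg])

lemma coadForm_apply (p q : ℕ) (a l : Loop n) : coadForm p q a l = coad p q a l := rfl

/-- The Jacobi identity, dualized: `ad*` is a representation. This is what links the commutator
`[a₊, b₊]` to the commutator of two flows. -/
lemma coad_bracket (p q : ℕ) (a b l : Loop n) :
    coad p q (bracket a b) l = coad p q a (coad p q b l) - coad p q b (coad p q a l) := by
  refine pairing_ext_left p q fun c => ?_
  rw [← pairingForm_apply p q (_ - _), map_sub, LinearMap.sub_apply]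
  simp only [pairingForm_apply, pairing_coad]
  have h := congrArg (pairingForm p q l) (bracket_jacobi a b c)
  rw [map_add] at h
  simp only [pairingForm_apply] at h
  rw [h]
  ring

end LoopTorus

namespace LoopTorus

/-! ### Differentiation of smooth families of loops -/

variable {n : ℕ}

lemma HasLoopDerivAt.unique {c : ℝ → Loop n} {v w : Loop n} {s : ℝ} (hv : HasLoopDerivAt c v s)
    (hw : HasLoopDerivAt c w s) : v = w :=
  Subtype.ext (funext fun z => (hv z).unique (hw z))

lemma HasLoopDerivAt.congr {c c' : ℝ → Loop n} {v : Loop n} {s : ℝ} (hv : HasLoopDerivAt c v s)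
    (h : c' =ᶠ[𝓝 s] c) : HasLoopDerivAt c' v s := fun z =>
  (hv z).congr_of_eventuallyEq (h.mono fun r hr => by simp only [hr])

/-- A difference quotient that extends continuously to `s₀` has its value there as derivative.
Linear maps on loops can thus be differentiated along curves knowing only how they act on smooth
families. -/
lemma hasDerivAt_of_factor {F : Type*} [NormedAddCommGroup F] [NormedSpace ℝ F] {g G : ℝ → F}
    {s₀ : ℝ} (hG : ContinuousAt G s₀) (h : ∀ s, g s = g s₀ + (s - s₀) • G s) :
    HasDerivAt g (G s₀) s₀ := by
  rw [hasDerivAt_iff_tendsto_slope]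
  refine (hG.tendsto.mono_left nhdsWithin_le_nhds).congr' ?_
  filter_upwards [self_mem_nhdsWithin] with s hs
  have : s - s₀ ≠ 0 := sub_ne_zero.2 hs
  rw [slope_def_module, h s, add_sub_cancel_left, smul_smul, inv_mul_cancel₀ this, one_smul]

/-- Hadamard's lemma for smooth curves of loops. -/
lemma SmoothFam.exists_factor {c : ℝ → Loop n} (hc : SmoothFam c) (s₀ : ℝ) :
    ∃ M : ℝ → Loop n, SmoothFam M ∧ ∀ s, c s = c s₀ + ((s - s₀ : ℝ) : ℂ) • M s := by
  set D : ℝ × (ℝ × (Fin n → ℝ)) → Fin n → ℂ := fun w => deriv (fun r => (c r).1 w.2) w.1 with hD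
  have hDs : ContDiff ℝ ∞ D := by
    refine ContDiff.fderiv_apply (m := ∞)
      (f := fun (w : ℝ × (ℝ × (Fin n → ℝ))) (r : ℝ) => (c r).1 w.2)
      (k := fun _ => (1 : ℝ)) ?_ contDiff_fst contDiff_const (by simp)
    exact ContDiff.comp (g := fun w : ℝ × (ℝ × (Fin n → ℝ)) => (c w.1).1 w.2) hc
      (contDiff_snd.prodMk (contDiff_snd.comp contDiff_fst))
  have hDd : ∀ z r, HasDerivAt (fun r => (c r).1 z) (D (r, z)) r := fun z r =>
    ((hc.eval z).differentiable (by simp) r).hasDerivAt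
  -- The quotient `(c s - c s₀) / (s - s₀)` is written as the mean of the derivative over the
  -- segment from `s₀` to `s`, which is smooth also at `s = s₀`.
  set N : ℝ × (ℝ × (Fin n → ℝ)) → Fin n → ℂ := fun w =>
    ∫ u in (0 : ℝ)..1, (1 : ℂ) • D (s₀ + u * (w.1 - s₀), w.2) with hN
  have hNs : ContDiff ℝ ∞ N := by
    refine contDiff_infty.2 fun m => ?_
    refine contDiff_integral_aux 0 1 (K := fun _ => 1) continuous_const m
      (G := fun w : (ℝ × (ℝ × (Fin n → ℝ))) × ℝ => D (s₀ + w.2 * (w.1.1 - s₀), w.1.2)) ?_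
    exact hDs.comp (by fun_prop)
  have hcirc : ∀ r θ x, D (r, (θ + 2 * Real.pi, x)) = D (r, (θ, x)) := fun r θ x => by
    simp only [hD, (c _).2.2.1]
  have htor : ∀ r θ x j, D (r, (θ, x + Pi.single j (2 * Real.pi))) = D (r, (θ, x)) :=
    fun r θ x j => by simp only [hD, (c _).2.2.2]
  refine ⟨fun s => ⟨fun z => N (s, z), hNs.comp (contDiff_const.prodMk contDiff_id),
    fun θ x => ?_, fun θ x j => ?_⟩, hNs, fun s => ?_⟩
  · simp only [hN, hcirc]
  · simp only [hN, htor]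
  · refine Subtype.ext (funext fun z => ?_)
    change (c s).1 z = (c s₀).1 z + ((s - s₀ : ℝ) : ℂ) • N (s, z)
    have h1 : ∀ u ∈ Set.uIcc (0 : ℝ) 1, HasDerivAt (fun u : ℝ => (c (s₀ + u * (s - s₀))).1 z)
        ((s - s₀) • D (s₀ + u * (s - s₀), z)) u := by
      intro u _
      have h2 : HasDerivAt (fun u : ℝ => s₀ + u * (s - s₀)) (s - s₀) u := by
        simpa using ((hasDerivAt_id u).mul_const (s - s₀)).const_add s₀
      exact (hDd z _).scomp u h2
    have h3 := intervalIntegral.integral_eq_sub_of_hasDerivAt h1 (Continuous.intervalIntegrable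
      (by
        have : Continuous D := hDs.continuous
        fun_prop) _ _)
    rw [intervalIntegral.integral_smul] at h3
    simp only [one_mul, zero_mul, add_zero, add_sub_cancel] at h3
    simp only [hN, one_smul]
    refine Eq.trans ?_ (congrArg ((c s₀).1 z + ·) h3.symm)
    simp

lemma SmoothFam.exists_factor_deriv {c : ℝ → Loop n} (hc : SmoothFam c) (s₀ : ℝ) :
    ∃ M : ℝ → Loop n, SmoothFam M ∧ HasLoopDerivAt c (M s₀) s₀ ∧
      ∀ s, c s = c s₀ + ((s - s₀ : ℝ) : ℂ) • M s := by
  obtain ⟨M, hM, h⟩ := hc.exists_factor s₀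
  refine ⟨M, hM, fun z => ?_, h⟩
  refine hasDerivAt_of_factor (G := fun s => (M s).1 z) (hM.eval z).continuous.continuousAt
    fun s => ?_
  exact congrArg (fun a : Loop n => a.1 z) (h s)

lemma SmoothFam.factor_of_hasLoopDerivAt {c : ℝ → Loop n} (hc : SmoothFam c) {s₀ : ℝ} {v : Loop n}
    (hv : HasLoopDerivAt c v s₀) : ∃ M : ℝ → Loop n, SmoothFam M ∧ M s₀ = v ∧
      ∀ s, c s = c s₀ + ((s - s₀ : ℝ) : ℂ) • M s := by
  obtain ⟨M, hM, hd, h⟩ := hc.exists_factor_deriv s₀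
  exact ⟨M, hM, hd.unique hv, h⟩

/-- Linearity carries the Hadamard factorization through `φ`, so continuity of `φ` along smooth
curves replaces boundedness. -/
lemma SmoothFam.hasDerivAt_linear {c : ℝ → Loop n} (hc : SmoothFam c) {s₀ : ℝ} {v : Loop n}
    (hv : HasLoopDerivAt c v s₀) (φ : Loop n →ₗ[ℂ] ℂ)
    (hφ : ∀ P : ℝ → Loop n, SmoothFam P → Continuous fun s => φ (P s)) :
    HasDerivAt (fun s => φ (c s)) (φ v) s₀ := by
  obtain ⟨M, hM, rfl, h⟩ := hc.factor_of_hasLoopDerivAt hv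
  refine hasDerivAt_of_factor (G := fun s => φ (M s)) (hφ M hM).continuousAt fun s => ?_
  rw [h s, map_add, map_smul]
  simp

/-- The value of a component at a point as a linear functional. -/
def evalForm (z : ℝ × (Fin n → ℝ)) (i : Fin n) : Loop n →ₗ[ℂ] ℂ where
  toFun a := a.1 z i
  map_add' _ _ := rfl
  map_smul' _ _ := rfl

lemma SmoothFam.hasLoopDerivAt_linear {c : ℝ → Loop n} (hc : SmoothFam c) {s₀ : ℝ} {v : Loop n}
    (hv : HasLoopDerivAt c v s₀) (T : Loop n →ₗ[ℂ] Loop n)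
    (hT : ∀ P : ℝ → Loop n, SmoothFam P → SmoothFam fun s => T (P s)) :
    HasLoopDerivAt (fun s => T (c s)) (T v) s₀ := fun z => hasDerivAt_pi.2 fun i =>
  hc.hasDerivAt_linear hv ((evalForm z i).comp T) fun P hP =>
    (continuous_apply i).comp ((hT P hP).eval z).continuous

lemma SmoothFam.hasDerivAt_pairing {c : ℝ → Loop n} (hc : SmoothFam c) {s₀ : ℝ} {v : Loop n}
    (hv : HasLoopDerivAt c v s₀) (p q : ℕ) (k : Loop n) :
    HasDerivAt (fun s => pairing p q k (c s)) (pairing p q k v) s₀ :=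
  hc.hasDerivAt_linear hv (pairingForm p q k) fun _ hP => continuous_pairing p q k hP

/-- The Leibniz rule: both curves are factored and the bilinear expression is telescoped, changing
one argument at a time. -/
lemma SmoothFam.hasLoopDerivAt_coad {b c : ℝ → Loop n} (hb : SmoothFam b) (hc : SmoothFam c)
    {s₀ : ℝ} {u v : Loop n} (hu : HasLoopDerivAt b u s₀) (hv : HasLoopDerivAt c v s₀) (p q : ℕ) :
    HasLoopDerivAt (fun s => LoopTorus.coad p q (b s) (c s))
      (LoopTorus.coad p q u (c s₀) + LoopTorus.coad p q (b s₀) v) s₀ := by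
  obtain ⟨M, hM, rfl, h⟩ := hb.factor_of_hasLoopDerivAt hu
  obtain ⟨N, hN, rfl, h'⟩ := hc.factor_of_hasLoopDerivAt hv
  intro z
  have hs : SmoothFam fun s => LoopTorus.coad p q (M s) (c s) + LoopTorus.coad p q (b s₀) (N s) :=
    (hM.coad p q hc).add ((SmoothFam.const _).coad p q hN)
  refine hasDerivAt_of_factor (G := fun s => (LoopTorus.coad p q (M s) (c s) +
    LoopTorus.coad p q (b s₀) (N s)).1 z) (hs.eval z).continuous.continuousAt fun s => ?_
  have e : LoopTorus.coad p q (b s) (c s) = LoopTorus.coad p q (b s₀) (c s₀) +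
      ((s - s₀ : ℝ) : ℂ) • (LoopTorus.coad p q (M s) (c s) + LoopTorus.coad p q (b s₀) (N s)) := by
    have e1 : LoopTorus.coad p q (b s) (c s) = LoopTorus.coad p q (b s₀) (c s) +
        ((s - s₀ : ℝ) : ℂ) • LoopTorus.coad p q (M s) (c s) := by
      rw [h s, ← coadForm_apply, map_add, map_smul]
      rfl
    have e2 : LoopTorus.coad p q (b s₀) (c s) = LoopTorus.coad p q (b s₀) (c s₀) +
        ((s - s₀ : ℝ) : ℂ) • LoopTorus.coad p q (b s₀) (N s) := by
      conv_lhs => rw [h' s]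
      rw [← coadForm_apply, map_add, map_smul]
      rfl
    rw [e1, e2, smul_add]
    abel
  exact congrArg (fun a : Loop n => a.1 z) e

/-! ### Smooth maps on open sets of loops -/

lemma isPlot_iff {k : ℕ} {P : EuclideanSpace ℝ (Fin k) → Loop n} :
    Diffeology.IsPlot P ↔ SmoothFam P := Iff.rfl

section Open

variable {U : Set (Loop n)} {E : Type} [NormedAddCommGroup E] [NormedSpace ℝ E]
  [FiniteDimensional ℝ E]

/-- The diffeology tests openness on plots from standard Euclidean spaces; other parameter spaces
are transported there by a linear isomorphism. -/
lemma SmoothFam.isOpen_preimage (hU : IsOpen[Diffeology.dTopology] U) {P : E → Loop n}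
    (hP : SmoothFam P) : IsOpen (P ⁻¹' U) := by
  have hQ : SmoothFam fun w => P ((toEuclidean (E := E)).symm w) :=
    hP.comp (toEuclidean (E := E)).symm.contDiff
  have h := Diffeology.isOpen_iff_preimages_plots.1 hU _ _ (isPlot_iff.2 hQ)
  have h2 := h.preimage (toEuclidean (E := E)).continuous
  convert h2 using 1
  ext w
  simp

lemma SmoothMapOn.smoothFam {X : Loop n → Loop n} (hX : SmoothMapOn U X) {P : E → Loop n}
    (hP : SmoothFam P) (hPU : ∀ w, P w ∈ U) : SmoothFam fun w => X (P w) := by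
  have hQ : SmoothFam fun w => P ((toEuclidean (E := E)).symm w) :=
    hP.comp (toEuclidean (E := E)).symm.contDiff
  have h := hX _ _ (isPlot_iff.2 hQ)
  have hu : ((fun w => P ((toEuclidean (E := E)).symm w)) ⁻¹' U) ×ˢ
      (Set.univ : Set (ℝ × (Fin n → ℝ))) = Set.univ := by
    ext w
    simp [hPU]
  rw [hu, contDiffOn_univ] at h
  have h2 := SmoothFam.comp (P := fun w => X (P ((toEuclidean (E := E)).symm w))) h
    (toEuclidean (E := E)).contDiff
  simpa using h2

lemma SmoothFunOn.contDiff {h : Loop n → ℂ} (hh : SmoothFunOn U h) {P : E → Loop n}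
    (hP : SmoothFam P) (hPU : ∀ w, P w ∈ U) : ContDiff ℝ ∞ fun w => h (P w) := by
  have hQ : SmoothFam fun w => P ((toEuclidean (E := E)).symm w) :=
    hP.comp (toEuclidean (E := E)).symm.contDiff
  have h1 := hh _ _ (isPlot_iff.2 hQ)
  have hu : ((fun w => P ((toEuclidean (E := E)).symm w)) ⁻¹' U) = Set.univ := by
    ext w
    simp [hPU]
  rw [hu, contDiffOn_univ] at h1
  have h2 := h1.comp (toEuclidean (E := E)).contDiff
  simpa [Function.comp_def] using h2

/-- The displacement from `w₀` is multiplied by a bump function supported in a ball inside `S`: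
points near `w₀` stay put, points outside the ball are sent to `w₀`. -/
lemma exists_contDiff_localization {S : Set E} (hS : IsOpen S) {w₀ : E} (hw : w₀ ∈ S) :
    ∃ ρ : E → E, ContDiff ℝ ∞ ρ ∧ (∀ w, ρ w ∈ S) ∧ ρ =ᶠ[𝓝 w₀] id := by
  obtain ⟨ε, hε, hb⟩ := Metric.isOpen_iff.1 hS w₀ hw
  let χ : ContDiffBump w₀ := ⟨ε / 2, ε, by positivity, by linarith⟩
  refine ⟨fun w => w₀ + χ w • (w - w₀), ?_, fun w => hb ?_, ?_⟩
  · exact contDiff_const.add (χ.contDiff.smul (contDiff_id.sub contDiff_const))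
  · rw [Metric.mem_ball, dist_eq_norm, add_sub_cancel_left, norm_smul,
      Real.norm_of_nonneg χ.nonneg]
    by_cases h : dist w w₀ < ε
    · rw [dist_eq_norm] at h
      exact (mul_le_of_le_one_left (norm_nonneg _) χ.le_one).trans_lt h
    · rw [χ.zero_of_le_dist (not_lt.1 h), zero_mul]
      exact hε
  · filter_upwards [χ.eventuallyEq_one] with w hw
    simp [hw]

/-- Gradients are controlled only on `U`. Replacing a family by one with the same germ and all
values in `U` allows global smoothness statements to be used for local questions. -/
lemma SmoothFam.exists_localization (hU : IsOpen[Diffeology.dTopology] U) {P : E → Loop n}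
    (hP : SmoothFam P) {w₀ : E} (hw : P w₀ ∈ U) :
    ∃ Q : E → Loop n, SmoothFam Q ∧ (∀ w, Q w ∈ U) ∧ Q =ᶠ[𝓝 w₀] P := by
  obtain ⟨ρ, hρ, hρS, hρ0⟩ := exists_contDiff_localization (hP.isOpen_preimage hU) hw
  exact ⟨fun w => P (ρ w), hP.comp hρ, hρS, hρ0.mono fun w hw => by simp only [hw, id]⟩

lemma SmoothMapOn.of_smoothFam (hU : IsOpen[Diffeology.dTopology] U) {X : Loop n → Loop n}
    (h : ∀ (k : ℕ) (P : EuclideanSpace ℝ (Fin k) → Loop n), SmoothFam P → (∀ w, P w ∈ U) →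
      SmoothFam fun w => X (P w)) : SmoothMapOn U X := by
  intro k P hP w hw
  obtain ⟨Q, hQ, hQU, hQP⟩ := SmoothFam.exists_localization hU (isPlot_iff.1 hP) hw.1
  refine ContDiffAt.contDiffWithinAt ?_
  refine (h k Q hQ hQU).contDiffAt.congr_of_eventuallyEq ?_
  have : ∀ᶠ w' : EuclideanSpace ℝ (Fin k) × (ℝ × (Fin n → ℝ)) in 𝓝 w, Q w'.1 = P w'.1 :=
    (continuous_fst.tendsto w).eventually hQP
  filter_upwards [this] with w' hw'
  rw [hw']

lemma SmoothMapOn.smoothFunOn {X : Loop n → Loop n} (hX : SmoothMapOn U X)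
    (z : ℝ × (Fin n → ℝ)) (i : Fin n) : SmoothFunOn U fun l => (X l).1 z i := by
  intro k P hP
  have h1 := contDiffOn_pi.1 (hX k P hP) i
  exact h1.comp (t := (P ⁻¹' U) ×ˢ Set.univ)
    (f := fun w : EuclideanSpace ℝ (Fin k) => (w, z)) (by fun_prop) fun w hw => ⟨hw, Set.mem_univ _⟩

/-- The chain rule from directional derivatives. With the factorization `c s = c s₀ + (s - s₀) M s`,
the curve is the diagonal `(s - s₀, s)` of the family `(r, s) ↦ c s₀ + r M s`. On this plane `h` is
differentiable at `(0, s₀)`: its `r`-derivative is the given directional derivative, and its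
`s`-derivative is zero because the family is constant on `r = 0`. -/
lemma SmoothFunOn.hasDerivAt_comp (hU : IsOpen[Diffeology.dTopology] U) {h : Loop n → ℂ}
    (hh : SmoothFunOn U h) {c : ℝ → Loop n} (hc : SmoothFam c) {s₀ : ℝ} (hs : c s₀ ∈ U)
    {m : Loop n} (hm : HasLoopDerivAt c m s₀) {d : ℂ}
    (hd : HasDerivAt (fun s : ℝ => h (c s₀ + (s : ℂ) • m)) d 0) :
    HasDerivAt (fun s => h (c s)) d s₀ := by
  obtain ⟨M, hM, rfl, hcM⟩ := hc.factor_of_hasLoopDerivAt hm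
  set P : ℝ × ℝ → Loop n := fun w => c s₀ + (w.1 : ℂ) • M w.2 with hPdef
  have hP : SmoothFam P := (SmoothFam.const _).add ((hM.comp contDiff_snd).smul contDiff_fst)
  obtain ⟨Q, hQ, hQU, hQP⟩ := hP.exists_localization hU (w₀ := (0, s₀)) (by simpa [hPdef] using hs)
  have hg : HasFDerivAt (fun w => h (P w)) (fderiv ℝ (fun w => h (Q w)) (0, s₀)) (0, s₀) :=
    (((hh.contDiff hQ hQU).differentiable (by simp) _).hasFDerivAt).congr_of_eventuallyEq
      (hQP.mono fun w hw => by simp only [hw])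
  set D := fderiv ℝ (fun w => h (Q w)) (0, s₀)
  have l1 : HasDerivAt (fun r : ℝ => (r, s₀)) ((1 : ℝ), (0 : ℝ)) 0 :=
    (hasDerivAt_id 0).prodMk (hasDerivAt_const _ _)
  have l2 : HasDerivAt (fun w : ℝ => ((0 : ℝ), w)) ((0 : ℝ), (1 : ℝ)) s₀ :=
    (hasDerivAt_const _ _).prodMk (hasDerivAt_id s₀)
  have l3 : HasDerivAt (fun s : ℝ => (s - s₀, s)) ((1 : ℝ), (1 : ℝ)) s₀ :=
    ((hasDerivAt_id s₀).sub_const s₀).prodMk (hasDerivAt_id s₀)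
  have h1 : D (1, 0) = d := by
    have := hg.comp_hasDerivAt (0 : ℝ) l1
    exact this.unique hd
  have h2 : D (0, 1) = 0 := by
    have := hg.comp_hasDerivAt s₀ l2
    refine this.unique ?_
    have e : (fun w => h (P w)) ∘ (fun w : ℝ => ((0 : ℝ), w)) = fun _ => h (c s₀) := by
      funext w
      simp [hPdef]
    rw [e]
    exact hasDerivAt_const _ _
  have h3 : HasDerivAt ((fun w => h (P w)) ∘ fun s : ℝ => (s - s₀, s)) (D (1, 1)) s₀ :=
    HasFDerivAt.comp_hasDerivAt (f := fun s : ℝ => (s - s₀, s)) s₀ (by simpa using hg) l3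
  have e : (fun w => h (P w)) ∘ (fun s : ℝ => (s - s₀, s)) = fun s => h (c s) := by
    funext s
    simp only [Function.comp_apply, hPdef]
    rw [← hcM]
  have e2 : D (1, 1) = d := by
    rw [show ((1 : ℝ), (1 : ℝ)) = (1, 0) + (0, 1) by simp, map_add, h1, h2, add_zero]
  rwa [e, e2] at h3

lemma SmoothMapOn.exists_hasLoopDerivAt (hU : IsOpen[Diffeology.dTopology] U) {X : Loop n → Loop n}
    (hX : SmoothMapOn U X) {c : ℝ → Loop n} (hc : SmoothFam c) {s₀ : ℝ} (hs : c s₀ ∈ U) :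
    ∃ v, HasLoopDerivAt (fun s => X (c s)) v s₀ := by
  obtain ⟨Q, hQ, hQU, hQP⟩ := hc.exists_localization hU hs
  obtain ⟨M, -, hM, -⟩ := (hX.smoothFam hQ hQU).exists_factor_deriv s₀
  exact ⟨_, hM.congr (hQP.mono fun s hs => by simp only [hs])⟩

lemma smoothFam_line (l m : Loop n) : SmoothFam fun s : ℝ => l + (s : ℂ) • m :=
  (SmoothFam.const l).add ((SmoothFam.const m).smul contDiff_id)

lemma hasLoopDerivAt_line (l m : Loop n) : HasLoopDerivAt (fun s : ℝ => l + (s : ℂ) • m) m 0 := by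
  intro z
  refine hasDerivAt_of_factor (G := fun _ => m.1 z) continuousAt_const fun s => ?_
  simp

lemma SmoothMapOn.hasLoopDerivAt_comp (hU : IsOpen[Diffeology.dTopology] U) {X : Loop n → Loop n}
    (hX : SmoothMapOn U X) {c : ℝ → Loop n} (hc : SmoothFam c) {s₀ : ℝ} (hs : c s₀ ∈ U)
    {m v : Loop n} (hm : HasLoopDerivAt c m s₀)
    (hd : HasLoopDerivAt (fun s : ℝ => X (c s₀ + (s : ℂ) • m)) v 0) :
    HasLoopDerivAt (fun s => X (c s)) v s₀ := fun z => hasDerivAt_pi.2 fun i =>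
  (hX.smoothFunOn z i).hasDerivAt_comp hU hc hs hm (hasDerivAt_pi.1 (hd z) i)

end Open

end LoopTorus

namespace LoopTorus

/-! ### The splitting of the loop algebra -/

variable {n : ℕ}

/-- `u` extends holomorphically to the interior of the circle. -/
def ExtendsInside (u : ℝ → ℂ) : Prop :=
  ∃ F : ℂ → ℂ, DiffContOnCl ℂ F (Metric.ball 0 1) ∧ ∀ θ : ℝ, F (exp (θ * I)) = u θ

/-- `u` extends holomorphically to the exterior of the circle and vanishes at infinity. -/
def ExtendsOutside (u : ℝ → ℂ) : Prop :=
  ∃ G : ℂ → ℂ, DiffContOnCl ℂ G (Metric.ball 0 1) ∧ G 0 = 0 ∧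
    ∀ θ : ℝ, G (exp (-(θ * I))) = u θ

lemma ExtendsInside.mul {u v : ℝ → ℂ} (hu : ExtendsInside u) (hv : ExtendsInside v) :
    ExtendsInside fun θ => u θ * v θ := by
  obtain ⟨F, hF, hFu⟩ := hu
  obtain ⟨G, hG, hGv⟩ := hv
  exact ⟨fun z => F z * G z, hF.smul hG, fun θ => by simp only [hFu, hGv]⟩

lemma ExtendsInside.sub {u v : ℝ → ℂ} (hu : ExtendsInside u) (hv : ExtendsInside v) :
    ExtendsInside fun θ => u θ - v θ := by
  obtain ⟨F, hF, hFu⟩ := hu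
  obtain ⟨G, hG, hGv⟩ := hv
  exact ⟨F - G, hF.sub hG, fun θ => by simp [hFu, hGv]⟩

lemma ExtendsInside.sum {ι : Type*} (s : Finset ι) {u : ι → ℝ → ℂ}
    (hu : ∀ i ∈ s, ExtendsInside (u i)) : ExtendsInside fun θ => ∑ i ∈ s, u i θ := by
  classical
  induction s using Finset.induction_on with
  | empty => exact ⟨0, diffContOnCl_const, fun θ => by simp⟩
  | insert i s hi ih =>
    obtain ⟨F, hF, hFu⟩ := hu i (Finset.mem_insert_self _ _)
    obtain ⟨G, hG, hGv⟩ := ih fun j hj => hu j (Finset.mem_insert_of_mem hj)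
    exact ⟨F + G, hF.add hG, fun θ => by simp [hFu, hGv, Finset.sum_insert hi]⟩

lemma ExtendsOutside.mul {u v : ℝ → ℂ} (hu : ExtendsOutside u) (hv : ExtendsOutside v) :
    ExtendsOutside fun θ => u θ * v θ := by
  obtain ⟨F, hF, hF0, hFu⟩ := hu
  obtain ⟨G, hG, hG0, hGv⟩ := hv
  exact ⟨fun z => F z * G z, hF.smul hG, by simp [hF0], fun θ => by simp only [hFu, hGv]⟩

lemma ExtendsOutside.sub {u v : ℝ → ℂ} (hu : ExtendsOutside u) (hv : ExtendsOutside v) :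
    ExtendsOutside fun θ => u θ - v θ := by
  obtain ⟨F, hF, hF0, hFu⟩ := hu
  obtain ⟨G, hG, hG0, hGv⟩ := hv
  exact ⟨F - G, hF.sub hG, by simp [hF0, hG0], fun θ => by simp [hFu, hGv]⟩

lemma ExtendsOutside.sum {ι : Type*} (s : Finset ι) {u : ι → ℝ → ℂ}
    (hu : ∀ i ∈ s, ExtendsOutside (u i)) : ExtendsOutside fun θ => ∑ i ∈ s, u i θ := by
  classical
  induction s using Finset.induction_on with
  | empty => exact ⟨0, diffContOnCl_const, rfl, fun θ => by simp⟩
  | insert i s hi ih =>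
    obtain ⟨F, hF, hF0, hFu⟩ := hu i (Finset.mem_insert_self _ _)
    obtain ⟨G, hG, hG0, hGv⟩ := ih fun j hj => hu j (Finset.mem_insert_of_mem hj)
    exact ⟨F + G, hF.add hG, by simp [hF0, hG0],
      fun θ => by simp [hFu, hGv, Finset.sum_insert hi]⟩

lemma ExtendsInside.continuous {u : ℝ → ℂ} (hu : ExtendsInside u) : Continuous u := by
  obtain ⟨F, hF, hFu⟩ := hu
  have h := hF.continuousOn
  rw [closure_ball _ one_ne_zero] at h
  have : u = fun θ : ℝ => F (exp (θ * I)) := funext fun θ => (hFu θ).symm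
  rw [this]
  exact h.comp_continuous (by fun_prop) fun θ => by simp [Complex.norm_exp_ofReal_mul_I]

lemma ExtendsInside.periodic {u : ℝ → ℂ} (hu : ExtendsInside u) (θ : ℝ) :
    u (θ + 2 * Real.pi) = u θ := by
  obtain ⟨F, hF, hFu⟩ := hu
  rw [← hFu, ← hFu]
  congr 1
  push_cast
  rw [add_mul, Complex.exp_periodic]

lemma ExtendsInside.eq_zero {u : ℝ → ℂ} (hu : ExtendsInside u) (hu' : ExtendsOutside u) (θ : ℝ) :
    u θ = 0 := by
  have hc := hu.continuous
  have hp := hu.periodic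
  obtain ⟨F, hF, hFu⟩ := hu
  obtain ⟨G, hG, hG0, hGu⟩ := hu'
  exact eq_zero_of_both hc hp hF hG hG0 hFu hGu θ

lemma extendsInside_splitPlus {u : ℝ → ℂ} (hu : ContDiff ℝ ∞ u)
    (hp : ∀ θ, u (θ + 2 * Real.pi) = u θ) : ExtendsInside (splitPlus u (deriv (deriv u))) := by
  refine ⟨fun z => ∑' k : ℕ, fc u k * z ^ k,
    diffContOnCl_powerSeries ((fc_summable hu hp).comp_injective Nat.cast_injective), fun θ => ?_⟩
  refine Eq.trans (tsum_congr fun k => ?_) (splitPlus_hasSum hu hp θ).tsum_eq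
  rw [← Complex.exp_nat_mul, mul_assoc]

lemma extendsOutside_sub_splitPlus {u : ℝ → ℂ} (hu : ContDiff ℝ ∞ u)
    (hp : ∀ θ, u (θ + 2 * Real.pi) = u θ) :
    ExtendsOutside fun θ => u θ - splitPlus u (deriv (deriv u)) θ := by
  have hs : Summable (fun k : ℕ => ‖fc u (-(k + 1 : ℕ))‖) :=
    (fc_summable hu hp).comp_injective (i := fun k : ℕ => (-(k + 1 : ℕ) : ℤ))
      (fun a b hab => by simp at hab; exact hab)
  refine ⟨fun z => z * ∑' k : ℕ, fc u (-(k + 1 : ℕ)) * z ^ k,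
    differentiable_id.diffContOnCl.smul (diffContOnCl_powerSeries hs), by simp, fun θ => ?_⟩
  refine Eq.trans ?_ (fc_hasSum_neg hu hp θ).tsum_eq
  refine Eq.trans tsum_mul_left.symm ?_
  refine tsum_congr fun k => ?_
  rw [← Complex.exp_nat_mul, mul_left_comm, ← Complex.exp_add]
  congr 2
  push_cast
  ring

lemma Pplus_mem (a : Loop n) : Pplus n a ∈ plusSpace n := Submodule.projection_apply_mem _ a

lemma sub_Pplus_mem (a : Loop n) : a - Pplus n a ∈ minusSpace n := Submodule.sub_projection_mem _ a

lemma Pplus_eq_self {a : Loop n} : Pplus n a = a ↔ a ∈ plusSpace n :=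
  Submodule.projection_eq_self_iff _ a

lemma Pplus_eq_zero {a : Loop n} : Pplus n a = 0 ↔ a ∈ minusSpace n :=
  Submodule.projection_apply_eq_zero_iff _

lemma Pminus_apply (a : Loop n) : Pminus n a = a - Pplus n a :=
  Submodule.projection_eq_self_sub_projection (isCompl_plus_minus n) a

/-- The splitting is unique for each fixed `x` and component: the difference of two candidates
extends both inside and outside the circle, hence vanishes. The explicit integral formula is what
shows that the projection respects smooth families. -/
lemma Pplus_apply (a : Loop n) (θ : ℝ) (x : Fin n → ℝ) (i : Fin n) :
    (Pplus n a).1 (θ, x) i =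
      splitPlus (fun s => a.1 (s, x) i) (deriv (deriv fun s => a.1 (s, x) i)) θ := by
  have hu := loop_coord_contDiff a x i
  have hp := loop_coord_periodic a x i
  have hb : ExtendsInside fun θ => (Pplus n a).1 (θ, x) i := Pplus_mem a x i
  have hab : ExtendsOutside fun θ => a.1 (θ, x) i - (Pplus n a).1 (θ, x) i := sub_Pplus_mem a x i
  have h1 := hb.sub (extendsInside_splitPlus hu hp)
  have h2 := (extendsOutside_sub_splitPlus hu hp).sub hab
  refine sub_eq_zero.1 (h1.eq_zero ?_ θ)
  convert h2 using 2
  ring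

lemma SmoothFam.Pplus {E : Type} [NormedAddCommGroup E] [NormedSpace ℝ E] [FiniteDimensional ℝ E]
    {P : E → Loop n} (hP : SmoothFam P) : SmoothFam fun e => Pplus n (P e) := by
  refine SmoothFam.of_coord fun i => ?_
  simp only [Pplus_apply, splitPlus]
  have step : ∀ {f : (E × (Fin n → ℝ)) × ℝ → ℂ}, ContDiff ℝ ∞ f →
      ContDiff ℝ ∞ (fun z : (E × (Fin n → ℝ)) × ℝ => deriv (fun s : ℝ => f (z.1, s)) z.2) := by
    intro f hf
    refine ContDiff.fderiv_apply (m := ∞)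
      (f := fun (z : (E × (Fin n → ℝ)) × ℝ) (s : ℝ) => f (z.1, s))
      (k := fun _ => (1 : ℝ)) ?_ contDiff_snd contDiff_const (by simp)
    exact hf.comp ((contDiff_fst.comp contDiff_fst).prodMk contDiff_snd)
  have hf : ContDiff ℝ ∞ fun z : (E × (Fin n → ℝ)) × ℝ => (P z.1.1).1 (z.2, z.1.2) i :=
    ContDiff.comp (g := fun w : E × (ℝ × (Fin n → ℝ)) => (P w.1).1 w.2 i) (contDiff_pi.1 hP i)
      (f := fun z : (E × (Fin n → ℝ)) × ℝ => (z.1.1, (z.2, z.1.2))) (by fun_prop)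
  have hsmooth : ∀ {f : (E × (Fin n → ℝ)) × ℝ → ℂ}, ContDiff ℝ ∞ f → ∀ {K : ℝ → ℂ}, Continuous K →
      SmoothParam fun (e : E × ℝ) x =>
        ∫ φ in (0 : ℝ)..2 * Real.pi, K φ * f ((e.1, x), e.2 + φ) := by
    intro f hf K hK
    refine contDiff_infty.2 fun m => ?_
    refine contDiff_integral_aux 0 (2 * Real.pi) hK m
      (G := fun w : ((E × ℝ) × (Fin n → ℝ)) × ℝ => f ((w.1.1.1, w.1.2), w.1.1.2 + w.2)) ?_
    exact hf.comp (by fun_prop)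
  have h1 := hsmooth hf (K := fun _ => 1) continuous_const
  have h2 := hsmooth (step (step hf)) continuous_splitKernel
  exact contDiff_const.mul (h1.add h2)

/-! ### Compatibility of the splitting with `x`-derivatives and commutators. -/

/-- The translation of a loop in `x`. -/
def translateLoop (v : Fin n → ℝ) (a : Loop n) : Loop n :=
  ofCoord (fun i θ x => a.1 (θ, v + x) i)
    (fun i => (contDiff_pi.1 a.2.1 i).comp (by fun_prop))
    (fun i θ => by simp only [a.2.2.1]) (fun i θ => (loop_torus a θ i).translate v)

lemma translateLoop_apply (v : Fin n → ℝ) (a : Loop n) (θ : ℝ) (x : Fin n → ℝ) (i : Fin n) :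
    (translateLoop v a).1 (θ, x) i = a.1 (θ, v + x) i := rfl

lemma smoothFam_translateLoop (j : Fin n) (a : Loop n) :
    SmoothFam fun s : ℝ => translateLoop (s • Pi.single j 1) a :=
  SmoothFam.of_coord fun i => (contDiff_pi.1 a.2.1 i).comp (by fun_prop)

lemma hasLoopDerivAt_translateLoop (j : Fin n) (a : Loop n) :
    HasLoopDerivAt (fun s : ℝ => translateLoop (s • Pi.single j 1) a) ((pdOp j).onLoop a) 0 := by
  intro z
  refine hasDerivAt_pi.2 fun i => ?_
  have := hasDerivAt_line (loop_contDiff a z.1 i) j z.2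
  simp only [add_comm z.2] at this
  exact this

/-- The projection acts separately at each `x`, so it commutes with translations; differentiating
the translations at zero gives the claim. The extensions defining the two halves are given for each
`x` alone, with no regularity in `x`, so they cannot be differentiated directly. -/
lemma Pplus_pdOp (j : Fin n) (a : Loop n) :
    Pplus n ((pdOp j).onLoop a) = (pdOp j).onLoop (Pplus n a) := by
  have h1 := (smoothFam_translateLoop j a).hasLoopDerivAt_linear (hasLoopDerivAt_translateLoop j a)
    (Pplus n) fun P hP => hP.Pplus
  have h2 := hasLoopDerivAt_translateLoop j (Pplus n a)
  refine h1.unique ?_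
  convert h2 using 2 with s
  refine loop_ext fun θ x i => ?_
  rw [translateLoop_apply, Pplus_apply, Pplus_apply]
  rfl

lemma pdOp_mem_plusSpace (j : Fin n) {a : Loop n} (ha : a ∈ plusSpace n) :
    (pdOp j).onLoop a ∈ plusSpace n := by
  rw [← Pplus_eq_self, Pplus_pdOp, Pplus_eq_self.2 ha]

lemma pdOp_mem_minusSpace (j : Fin n) {a : Loop n} (ha : a ∈ minusSpace n) :
    (pdOp j).onLoop a ∈ minusSpace n := by
  rw [← Pplus_eq_zero, Pplus_pdOp, Pplus_eq_zero.2 ha]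
  refine loop_ext fun θ x i => ?_
  rw [SmoothTorusOp.onLoop_apply]
  change pd j (fun _ => (0 : ℂ)) x = 0
  simp [pd]

/-- The components of the commutator are sums of products of components and their `x`-derivatives,
and holomorphic extension survives all of these operations. -/
lemma bracket_mem_plusSpace {a b : Loop n} (ha : a ∈ plusSpace n) (hb : b ∈ plusSpace n) :
    bracket a b ∈ plusSpace n := by
  intro x i
  have ha' : ∀ j, ExtendsInside fun θ => a.1 (θ, x) j := ha x
  have hb' : ∀ j, ExtendsInside fun θ => b.1 (θ, x) j := hb x
  exact ExtendsInside.sum Finset.univ fun j _ =>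
    ((ha' j).mul (pdOp_mem_plusSpace j hb x i)).sub ((hb' j).mul (pdOp_mem_plusSpace j ha x i))

lemma bracket_mem_minusSpace {a b : Loop n} (ha : a ∈ minusSpace n) (hb : b ∈ minusSpace n) :
    bracket a b ∈ minusSpace n := by
  intro x i
  have ha' : ∀ j, ExtendsOutside fun θ => a.1 (θ, x) j := ha x
  have hb' : ∀ j, ExtendsOutside fun θ => b.1 (θ, x) j := hb x
  exact ExtendsOutside.sum Finset.univ fun j _ =>
    ((ha' j).mul (pdOp_mem_minusSpace j hb x i)).sub ((hb' j).mul (pdOp_mem_minusSpace j ha x i))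

/-- The Rota–Baxter identity for `P₊`: the commutator of the two minus parts projects to zero, the
commutator of the two plus parts to itself. It is the algebraic source of zero curvature. -/
lemma Pplus_bracket (a b : Loop n) :
    Pplus n (bracket a b) = Pplus n (bracket (Pplus n a) b) + Pplus n (bracket a (Pplus n b)) -
      bracket (Pplus n a) (Pplus n b) := by
  have h1 := Pplus_eq_zero.2 (bracket_mem_minusSpace (sub_Pplus_mem a) (sub_Pplus_mem b))
  have h2 := Pplus_eq_self.2 (bracket_mem_plusSpace (Pplus_mem a) (Pplus_mem b))
  simp only [← bracketForm_apply, map_sub, LinearMap.sub_apply] at h1 h2 ⊢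
  rw [h2] at h1
  have h3 : Pplus n (bracketForm a b) - (Pplus n (bracketForm (Pplus n a) b) +
    Pplus n (bracketForm a (Pplus n b)) - bracketForm (Pplus n a) (Pplus n b)) = 0 := by
    rw [← h1]
    abel
  exact sub_eq_zero.1 h3

/-! ### Holomorphic extension -/

lemma extend_of_lt {lam : ℂ} (h : ‖lam‖ < 1) (a : Loop n) (x : Fin n → ℝ) (i : Fin n) :
    extend a lam x i = (2 * Real.pi * I)⁻¹ * ∫ φ in (0 : ℝ)..2 * Real.pi,
      (I * exp (φ * I) / (exp (φ * I) - lam)) * a.1 (φ, x) i := by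
  rw [extend, if_pos h]
  congr 1
  refine intervalIntegral.integral_congr fun φ _ => ?_
  ring

lemma extend_of_not_lt {lam : ℂ} (h : ¬‖lam‖ < 1) (a : Loop n) (x : Fin n → ℝ) :
    extend a lam x = a.1 (arg lam, x) := by
  rw [extend, if_neg h]

lemma continuous_cauchyKernel {lam : ℂ} (h : ‖lam‖ < 1) :
    Continuous fun φ : ℝ => I * exp (φ * I) / (exp (φ * I) - lam) := by
  refine Continuous.div (by fun_prop) (by fun_prop) fun φ h0 => ?_
  rw [sub_eq_zero] at h0
  rw [← h0, Complex.norm_exp_ofReal_mul_I] at h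
  exact lt_irrefl _ h

/-- The value of the holomorphic extension as a linear functional. -/
def extendForm (lam : ℂ) (x : Fin n → ℝ) (i : Fin n) : Loop n →ₗ[ℂ] ℂ where
  toFun a := extend a lam x i
  map_add' a b := by
    by_cases h : ‖lam‖ < 1
    · have hc : ∀ a : Loop n, IntervalIntegrable (fun φ : ℝ =>
          (I * exp (φ * I) / (exp (φ * I) - lam)) * a.1 (φ, x) i) volume 0 (2 * Real.pi) :=
        fun a => ((continuous_cauchyKernel h).mul
          (loop_coord_contDiff a x i).continuous).intervalIntegrable _ _
      rw [extend_of_lt h, extend_of_lt h, extend_of_lt h, ← mul_add,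
        ← intervalIntegral.integral_add (hc a) (hc b)]
      congr 1
      exact intervalIntegral.integral_congr fun φ _ => mul_add _ _ _
    · simp only [extend_of_not_lt h]
      rfl
  map_smul' r a := by
    by_cases h : ‖lam‖ < 1
    · rw [extend_of_lt h, extend_of_lt h, RingHom.id_apply, smul_eq_mul, mul_left_comm,
        ← intervalIntegral.integral_const_mul r]
      congr 1
      exact intervalIntegral.integral_congr fun φ _ => mul_left_comm _ _ _
    · simp only [extend_of_not_lt h]
      rfl

lemma SmoothFam.extend {E : Type} [NormedAddCommGroup E] [NormedSpace ℝ E] [FiniteDimensional ℝ E]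
    {P : E → Loop n} (hP : SmoothFam P) (lam : ℂ) (i : Fin n) :
    SmoothParam fun e x => extend (P e) lam x i := by
  by_cases h : ‖lam‖ < 1
  · simp only [extend_of_lt h]
    refine ContDiff.mul contDiff_const (contDiff_infty.2 fun m => ?_)
    refine contDiff_integral_aux 0 (2 * Real.pi) (continuous_cauchyKernel h) m
      (G := fun w : (E × (Fin n → ℝ)) × ℝ => (P w.1.1).1 (w.2, w.1.2) i) ?_
    exact ContDiff.comp (g := fun w : E × (ℝ × (Fin n → ℝ)) => (P w.1).1 w.2 i)
      (contDiff_pi.1 hP i)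
      (f := fun z : (E × (Fin n → ℝ)) × ℝ => (z.1.1, (z.2, z.1.2))) (by fun_prop)
  · simp only [extend_of_not_lt h]
    exact ContDiff.comp (g := fun w : E × (ℝ × (Fin n → ℝ)) => (P w.1).1 w.2 i)
      (contDiff_pi.1 hP i)
      (f := fun z : E × (Fin n → ℝ) => (z.1, (arg lam, z.2))) (by fun_prop)

lemma isTorusFun_extend (a : Loop n) (lam : ℂ) (i : Fin n) :
    IsTorusFun fun x => extend a lam x i := by
  refine ⟨((SmoothFam.const (E := ℝ) a).extend lam i).section_contDiff 0, fun x j => ?_⟩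
  by_cases h : ‖lam‖ < 1
  · simp only [extend_of_lt h, a.2.2.2]
  · simp only [extend_of_not_lt h, a.2.2.2]

lemma SmoothFam.hasDerivAt_extend {c : ℝ → Loop n} (hc : SmoothFam c) {s₀ : ℝ} {v : Loop n}
    (hv : HasLoopDerivAt c v s₀) (lam : ℂ) (x : Fin n → ℝ) :
    HasDerivAt (fun s => LoopTorus.extend (c s) lam x) (LoopTorus.extend v lam x) s₀ :=
  hasDerivAt_pi.2 fun i => hc.hasDerivAt_linear hv (extendForm lam x i) fun _ hP =>
    (ContDiff.continuous (𝕜 := ℝ) (n := ∞) (hP.extend lam i)).comp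
      (by fun_prop : Continuous fun s : ℝ => (s, x))

/-- Evaluating the extension commutes with translation in `x`, and translations differentiate to the
partial derivative. -/
lemma pd_extend (a : Loop n) (lam : ℂ) (j i : Fin n) (x : Fin n → ℝ) :
    pd j (fun z => extend a lam z i) x = extend ((pdOp j).onLoop a) lam x i := by
  have h1 := hasDerivAt_pi.1 ((smoothFam_translateLoop j a).hasDerivAt_extend
    (hasLoopDerivAt_translateLoop j a) lam x) i
  refine (hasDerivAt_line (isTorusFun_extend a lam i).1 j x).unique ?_
  convert h1 using 2 with s
  rw [add_comm]
  by_cases h : ‖lam‖ < 1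
  · simp only [extend_of_lt h, translateLoop_apply]
  · simp only [extend_of_not_lt h, translateLoop_apply]

/-- Cauchy's formula inside the disc; on the circle, `λ = exp (i arg λ)`. -/
lemma extend_eq {a : Loop n} {x : Fin n → ℝ} {i : Fin n} {F : ℂ → ℂ}
    (hF : DiffContOnCl ℂ F (Metric.ball 0 1)) (hFa : ∀ θ : ℝ, F (exp (θ * I)) = a.1 (θ, x) i)
    {lam : ℂ} (hlam : ‖lam‖ ≤ 1) : extend a lam x i = F lam := by
  by_cases h : ‖lam‖ < 1
  · have hc := hF.circleIntegral_sub_inv_smul (w := lam) (by simpa using h)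
    rw [circleIntegral] at hc
    rw [extend_of_lt h]
    have hpi : (2 * Real.pi * I : ℂ) ≠ 0 := by simp [Real.pi_ne_zero]
    rw [inv_mul_eq_iff_eq_mul₀ hpi]
    refine Eq.trans ?_ hc
    refine intervalIntegral.integral_congr fun φ _ => ?_
    simp only [circleMap, deriv_circleMap, ← hFa, smul_eq_mul]
    simp
    ring
  · rw [extend_of_not_lt h, ← hFa]
    congr 1
    have h1 : ‖lam‖ = 1 := le_antisymm hlam (not_lt.1 h)
    have := Complex.norm_mul_exp_arg_mul_I lam
    rwa [h1, ofReal_one, one_mul] at this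

/-- Extensions of the components and of their `x`-derivatives combine, by the formula for the
commutator, into an extension of the commutator; `extend` computes the values of each of them on the
closed disc. -/
lemma fieldBracket_extend {a b : Loop n} (ha : a ∈ plusSpace n) (hb : b ∈ plusSpace n) {lam : ℂ}
    (hlam : ‖lam‖ ≤ 1) (x : Fin n → ℝ) :
    fieldBracket (extend a lam) (extend b lam) x = extend (bracket a b) lam x := by
  funext k
  choose Fa hFa hFa' using ha x
  choose Fb hFb hFb' using hb x
  choose Ga hGa hGa' using fun j => pdOp_mem_plusSpace j ha x k
  choose Gb hGb hGb' using fun j => pdOp_mem_plusSpace j hb x k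
  have hd : ∀ s : Finset (Fin n), DiffContOnCl ℂ
      (fun z => ∑ j ∈ s, (Fa j z * Gb j z - Fb j z * Ga j z)) (Metric.ball 0 1) := by
    intro s
    induction s using Finset.induction_on with
    | empty => simpa using diffContOnCl_const
    | insert j s hj ih =>
      simp only [Finset.sum_insert hj]
      exact (((hFa j).smul (hGb j)).sub ((hFb j).smul (hGa j))).add ih
  have h := extend_eq (a := bracket a b) (x := x) (i := k) (hd Finset.univ) (fun θ => by
    simp only [hFa', hFb', hGa', hGb']
    rfl) hlam
  rw [h]
  refine Finset.sum_congr rfl fun j _ => ?_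
  rw [pd_extend, pd_extend, extend_eq (hFa j) (hFa' j) hlam, extend_eq (hFb j) (hFb' j) hlam,
    extend_eq (hGa j) (hGa' j) hlam, extend_eq (hGb j) (hGb' j) hlam]

end LoopTorus

namespace LoopTorus

/-! ### Gradients of Casimir functions and the flows they generate -/

variable {n : ℕ} {p q : ℕ} {U : Set (Loop n)} {h : Loop n → ℂ}

lemma IsSmoothFunctionalOn.hasGrad_grad (hh : IsSmoothFunctionalOn p q U h) {l : Loop n}
    (hl : l ∈ U) : HasGrad p q h l (grad p q h l) := by
  rw [grad, dif_pos (hh.hasGrad l hl)]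
  exact (hh.hasGrad l hl).choose_spec

lemma SmoothMapOn.hasDerivAt_pairing (hU : IsOpen[Diffeology.dTopology] U) {X : Loop n → Loop n}
    (hX : SmoothMapOn U X) {c : ℝ → Loop n} (hc : SmoothFam c) {s₀ : ℝ} (hs : c s₀ ∈ U)
    {v : Loop n} (hv : HasLoopDerivAt (fun s => X (c s)) v s₀) (p q : ℕ) (k : Loop n) :
    HasDerivAt (fun s => pairing p q k (X (c s))) (pairing p q k v) s₀ := by
  obtain ⟨Q, hQ, hQU, hQP⟩ := hc.exists_localization hU hs
  have h1 := (hX.smoothFam hQ hQU).hasDerivAt_pairing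
    (hv.congr (hQP.mono fun s hs => by simp only [hs])) p q k
  exact h1.congr_of_eventuallyEq (hQP.mono fun s hs => by simp only [hs])

/-- Moving in the direction `e` translates the family by multiples of `m`, so the derivative is the
pairing of `m` with the gradient. It holds on a neighbourhood of `w₀`, so that it can be
differentiated once more. -/
lemma IsSmoothFunctionalOn.fderiv_comp (hh : IsSmoothFunctionalOn p q U h)
    {P Q : ℝ × ℝ → Loop n} (hQ : SmoothFam Q) (hQU : ∀ w, Q w ∈ U) {w₀ : ℝ × ℝ}
    (hQP : Q =ᶠ[𝓝 w₀] P) {e : ℝ × ℝ} {m : Loop n} (hP : ∀ w (s : ℝ), P (w + s • e) = P w + (s : ℂ) • m) :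
    ∀ᶠ w in 𝓝 w₀, fderiv ℝ (fun w => h (Q w)) w e = pairing p q m (grad p q h (P w)) := by
  filter_upwards [hQP.eventually_nhds] with w hw
  have hPw : P w ∈ U := hw.self_of_nhds ▸ hQU w
  have h1 := hh.hasGrad_grad hPw m
  have h2 : HasFDerivAt (fun w => h (P w)) (fderiv ℝ (fun w => h (Q w)) w) (w + (0 : ℝ) • e) := by
    rw [zero_smul, add_zero]
    exact (((hh.smooth.contDiff hQ hQU).differentiable (by simp) w).hasFDerivAt).congr_of_eventuallyEq
      (hw.mono fun w' hw' => by simp only [hw'])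
  have h3 : HasDerivAt (fun s : ℝ => w + s • e) e 0 := by
    simpa using ((hasDerivAt_id (0 : ℝ)).smul_const e).const_add w
  have h4 := h2.comp_hasDerivAt (0 : ℝ) h3
  refine h4.unique (h1.congr_of_eventuallyEq (Filter.Eventually.of_forall fun s => ?_))
  simp only [Function.comp_apply, hP]

/-- The derivative of the gradient is symmetric with respect to the pairing. -/
lemma IsSmoothFunctionalOn.pairing_grad_symm (hU : IsOpen[Diffeology.dTopology] U)
    (hh : IsSmoothFunctionalOn p q U h) {l : Loop n} (hl : l ∈ U) {m m' d d' : Loop n}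
    (hd : HasLoopDerivAt (fun s : ℝ => grad p q h (l + (s : ℂ) • m)) d 0)
    (hd' : HasLoopDerivAt (fun s : ℝ => grad p q h (l + (s : ℂ) • m')) d' 0) :
    pairing p q m' d = pairing p q m d' := by
  set P : ℝ × ℝ → Loop n := fun w => l + (w.1 : ℂ) • m + (w.2 : ℂ) • m' with hPdef
  have hP : SmoothFam P := ((SmoothFam.const l).add ((SmoothFam.const m).smul contDiff_fst)).add
    ((SmoothFam.const m').smul contDiff_snd)
  obtain ⟨Q, hQ, hQU, hQP⟩ := hP.exists_localization hU (w₀ := 0) (by simpa [hPdef] using hl)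
  set φ : ℝ × ℝ → ℂ := fun w => h (Q w)
  have hφ : ContDiff ℝ ∞ φ := hh.smooth.contDiff hQ hQU
  have hφ' : HasFDerivAt (fderiv ℝ φ) (fderiv ℝ (fderiv ℝ φ) 0) 0 :=
    ((hφ.fderiv_right (m := ∞) (by simp)).differentiable (by simp) 0).hasFDerivAt
  -- One entry of the second derivative of `h` on the plane spanned by `m` and `m'`: the first
  -- derivative along `e'` is a pairing with the gradient, and differentiating it along `e`
  -- differentiates the gradient.
  have key : ∀ (e e' : ℝ × ℝ) (k k' δ : Loop n),
      (∀ w (s : ℝ), P (w + s • e) = P w + (s : ℂ) • k) →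
      (∀ w (s : ℝ), P (w + s • e') = P w + (s : ℂ) • k') →
      HasLoopDerivAt (fun s : ℝ => grad p q h (l + (s : ℂ) • k)) δ 0 →
      fderiv ℝ (fderiv ℝ φ) 0 e e' = pairing p q k' δ := by
    intro e e' k k' δ hPe hPe' hδ
    have h1 := hh.fderiv_comp hQ hQU hQP hPe'
    have h2 := hh.smooth_grad.hasDerivAt_pairing hU (smoothFam_line l k) (s₀ := 0)
      (by simpa using hl) hδ p q k'
    have h3 : HasDerivAt (fun s : ℝ => s • e) e 0 := by
      simpa using (hasDerivAt_id (0 : ℝ)).smul_const e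
    have h4 : HasDerivAt (fun s : ℝ => fderiv ℝ φ (s • e)) (fderiv ℝ (fderiv ℝ φ) 0 e) 0 :=
      HasFDerivAt.comp_hasDerivAt (f := fun s : ℝ => s • e) (0 : ℝ) (by simpa using hφ') h3
    have h5 := h4.clm_apply (hasDerivAt_const (0 : ℝ) e')
    simp only [map_zero, add_zero] at h5
    refine h5.unique (h2.congr_of_eventuallyEq ?_)
    have hc : Filter.Tendsto (fun s : ℝ => s • e) (𝓝 0) (𝓝 0) := by
      simpa using h3.continuousAt.tendsto
    filter_upwards [hc.eventually h1] with s hs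
    rw [hs]
    congr 2
    have := hPe 0 s
    rw [zero_add] at this
    rw [this]
    simp [hPdef]
  have e1 : ∀ w (s : ℝ), P (w + s • (1, 0)) = P w + (s : ℂ) • m := by
    intro w s
    simp only [hPdef, Prod.fst_add, Prod.snd_add, Prod.smul_fst, Prod.smul_snd, smul_eq_mul, mul_one,
      mul_zero, add_zero, ofReal_add, add_smul]
    abel
  have e2 : ∀ w (s : ℝ), P (w + s • (0, 1)) = P w + (s : ℂ) • m' := by
    intro w s
    simp only [hPdef, Prod.fst_add, Prod.snd_add, Prod.smul_fst, Prod.smul_snd, smul_eq_mul, mul_one,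
      mul_zero, add_zero, ofReal_add, add_smul]
    abel
  rw [← key _ _ m m' d e1 e2 hd, ← key _ _ m' m d' e2 e1 hd']
  exact (hφ.contDiffAt.isSymmSndFDerivAt (by
    simp only [minSmoothness_of_isRCLikeNormedField]; exact WithTop.coe_le_coe.2 le_top)).eq _ _

lemma IsCasimirOn.pairing_bracket (hh : IsCasimirOn p q U h) {l : Loop n} (hl : l ∈ U)
    (c : Loop n) : pairing p q l (bracket (grad p q h l) c) = 0 := by
  have := hh.coad_grad l hl c
  rw [← pairingForm_apply, map_zero, LinearMap.zero_apply] at this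
  exact neg_eq_zero.1 this.symm

lemma IsCasimirOn.coad_grad_eq_zero (hh : IsCasimirOn p q U h) {l : Loop n} (hl : l ∈ U) :
    coad p q (grad p q h l) l = 0 := (isCoad_coad p q _ l).unique (hh.coad_grad l hl)

lemma pairing_bracket_skew (l a b : Loop n) :
    pairing p q l (bracket a b) = -pairing p q l (bracket b a) := by
  rw [bracket_skew, ← pairingForm_apply, map_neg, pairingForm_apply]

/-- The derivative of the identity `(l, [∇h(l), c]) = 0`. -/
lemma IsCasimirOn.pairing_bracket_deriv (hU : IsOpen[Diffeology.dTopology] U)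
    (hh : IsCasimirOn p q U h) {l : Loop n} (hl : l ∈ U) {m d : Loop n}
    (hd : HasLoopDerivAt (fun s : ℝ => grad p q h (l + (s : ℂ) • m)) d 0) (c : Loop n) :
    pairing p q l (bracket d c) + pairing p q m (bracket (grad p q h l) c) = 0 := by
  have hline := smoothFam_line l m
  have hl0 : l + ((0 : ℝ) : ℂ) • m ∈ U := by simpa using hl
  -- Written as `(ad*_c (l + s m), ∇h)`, the identity is affine in `s` in its first slot. It thus
  -- splits into two pairings with fixed forms, and only the gradient remains to be differentiated.
  have h1 := hh.smooth_grad.hasDerivAt_pairing hU hline (s₀ := 0) hl0 hd p q (coad p q c l)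
  have h2 := hh.smooth_grad.hasDerivAt_pairing hU hline (s₀ := 0) hl0 hd p q (coad p q c m)
  have h0 : HasDerivAt (fun φ : ℝ => (φ : ℂ)) 1 (0 : ℝ) := Complex.ofRealCLM.hasDerivAt
  have h3 := h1.add (h0.mul h2)
  have hev : ∀ᶠ s : ℝ in 𝓝 0, l + (s : ℂ) • m ∈ U :=
    (hline.isOpen_preimage hU).mem_nhds hl0
  have h4 : HasDerivAt (fun _ : ℝ => (0 : ℂ)) 0 (0 : ℝ) := hasDerivAt_const _ _
  have h5 := h3.unique (h4.congr_of_eventuallyEq (by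
    filter_upwards [hev] with s hs
    have h6 := hh.pairing_bracket hs c
    rw [pairing_bracket_skew, ← pairing_coad] at h6
    rw [← coadForm_apply, map_add, map_smul, ← pairingForm_apply, map_add, map_smul] at h6
    exact h6))
  simp only [ofReal_zero, zero_smul, add_zero, one_mul, zero_mul, pairing_coad] at h5
  rw [pairing_bracket_skew l d, pairing_bracket_skew m]
  exact h5

/-- Along a curve that is tangent to the coadjoint orbit, the gradient of a Casimir function is
moved by the adjoint action. -/
lemma IsCasimirOn.hasLoopDerivAt_grad (hU : IsOpen[Diffeology.dTopology] U)
    (hh : IsCasimirOn p q U h) {c : ℝ → Loop n} (hc : SmoothFam c) {s₀ : ℝ} (hs : c s₀ ∈ U)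
    {v : Loop n} (hv : HasLoopDerivAt c (coad p q v (c s₀)) s₀) :
    HasLoopDerivAt (fun s => grad p q h (c s)) (bracket v (grad p q h (c s₀))) s₀ := by
  have hex : ∀ m, ∃ d, HasLoopDerivAt (fun s : ℝ => grad p q h (c s₀ + (s : ℂ) • m)) d 0 := fun m =>
    hh.smooth_grad.exists_hasLoopDerivAt hU (smoothFam_line (c s₀) m) (by simpa using hs)
  obtain ⟨d, hd⟩ := hex (coad p q v (c s₀))
  have e : d = bracket v (grad p q h (c s₀)) := by
    refine pairing_ext_right p q fun m' => ?_
    obtain ⟨d', hd'⟩ := hex m'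
    -- Symmetry moves the derivative to the arbitrary direction `m'`, where the differentiated
    -- Casimir identity applies: `(m', d) = (ad*_v l, d') = -(l, [v, d']) = (l, [d', v]) = -(m',
    -- [∇h, v])`.
    rw [hh.pairing_grad_symm hU hs hd hd', pairing_coad, pairing_bracket_skew, neg_neg,
      pairing_bracket_skew m']
    exact eq_neg_of_add_eq_zero_left (hh.pairing_bracket_deriv hU hs hd' v)
  rw [← e]
  exact hh.smooth_grad.hasLoopDerivAt_comp hU hc hs hv hd

lemma hasLoopDerivAt_const (a : Loop n) (s : ℝ) : HasLoopDerivAt (fun _ => a) 0 s :=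
  fun _ => hasDerivAt_const _ _

/-- Since `ad*_{∇h} l = 0`, the constant curve at `l` has velocity `ad*_v l` with `v = ∇h`. Along it
the gradient of `h'` changes by `[∇h, ∇h']`, but it is constant. -/
lemma IsCasimirOn.bracket_grad_eq_zero {h' : Loop n → ℂ} (hU : IsOpen[Diffeology.dTopology] U)
    (hh : IsCasimirOn p q U h) (hh' : IsCasimirOn p q U h') {l : Loop n} (hl : l ∈ U) :
    bracket (grad p q h l) (grad p q h' l) = 0 := by
  have h1 := hh'.hasLoopDerivAt_grad hU (SmoothFam.const (E := ℝ) l) (s₀ := 0) hl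
    (v := grad p q h l) (by rw [hh.coad_grad_eq_zero hl]; exact hasLoopDerivAt_const l 0)
  exact h1.unique (hasLoopDerivAt_const _ 0)

lemma IsSmoothFunctionalOn.smoothMapOn_flowField (hU : IsOpen[Diffeology.dTopology] U)
    (hh : IsSmoothFunctionalOn p q U h) : SmoothMapOn U (flowField p q h) :=
  SmoothMapOn.of_smoothFam hU fun _ _ hP hPU =>
    (((hh.smooth_grad.smoothFam hP hPU).Pplus).coad p q hP).neg

lemma IsCasimirOn.hasLoopDerivAt_gradPlus (hU : IsOpen[Diffeology.dTopology] U)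
    (hh : IsCasimirOn p q U h) {c : ℝ → Loop n} (hc : SmoothFam c) {s₀ : ℝ} (hs : c s₀ ∈ U)
    {v : Loop n} (hv : HasLoopDerivAt c (coad p q v (c s₀)) s₀) :
    HasLoopDerivAt (fun s => gradPlus p q h (c s))
      (Pplus n (bracket v (grad p q h (c s₀)))) s₀ := by
  obtain ⟨Q, hQ, hQU, hQP⟩ := hc.exists_localization hU hs
  have h1 := (hh.hasLoopDerivAt_grad hU hc hs hv).congr
    (c' := fun s => grad p q h (Q s)) (hQP.mono fun s hs => by simp only [hs])
  have h2 := (hh.smooth_grad.smoothFam hQ hQU).hasLoopDerivAt_linear h1 (Pplus n)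
    fun P hP => hP.Pplus
  exact h2.congr (hQP.mono fun s hs => by simp only [hs, gradPlus])

lemma IsCasimirOn.hasLoopDerivAt_flowField (hU : IsOpen[Diffeology.dTopology] U)
    (hh : IsCasimirOn p q U h) {c : ℝ → Loop n} (hc : SmoothFam c) {s₀ : ℝ} (hs : c s₀ ∈ U)
    {v : Loop n} (hv : HasLoopDerivAt c (coad p q v (c s₀)) s₀) :
    HasLoopDerivAt (fun s => flowField p q h (c s))
      (-(coad p q (Pplus n (bracket v (grad p q h (c s₀)))) (c s₀) +
        coad p q (gradPlus p q h (c s₀)) (coad p q v (c s₀)))) s₀ := by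
  obtain ⟨Q, hQ, hQU, hQP⟩ := hc.exists_localization hU hs
  have e0 := hQP.self_of_nhds
  have h1 := (hh.hasLoopDerivAt_gradPlus hU hc hs hv).congr
    (c' := fun s => gradPlus p q h (Q s)) (hQP.mono fun s hs => by simp only [hs])
  have h2 := ((hh.smooth_grad.smoothFam hQ hQU).Pplus).hasLoopDerivAt_coad hQ h1 (hv.congr hQP) p q
  rw [e0] at h2
  intro z
  have h3 := (h2 z).neg
  exact h3.congr_of_eventuallyEq (hQP.mono fun s hs => by simp only [flowField, ← hs]; rfl)

/-- The vector field is tangent to the coadjoint orbit, with `v = -∇h₊`; this is the form in which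
the evolution of gradients applies to it. -/
lemma flowField_eq (p q : ℕ) (h : Loop n → ℂ) (l : Loop n) :
    flowField p q h l = coad p q (-gradPlus p q h l) l := by
  rw [flowField, ← coadForm_apply, ← coadForm_apply, map_neg]
  rfl

/-- From `P₋ = 1 - P₊` one has `R = P₊ - 1/2`. The Casimir property removes `(l, [∇h, R ∇f])` and
the contribution of `1/2`, so only `(l, [∇h₊, ∇f])` survives. -/
lemma IsCasimirOn.pairing_flowField (hh : IsCasimirOn p q U h) (f : Loop n → ℂ) {l : Loop n}
    (hl : l ∈ U) : poissonR p q h f l = pairing p q (flowField p q h l) (grad p q f l) := by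
  have hR : Rmap n (grad p q h l) = gradPlus p q h l - (1 / 2 : ℂ) • grad p q h l := by
    rw [Rmap, LinearMap.smul_apply, LinearMap.sub_apply, Pminus_apply, gradPlus]
    module
  rw [poissonR, bracketR, pairing_add_right, hh.pairing_bracket hl, add_zero, hR,
    ← bracketForm_apply, map_sub, map_smul, LinearMap.sub_apply, LinearMap.smul_apply,
    ← pairingForm_apply, map_sub, map_smul, pairingForm_apply, pairingForm_apply, bracketForm_apply,
    bracketForm_apply, hh.pairing_bracket hl, smul_zero, sub_zero, flowField, ← pairingForm_apply,
    ← pairingForm_apply, map_neg, LinearMap.neg_apply, pairingForm_apply, pairingForm_apply,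
    pairing_coad, neg_neg]

lemma IsCasimirOn.hamiltonian (hU : IsOpen[Diffeology.dTopology] U) (hh : IsCasimirOn p q U h)
    {f : Loop n → ℂ} (hf : IsSmoothFunctionalOn p q U f) {c : ℝ → Loop n} (hc : SmoothFam c)
    {s : ℝ} (hs : c s ∈ U) (hd : HasLoopDerivAt c (flowField p q h (c s)) s) :
    HasDerivAt (fun r => f (c r)) (poissonR p q h f (c s)) s := by
  rw [hh.pairing_flowField f hs]
  exact hf.smooth.hasDerivAt_comp hU hc hs hd (hf.hasGrad_grad hs _)

/-- The bracket reduces to `(l, [∇h₊, ∇h'])`, which vanishes by the Casimir property of the second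
function. -/
lemma IsCasimirOn.poissonR_eq_zero {h' : Loop n → ℂ} (hh : IsCasimirOn p q U h)
    (hh' : IsCasimirOn p q U h') {l : Loop n} (hl : l ∈ U) : poissonR p q h h' l = 0 := by
  rw [hh.pairing_flowField h' hl, flowField_eq, pairing_coad, pairing_bracket_skew,
    hh'.pairing_bracket hl, neg_zero, neg_zero]

/-- The zero-curvature relation between the projected gradients of two Casimir functions. -/
lemma IsCasimirOn.gradPlus_curvature {h' : Loop n → ℂ} (hU : IsOpen[Diffeology.dTopology] U)
    (hh : IsCasimirOn p q U h) (hh' : IsCasimirOn p q U h') {l : Loop n} (hl : l ∈ U) :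
    Pplus n (bracket (-gradPlus p q h l) (grad p q h' l)) -
      Pplus n (bracket (-gradPlus p q h' l) (grad p q h l)) +
      bracket (gradPlus p q h l) (gradPlus p q h' l) = 0 := by
  have h1 := Pplus_bracket (grad p q h l) (grad p q h' l)
  rw [hh.bracket_grad_eq_zero hU hh' hl, map_zero,
    bracket_skew (grad p q h l) (Pplus n (grad p q h' l))] at h1
  simp only [← bracketForm_apply, map_neg, LinearMap.neg_apply, gradPlus] at h1 ⊢
  have h2 := congrArg Neg.neg h1
  rw [neg_zero] at h2
  rw [h2]
  abel

lemma IsCasimirOn.flow_commute {h' : Loop n → ℂ} (hU : IsOpen[Diffeology.dTopology] U)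
    (hh : IsCasimirOn p q U h) (hh' : IsCasimirOn p q U h') {l : Loop n} (hl : l ∈ U) :
    CommuteAt (flowField p q h) (flowField p q h') l := by
  have key : ∀ {h h' : Loop n → ℂ}, IsCasimirOn p q U h → IsCasimirOn p q U h' →
      HasLoopDerivAt (fun s : ℝ => flowField p q h' (l + (s : ℂ) • flowField p q h l))
      (-(coad p q (Pplus n (bracket (-gradPlus p q h l) (grad p q h' l))) l +
        coad p q (gradPlus p q h' l) (coad p q (-gradPlus p q h l) l))) 0 := by
    intro h h' hh hh'
    have h1 := hasLoopDerivAt_line l (flowField p q h l)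
    have e0 : l + ((0 : ℝ) : ℂ) • flowField p q h l = l := by simp
    have h2 := hh'.hasLoopDerivAt_flowField hU (smoothFam_line l (flowField p q h l)) (s₀ := 0)
      (v := -gradPlus p q h l) (by rw [e0]; exact hl) (by rw [e0, ← flowField_eq]; exact h1)
    rwa [e0] at h2
  refine ⟨_, key hh hh', ?_⟩
  have h2 := key hh' hh
  convert h2 using 1
  -- The two derivatives differ by a term from the change of the projected gradients and by a
  -- commutator of two coadjoint actions. Up to sign, their sum is `ad*` of the zero-curvature
  -- expression applied to `l`, because `ad*` is a representation.
  have hc := congrArg (fun a => coad p q a l) (hh.gradPlus_curvature hU hh' hl)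
  have hb := coad_bracket p q (gradPlus p q h l) (gradPlus p q h' l) l
  simp only [← coadForm_apply, map_add, map_sub, map_neg, map_zero, LinearMap.add_apply,
    LinearMap.sub_apply, LinearMap.neg_apply, LinearMap.zero_apply] at hc hb ⊢
  rw [hb] at hc
  rw [← sub_eq_zero, ← neg_eq_zero, ← hc]
  abel

end LoopTorus

namespace LoopTorus

/-! ### Zero curvature and compatibility of the linear system -/

section VecD

variable {W : Type*} [NormedAddCommGroup W] [NormedSpace ℝ W] {ι κ : Type*} [Fintype ι] [Fintype κ]

/-- The first-order operator `∑ i, a i ∂/∂(v i)`. -/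
def vecD (a : ι → W → ℂ) (v : ι → W) (f : W → ℂ) (z : W) : ℂ := ∑ i, a i z * fderiv ℝ f z (v i)

lemma fderiv_vecD {a : ι → W → ℂ} (ha : ∀ i, ContDiff ℝ ∞ (a i)) (v : ι → W) {f : W → ℂ}
    (hf : ContDiff ℝ ∞ f) (z u : W) :
    fderiv ℝ (vecD a v f) z u = ∑ i, (a i z * fderiv ℝ (fderiv ℝ f) z u (v i) +
      fderiv ℝ (a i) z u * fderiv ℝ f z (v i)) := by
  have hf' : ContDiff ℝ ∞ (fderiv ℝ f) := hf.fderiv_right (by simp)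
  have hd : ∀ i, HasFDerivAt (fun z => fderiv ℝ f z (v i))
      ((fderiv ℝ (fderiv ℝ f) z).flip (v i)) z := fun i => by
    have := (hf'.differentiable (by simp) z).hasFDerivAt.clm_apply (hasFDerivAt_const (v i) z)
    simpa using this
  have h := HasFDerivAt.fun_sum (u := Finset.univ) fun i _ =>
    (((ha i).differentiable (by simp) z).hasFDerivAt).mul (hd i)
  have e : fderiv ℝ (vecD a v f) z = _ := h.fderiv
  rw [e]
  simp only [sum_apply, add_apply, smul_apply, ContinuousLinearMap.flip_apply, smul_eq_mul]
  exact Finset.sum_congr rfl fun i _ => by ring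

lemma vecD_vecD (a : ι → W → ℂ) (v : ι → W) {b : κ → W → ℂ} (hb : ∀ i, ContDiff ℝ ∞ (b i))
    (w : κ → W) {f : W → ℂ} (hf : ContDiff ℝ ∞ f) (z : W) :
    vecD a v (vecD b w f) z = ∑ i, ∑ k, a i z * b k z * fderiv ℝ (fderiv ℝ f) z (v i) (w k) +
      ∑ k, vecD a v (b k) z * fderiv ℝ f z (w k) := by
  have : ∑ k, vecD a v (b k) z * fderiv ℝ f z (w k) =
      ∑ i, ∑ k, a i z * (fderiv ℝ (b k) z (v i) * fderiv ℝ f z (w k)) := by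
    rw [Finset.sum_comm]
    refine Finset.sum_congr rfl fun k _ => ?_
    rw [vecD, Finset.sum_mul]
    exact Finset.sum_congr rfl fun i _ => by ring
  rw [this, ← Finset.sum_add_distrib, vecD]
  refine Finset.sum_congr rfl fun i _ => ?_
  rw [fderiv_vecD hb w hf, Finset.mul_sum, ← Finset.sum_add_distrib]
  exact Finset.sum_congr rfl fun k _ => by ring

/-- Second-order terms cancel by symmetry of second derivatives. Allowing arbitrary constant
directions treats `y`, `t` and `x` alike, so one computation covers both operators. -/
lemma vecD_vecD_sub {a : ι → W → ℂ} (ha : ∀ i, ContDiff ℝ ∞ (a i)) (v : ι → W)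
    {b : κ → W → ℂ} (hb : ∀ i, ContDiff ℝ ∞ (b i)) (w : κ → W) {f : W → ℂ}
    (hf : ContDiff ℝ ∞ f) (z : W) :
    vecD a v (vecD b w f) z - vecD b w (vecD a v f) z =
      ∑ k, vecD a v (b k) z * fderiv ℝ f z (w k) - ∑ i, vecD b w (a i) z * fderiv ℝ f z (v i) := by
  have hsymm : ∀ u u', fderiv ℝ (fderiv ℝ f) z u u' = fderiv ℝ (fderiv ℝ f) z u' u :=
    (hf.contDiffAt.isSymmSndFDerivAt (by
      simp only [minSmoothness_of_isRCLikeNormedField]; exact WithTop.coe_le_coe.2 le_top)).eq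
  have e2 : ∑ i, ∑ k, a i z * b k z * fderiv ℝ (fderiv ℝ f) z (v i) (w k) =
      ∑ k, ∑ i, b k z * a i z * fderiv ℝ (fderiv ℝ f) z (w k) (v i) := by
    rw [Finset.sum_comm]
    refine Finset.sum_congr rfl fun k _ => Finset.sum_congr rfl fun i _ => ?_
    rw [hsymm, mul_comm (a i z)]
  rw [vecD_vecD a v hb w hf, vecD_vecD b w ha v hf, e2]
  ring

end VecD

variable {n : ℕ}

/-! ### The operators on functions of `(y, t, x)` and their commutator. -/

/-- A function of `(y, t, x)` as a function of one variable. -/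
def uncurryWave (ψ : ℝ → ℝ → (Fin n → ℝ) → ℂ) (w : (ℝ × ℝ) × (Fin n → ℝ)) : ℂ := ψ w.1.1 w.1.2 w.2

/-- The coefficients of `∂/∂y + A`, with `none` for the coefficient `1` of `∂/∂y`. -/
def waveCoeff (A : ℝ → ℝ → (Fin n → ℝ) → Fin n → ℂ) :
    Option (Fin n) → (ℝ × ℝ) × (Fin n → ℝ) → ℂ
  | none => fun _ => 1
  | some j => uncurryWave fun y t x => A y t x j

/-- The directions `e` and `∂/∂x j` in the space of `(y, t, x)`. -/
def waveDir (e : ℝ × ℝ) : Option (Fin n) → (ℝ × ℝ) × (Fin n → ℝ)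
  | none => (e, 0)
  | some j => (0, Pi.single j 1)

namespace IsWaveFun

variable {ψ : ℝ → ℝ → (Fin n → ℝ) → ℂ}

lemma contDiff (hψ : IsWaveFun ψ) : ContDiff ℝ ∞ (uncurryWave ψ) := hψ.1

lemma isTorusFun (hψ : IsWaveFun ψ) (y t : ℝ) : IsTorusFun (ψ y t) :=
  ⟨ContDiff.comp (g := fun w : (ℝ × ℝ) × (Fin n → ℝ) => ψ w.1.1 w.1.2 w.2)
    (f := fun x => ((y, t), x)) hψ.1 (contDiff_const.prodMk contDiff_id), fun x j => hψ.2 y t x j⟩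

lemma pd_eq (hψ : IsWaveFun ψ) (y t : ℝ) (x : Fin n → ℝ) (j : Fin n) :
    pd j (ψ y t) x = fderiv ℝ (uncurryWave ψ) ((y, t), x) (0, Pi.single j 1) := by
  have h1 : HasFDerivAt (uncurryWave ψ) (fderiv ℝ (uncurryWave ψ) ((y, t), x)) ((y, t), x) :=
    (hψ.contDiff.differentiable (by simp) _).hasFDerivAt
  have h2 : HasFDerivAt (fun x : Fin n → ℝ => ((y, t), x))
      ((0 : (Fin n → ℝ) →L[ℝ] ℝ × ℝ).prod (ContinuousLinearMap.id ℝ _)) x :=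
    (hasFDerivAt_const _ _).prodMk (hasFDerivAt_id x)
  have h3 := h1.comp x h2
  have e : fderiv ℝ (ψ y t) x = _ := h3.fderiv
  rw [pd, e]
  simp

lemma hasDerivAt_y (hψ : IsWaveFun ψ) (y t : ℝ) (x : Fin n → ℝ) :
    HasDerivAt (fun s => ψ s t x) (fderiv ℝ (uncurryWave ψ) ((y, t), x) ((1, 0), 0)) y := by
  have h1 : HasFDerivAt (uncurryWave ψ) (fderiv ℝ (uncurryWave ψ) ((y, t), x)) ((y, t), x) :=
    (hψ.contDiff.differentiable (by simp) _).hasFDerivAt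
  exact HasFDerivAt.comp_hasDerivAt (f := fun s : ℝ => ((s, t), x)) y h1
    (((hasDerivAt_id y).prodMk (hasDerivAt_const y t)).prodMk (hasDerivAt_const y x))

lemma hasDerivAt_t (hψ : IsWaveFun ψ) (y t : ℝ) (x : Fin n → ℝ) :
    HasDerivAt (fun s => ψ y s x) (fderiv ℝ (uncurryWave ψ) ((y, t), x) ((0, 1), 0)) t := by
  have h1 : HasFDerivAt (uncurryWave ψ) (fderiv ℝ (uncurryWave ψ) ((y, t), x)) ((y, t), x) :=
    (hψ.contDiff.differentiable (by simp) _).hasFDerivAt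
  exact HasFDerivAt.comp_hasDerivAt (f := fun s : ℝ => ((y, s), x)) t h1
    (((hasDerivAt_const t y).prodMk (hasDerivAt_id t)).prodMk (hasDerivAt_const t x))

lemma opY_eq (hψ : IsWaveFun ψ) (A : ℝ → ℝ → (Fin n → ℝ) → Fin n → ℂ) (y t : ℝ) (x : Fin n → ℝ) :
    opY A ψ y t x = vecD (waveCoeff A) (waveDir (1, 0)) (uncurryWave ψ) ((y, t), x) := by
  rw [opY, vecD, Fintype.sum_option, (hψ.hasDerivAt_y y t x).deriv]
  simp only [waveCoeff, waveDir, one_mul, hψ.pd_eq, uncurryWave]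

lemma opT_eq (hψ : IsWaveFun ψ) (A : ℝ → ℝ → (Fin n → ℝ) → Fin n → ℂ) (y t : ℝ) (x : Fin n → ℝ) :
    opT A ψ y t x = vecD (waveCoeff A) (waveDir (0, 1)) (uncurryWave ψ) ((y, t), x) := by
  rw [opT, vecD, Fintype.sum_option, (hψ.hasDerivAt_t y t x).deriv]
  simp only [waveCoeff, waveDir, one_mul, hψ.pd_eq, uncurryWave]

lemma mul {φ : ℝ → ℝ → (Fin n → ℝ) → ℂ} (hψ : IsWaveFun ψ) (hφ : IsWaveFun φ) :
    IsWaveFun fun y t x => ψ y t x * φ y t x :=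
  ⟨hψ.1.mul hφ.1, fun y t x j => by simp only [hψ.2, hφ.2]⟩

lemma add {φ : ℝ → ℝ → (Fin n → ℝ) → ℂ} (hψ : IsWaveFun ψ) (hφ : IsWaveFun φ) :
    IsWaveFun fun y t x => ψ y t x + φ y t x :=
  ⟨hψ.1.add hφ.1, fun y t x j => by simp only [hψ.2, hφ.2]⟩

lemma sum {ι : Type*} {s : Finset ι} {ψ : ι → ℝ → ℝ → (Fin n → ℝ) → ℂ}
    (hψ : ∀ i ∈ s, IsWaveFun (ψ i)) : IsWaveFun fun y t x => ∑ i ∈ s, ψ i y t x :=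
  ⟨ContDiff.sum fun i hi => (hψ i hi).1,
    fun y t x j => Finset.sum_congr rfl fun i hi => (hψ i hi).2 y t x j⟩

lemma of_torus {f : (Fin n → ℝ) → ℂ} (hf : IsTorusFun f) {g : ℝ × ℝ → ℝ} (hg : ContDiff ℝ ∞ g) :
    IsWaveFun fun y t x => (g (y, t) : ℂ) * f x :=
  ⟨(ofRealCLM.contDiff.comp (hg.comp contDiff_fst)).mul (hf.1.comp contDiff_snd),
    fun y t x j => by simp only [hf.2]⟩

lemma deriv_y (hψ : IsWaveFun ψ) : IsWaveFun fun y t x => deriv (fun s => ψ s t x) y := by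
  refine ⟨?_, fun y t x j => by simp only [hψ.2]⟩
  simp only [(hψ.hasDerivAt_y _ _ _).deriv]
  exact (hψ.contDiff.fderiv_right (m := ∞) (by simp)).clm_apply contDiff_const

lemma deriv_t (hψ : IsWaveFun ψ) : IsWaveFun fun y t x => deriv (fun s => ψ y s x) t := by
  refine ⟨?_, fun y t x j => by simp only [hψ.2]⟩
  simp only [(hψ.hasDerivAt_t _ _ _).deriv]
  exact (hψ.contDiff.fderiv_right (m := ∞) (by simp)).clm_apply contDiff_const

lemma pd (hψ : IsWaveFun ψ) (j : Fin n) : IsWaveFun fun y t x => pd j (ψ y t) x :=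
  ⟨SmoothParam.pd (G := fun (w : ℝ × ℝ) x => ψ w.1 w.2 x) hψ.1 j,
    fun y t x i => ((hψ.isTorusFun y t).pd j).2 x i⟩

variable {A B : ℝ → ℝ → (Fin n → ℝ) → Fin n → ℂ}

lemma opY (hψ : IsWaveFun ψ) (hA : ∀ j, IsWaveFun fun y t x => A y t x j) :
    IsWaveFun (opY A ψ) := hψ.deriv_y.add (IsWaveFun.sum fun j _ => (hA j).mul (hψ.pd j))

lemma opT (hψ : IsWaveFun ψ) (hA : ∀ j, IsWaveFun fun y t x => A y t x j) :
    IsWaveFun (opT A ψ) := hψ.deriv_t.add (IsWaveFun.sum fun j _ => (hA j).mul (hψ.pd j))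

end IsWaveFun

variable {A B : ℝ → ℝ → (Fin n → ℝ) → Fin n → ℂ}

/-- The components of `∂B/∂y - ∂A/∂t + [A, B]`. -/
def curvature (A B : ℝ → ℝ → (Fin n → ℝ) → Fin n → ℂ) (y t : ℝ) (x : Fin n → ℝ) (j : Fin n) : ℂ :=
  opY A (fun y t x => B y t x j) y t x - opT B (fun y t x => A y t x j) y t x

lemma laxAt_iff (hA : ∀ j, IsWaveFun fun y t x => A y t x j)
    (hB : ∀ j, IsWaveFun fun y t x => B y t x j) (y t : ℝ) :
    LaxAt A B y t ↔ ∀ x j, curvature A B y t x j = 0 := by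
  have hBd : ∀ x, HasDerivAt (fun s => B s t x) (fun j => deriv (fun s => B s t x j) y) y :=
    fun x => hasDerivAt_pi.2 fun j => ((hB j).hasDerivAt_y y t x).differentiableAt.hasDerivAt
  have hAd : ∀ x, HasDerivAt (fun s => A y s x) (fun j => deriv (fun s => A y s x j) t) t :=
    fun x => hasDerivAt_pi.2 fun j => ((hA j).hasDerivAt_t y t x).differentiableAt.hasDerivAt
  have e : ∀ x j, curvature A B y t x j =
      ((fun j => deriv (fun s => B s t x j) y) - (fun j => deriv (fun s => A y s x j) t) +
        fieldBracket (A y t) (B y t) x) j := by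
    intro x j
    simp only [curvature, opY, opT, Pi.add_apply, Pi.sub_apply, fieldBracket,
      Finset.sum_sub_distrib]
    ring
  constructor
  · intro h x j
    obtain ⟨u, v, hu, hv, huv⟩ := h x
    rw [e, ← hu.unique (hBd x), ← hv.unique (hAd x), huv]
    rfl
  · exact fun h x => ⟨_, _, hBd x, hAd x, funext fun j => by rw [← e]; exact h x j⟩

/-- The coefficients of `∂/∂y` and `∂/∂t` are constant, so the commutator has only `x`-components,
and these are minus the curvature. -/
lemma opT_opY_sub (hA : ∀ j, IsWaveFun fun y t x => A y t x j)
    (hB : ∀ j, IsWaveFun fun y t x => B y t x j) {ψ : ℝ → ℝ → (Fin n → ℝ) → ℂ}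
    (hψ : IsWaveFun ψ) (y t : ℝ) (x : Fin n → ℝ) :
    opT B (opY A ψ) y t x - opY A (opT B ψ) y t x =
      -∑ j, curvature A B y t x j * pd j (ψ y t) x := by
  have hc : ∀ {A : ℝ → ℝ → (Fin n → ℝ) → Fin n → ℂ}, (∀ j, IsWaveFun fun y t x => A y t x j) →
      ∀ i, ContDiff ℝ ∞ (waveCoeff A i) := by
    intro A hA i
    cases i with
    | none => exact contDiff_const
    | some j => exact (hA j).contDiff
  have e1 : uncurryWave (opY A ψ) = vecD (waveCoeff A) (waveDir (1, 0)) (uncurryWave ψ) :=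
    funext fun w => hψ.opY_eq A w.1.1 w.1.2 w.2
  have e2 : uncurryWave (opT B ψ) = vecD (waveCoeff B) (waveDir (0, 1)) (uncurryWave ψ) :=
    funext fun w => hψ.opT_eq B w.1.1 w.1.2 w.2
  rw [(hψ.opY hA).opT_eq, (hψ.opT hB).opY_eq, e1, e2,
    vecD_vecD_sub (hc hB) _ (hc hA) _ hψ.contDiff, Fintype.sum_option, Fintype.sum_option]
  have z : ∀ {C : ℝ → ℝ → (Fin n → ℝ) → Fin n → ℂ} {v : Option (Fin n) → (ℝ × ℝ) × (Fin n → ℝ)}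
      {D : ℝ → ℝ → (Fin n → ℝ) → Fin n → ℂ},
      vecD (waveCoeff C) v (waveCoeff D none) ((y, t), x) = 0 := by
    intro C v D
    simp [vecD, waveCoeff]
  rw [z, z, zero_mul, zero_mul, zero_add, zero_add, ← Finset.sum_sub_distrib,
    ← Finset.sum_neg_distrib]
  refine Finset.sum_congr rfl fun j _ => ?_
  rw [hψ.pd_eq, curvature, (hB j).opY_eq, (hA j).opT_eq]
  simp only [waveDir, waveCoeff]
  ring

/-- A test function with a single nonzero gradient component at `x` isolates one component of the
curvature there. Commutation, compatibility and complete solutions each supply such functions. -/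
lemma laxAt_of_test (hA : ∀ j, IsWaveFun fun y t x => A y t x j)
    (hB : ∀ j, IsWaveFun fun y t x => B y t x j) {y t : ℝ}
    (h : ∀ x j, ∃ ψ : ℝ → ℝ → (Fin n → ℝ) → ℂ, IsWaveFun ψ ∧
      opT B (opY A ψ) y t x = opY A (opT B ψ) y t x ∧ pd j (ψ y t) x ≠ 0 ∧
      ∀ i, i ≠ j → pd i (ψ y t) x = 0) : LaxAt A B y t := by
  refine (laxAt_iff hA hB y t).2 fun x j => ?_
  obtain ⟨ψ, hψ, hc, hj, hi⟩ := h x j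
  have h1 := opT_opY_sub hA hB hψ y t x
  rw [hc, sub_self, Finset.sum_eq_single j (fun i _ hij => by rw [hi i hij, mul_zero]) (by simp),
    eq_comm, neg_eq_zero, mul_eq_zero] at h1
  exact h1.resolve_right hj

lemma pd_character_single (j i : Fin n) (x : Fin n → ℝ) :
    pd i (character (Pi.single j 1)) x = if i = j then I * character (Pi.single j 1) x else 0 := by
  rw [pd_character]
  split_ifs with h
  · subst h; simp
  · simp [h]

lemma character_ne_zero (k : Fin n → ℤ) (x : Fin n → ℝ) : character k x ≠ 0 := exp_ne_zero _

lemma opsCommuteAt_of_laxAt (hA : ∀ j, IsWaveFun fun y t x => A y t x j)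
    (hB : ∀ j, IsWaveFun fun y t x => B y t x j) {y t : ℝ} (h : LaxAt A B y t) :
    OpsCommuteAt A B y t := by
  intro ψ hψ x
  rw [← sub_eq_zero, opT_opY_sub hA hB hψ]
  simp [(laxAt_iff hA hB y t).1 h]

lemma laxAt_of_opsCommuteAt (hA : ∀ j, IsWaveFun fun y t x => A y t x j)
    (hB : ∀ j, IsWaveFun fun y t x => B y t x j) {y t : ℝ} (h : OpsCommuteAt A B y t) :
    LaxAt A B y t := by
  refine laxAt_of_test hA hB fun x j => ?_
  have hψ : IsWaveFun fun (_ _ : ℝ) => character (Pi.single j 1 : Fin n → ℤ) :=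
    ⟨(isTorusFun_character _).1.comp contDiff_snd, fun _ _ => (isTorusFun_character _).2⟩
  refine ⟨_, hψ, h _ hψ x, ?_, fun i hi => ?_⟩
  · simp [pd_character_single, character_ne_zero]
  · simp [pd_character_single, hi]

/-- Both compositions are zero: the parameter derivative of each residual vanishes by assumption,
and its `x`-derivatives vanish because the residual is zero at `(y, t)` for all `x`. -/
lemma commute_of_vanishes {ψ : ℝ → ℝ → (Fin n → ℝ) → ℂ} {y t : ℝ}
    (h1 : VanishesToFirstOrderAt (opT B ψ) y t) (h2 : VanishesToFirstOrderAt (opY A ψ) y t)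
    (x : Fin n → ℝ) : opT B (opY A ψ) y t x = opY A (opT B ψ) y t x := by
  have e1 : opT B ψ y t = fun _ => 0 := funext fun x => (h1 x).1
  have e2 : opY A ψ y t = fun _ => 0 := funext fun x => (h2 x).1
  have e3 : opT B (opY A ψ) y t x = 0 := by
    rw [opT, (h2 x).2.2.deriv, e2]
    simp [pd]
  have e4 : opY A (opT B ψ) y t x = 0 := by
    rw [opY, (h1 x).2.1.deriv, e1]
    simp [pd]
  rw [e3, e4]

lemma laxAt_of_linearCompatibleAt (hA : ∀ j, IsWaveFun fun y t x => A y t x j)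
    (hB : ∀ j, IsWaveFun fun y t x => B y t x j) {y t : ℝ} (h : LinearCompatibleAt A B y t) :
    LaxAt A B y t := by
  refine laxAt_of_test hA hB fun x j => ?_
  obtain ⟨ψ, hψ, hψf, h1, h2⟩ := h _ (isTorusFun_character (Pi.single j 1 : Fin n → ℤ))
  refine ⟨ψ, hψ, commute_of_vanishes h1 h2 x, ?_, fun i hi => ?_⟩
  · simp [hψf, pd_character_single, character_ne_zero]
  · simp [hψf, pd_character_single, hi]

lemma vanishes_of_eventually {r : ℝ → ℝ → (Fin n → ℝ) → ℂ} {y t : ℝ}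
    (h : ∀ᶠ w : ℝ × ℝ in 𝓝 (y, t), ∀ x, r w.1 w.2 x = 0) : VanishesToFirstOrderAt r y t := by
  intro x
  have c1 : Filter.Tendsto (fun s : ℝ => (s, t)) (𝓝 y) (𝓝 (y, t)) :=
    Continuous.tendsto (by fun_prop) y
  have c2 : Filter.Tendsto (fun s : ℝ => (y, s)) (𝓝 t) (𝓝 (y, t)) :=
    Continuous.tendsto (by fun_prop) t
  refine ⟨h.self_of_nhds x, ?_, ?_⟩
  · exact (hasDerivAt_const y (0 : ℂ)).congr_of_eventuallyEq ((c1.eventually h).mono fun s hs => hs x)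
  · exact (hasDerivAt_const t (0 : ℂ)).congr_of_eventuallyEq ((c2.eventually h).mono fun s hs => hs x)

lemma laxAt_of_hasCompleteSolutionsAt (hA : ∀ j, IsWaveFun fun y t x => A y t x j)
    (hB : ∀ j, IsWaveFun fun y t x => B y t x j) {y t : ℝ} (h : HasCompleteSolutionsAt A B y t) :
    LaxAt A B y t := by
  refine laxAt_of_test hA hB fun x j => ?_
  obtain ⟨ψ, hψ, hev, hg⟩ := h x (Pi.single j 1)
  refine ⟨ψ, hψ, commute_of_vanishes (vanishes_of_eventually (hev.mono fun w hw x => (hw x).1))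
    (vanishes_of_eventually (hev.mono fun w hw x => (hw x).2)) x, ?_, fun i hi => ?_⟩
  · simp [hg]
  · simp [hg, hi]

/-! ### Second-order Taylor solutions of the linear system. -/

/-- The polynomial of second order in `(y, t)` around `(y₀, t₀)` with given coefficients. -/
def taylorWave (y₀ t₀ : ℝ) (f f₁ f₂ f₁₁ f₁₂ f₂₂ : (Fin n → ℝ) → ℂ) :
    ℝ → ℝ → (Fin n → ℝ) → ℂ := fun y t x =>
  f x + ((y - y₀ : ℝ) : ℂ) * f₁ x + ((t - t₀ : ℝ) : ℂ) * f₂ x +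
    (((y - y₀) ^ 2 / 2 : ℝ) : ℂ) * f₁₁ x + (((y - y₀) * (t - t₀) : ℝ) : ℂ) * f₁₂ x +
    (((t - t₀) ^ 2 / 2 : ℝ) : ℂ) * f₂₂ x

section Taylor

variable {f f₁ f₂ f₁₁ f₁₂ f₂₂ : (Fin n → ℝ) → ℂ}

lemma isWaveFun_taylorWave (y₀ t₀ : ℝ) (hf : IsTorusFun f) (hf₁ : IsTorusFun f₁)
    (hf₂ : IsTorusFun f₂) (hf₁₁ : IsTorusFun f₁₁) (hf₁₂ : IsTorusFun f₁₂) (hf₂₂ : IsTorusFun f₂₂) :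
    IsWaveFun (taylorWave y₀ t₀ f f₁ f₂ f₁₁ f₁₂ f₂₂) := by
  have h0 : IsWaveFun fun _ _ : ℝ => f := ⟨hf.1.comp contDiff_snd, fun _ _ => hf.2⟩
  exact ((((h0.add (.of_torus hf₁ (g := fun w => w.1 - y₀) (by fun_prop))).add
    (.of_torus hf₂ (g := fun w => w.2 - t₀) (by fun_prop))).add
    (.of_torus hf₁₁ (g := fun w => (w.1 - y₀) ^ 2 / 2) (by fun_prop))).add
    (.of_torus hf₁₂ (g := fun w => (w.1 - y₀) * (w.2 - t₀)) (by fun_prop))).add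
    (.of_torus hf₂₂ (g := fun w => (w.2 - t₀) ^ 2 / 2) (by fun_prop))

lemma hasDerivAt_taylorWave (y₀ t₀ y t : ℝ) (x : Fin n → ℝ) :
    HasDerivAt (fun s => taylorWave y₀ t₀ f f₁ f₂ f₁₁ f₁₂ f₂₂ y s x)
      (f₂ x + ((y - y₀ : ℝ) : ℂ) * f₁₂ x + ((t - t₀ : ℝ) : ℂ) * f₂₂ x) t := by
  have h0 : HasDerivAt (fun s : ℝ => (s : ℂ) - t₀) 1 t :=
    (Complex.ofRealCLM.hasDerivAt (x := t)).sub_const (t₀ : ℂ)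
  have h := (((((hasDerivAt_const t (f x + ((y - y₀ : ℝ) : ℂ) * f₁ x)).add
    (h0.mul_const (f₂ x)))).add_const ((((y - y₀) ^ 2 / 2 : ℝ) : ℂ) * f₁₁ x)).add
    ((h0.const_mul ((y : ℂ) - y₀)).mul_const (f₁₂ x))).add
    (((h0.pow 2).div_const 2).mul_const (f₂₂ x))
  refine (h.congr_deriv ?_).congr_of_eventuallyEq (Filter.Eventually.of_forall fun s => ?_)
  · push_cast
    ring
  · simp [taylorWave]

lemma pd_taylorWave (hf : IsTorusFun f) (hf₁ : IsTorusFun f₁)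
    (hf₂ : IsTorusFun f₂) (hf₁₁ : IsTorusFun f₁₁) (hf₁₂ : IsTorusFun f₁₂) (hf₂₂ : IsTorusFun f₂₂)
    (y₀ t₀ y t : ℝ) (j : Fin n) (x : Fin n → ℝ) :
    pd j (taylorWave y₀ t₀ f f₁ f₂ f₁₁ f₁₂ f₂₂ y t) x =
      taylorWave y₀ t₀ (pd j f) (pd j f₁) (pd j f₂) (pd j f₁₁) (pd j f₁₂) (pd j f₂₂) y t x := by
  have hc : ∀ {g : (Fin n → ℝ) → ℂ} (c : ℂ), IsTorusFun g → ContDiff ℝ ∞ fun x => c * g x :=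
    fun c hg => contDiff_const.mul hg.1
  unfold taylorWave
  rw [pd_add (((((hf.1.add (hc _ hf₁)).add (hc _ hf₂)).add (hc _ hf₁₁)).add (hc _ hf₁₂)))
    (hc _ hf₂₂), pd_add ((((hf.1.add (hc _ hf₁)).add (hc _ hf₂)).add (hc _ hf₁₁))) (hc _ hf₁₂),
    pd_add (((hf.1.add (hc _ hf₁)).add (hc _ hf₂))) (hc _ hf₁₁),
    pd_add ((hf.1.add (hc _ hf₁))) (hc _ hf₂), pd_add hf.1 (hc _ hf₁),
    pd_const_mul _ hf₁.1, pd_const_mul _ hf₂.1, pd_const_mul _ hf₁₁.1, pd_const_mul _ hf₁₂.1,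
    pd_const_mul _ hf₂₂.1]

/-- The two parameters play symmetric roles, so the equation in `y` is obtained from the one in `t`.
-/
lemma taylorWave_swap (y₀ t₀ y t : ℝ) : taylorWave y₀ t₀ f f₁ f₂ f₁₁ f₁₂ f₂₂ y t =
    taylorWave t₀ y₀ f f₂ f₁ f₂₂ f₁₂ f₁₁ t y := by
  funext x
  simp only [taylorWave]
  push_cast
  ring

/-- The three relations are the value, the `y`-derivative and the `t`-derivative of the residual at
the centre; the coefficient `f₁₁` does not enter them. -/
lemma vanishes_opT_taylorWave (hf : IsTorusFun f) (hf₁ : IsTorusFun f₁)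
    (hf₂ : IsTorusFun f₂) (hf₁₁ : IsTorusFun f₁₁) (hf₁₂ : IsTorusFun f₁₂) (hf₂₂ : IsTorusFun f₂₂)
    {y t : ℝ} {By Bt : (Fin n → ℝ) → Fin n → ℂ}
    (hBy : ∀ x j, HasDerivAt (fun s => B s t x j) (By x j) y)
    (hBt : ∀ x j, HasDerivAt (fun s => B y s x j) (Bt x j) t)
    (e₂ : ∀ x, f₂ x + lieD (B y t) f x = 0)
    (e₁₂ : ∀ x, f₁₂ x + lieD By f x + lieD (B y t) f₁ x = 0)
    (e₂₂ : ∀ x, f₂₂ x + lieD Bt f x + lieD (B y t) f₂ x = 0) :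
    VanishesToFirstOrderAt (opT B (taylorWave y t f f₁ f₂ f₁₁ f₁₂ f₂₂)) y t := by
  have hop : ∀ y' t' x, opT B (taylorWave y t f f₁ f₂ f₁₁ f₁₂ f₂₂) y' t' x =
      (f₂ x + ((y' - y : ℝ) : ℂ) * f₁₂ x + ((t' - t : ℝ) : ℂ) * f₂₂ x) + ∑ j, B y' t' x j *
        taylorWave y t (pd j f) (pd j f₁) (pd j f₂) (pd j f₁₁) (pd j f₁₂) (pd j f₂₂) y' t' x := by
    intro y' t' x
    rw [opT, (hasDerivAt_taylorWave y t y' t' x).deriv]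
    simp only [pd_taylorWave hf hf₁ hf₂ hf₁₁ hf₁₂ hf₂₂]
  intro x
  simp only [hop]
  have hval : ∀ {g g₁ g₂ g₁₁ g₁₂ g₂₂ : (Fin n → ℝ) → ℂ},
      taylorWave y t g g₁ g₂ g₁₁ g₁₂ g₂₂ y t x = g x := by
    intros
    simp [taylorWave]
  have hdt : ∀ {g g₁ g₂ g₁₁ g₁₂ g₂₂ : (Fin n → ℝ) → ℂ},
      HasDerivAt (fun s => taylorWave y t g g₁ g₂ g₁₁ g₁₂ g₂₂ y s x) (g₂ x) t := by
    intro g g₁ g₂ g₁₁ g₁₂ g₂₂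
    simpa using hasDerivAt_taylorWave (f := g) (f₁ := g₁) (f₂ := g₂) (f₁₁ := g₁₁) (f₁₂ := g₁₂)
      (f₂₂ := g₂₂) y t y t x
  have hdy : ∀ {g g₁ g₂ g₁₁ g₁₂ g₂₂ : (Fin n → ℝ) → ℂ},
      HasDerivAt (fun s => taylorWave y t g g₁ g₂ g₁₁ g₁₂ g₂₂ s t x) (g₁ x) y := by
    intro g g₁ g₂ g₁₁ g₁₂ g₂₂
    rw [show (fun s => taylorWave y t g g₁ g₂ g₁₁ g₁₂ g₂₂ s t x) =
      fun s => taylorWave t y g g₂ g₁ g₂₂ g₁₂ g₁₁ t s x from funext fun s => by rw [taylorWave_swap]]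
    simpa using hasDerivAt_taylorWave (f := g) (f₁ := g₂) (f₂ := g₁) (f₁₁ := g₂₂) (f₁₂ := g₁₂)
      (f₂₂ := g₁₁) t y t y x
  have h0 : ∀ r : ℝ, HasDerivAt (fun s : ℝ => ((s - r : ℝ) : ℂ)) 1 r := fun r => by
    simpa using (Complex.ofRealCLM.hasDerivAt (x := r)).sub_const (r : ℂ)
  refine ⟨?_, ?_, ?_⟩
  · simp only [hval, sub_self, ofReal_zero, zero_mul, add_zero]
    exact e₂ x
  · have h1 := ((((h0 y).mul_const (f₁₂ x)).const_add (f₂ x)).add_const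
      (((t - t : ℝ) : ℂ) * f₂₂ x)).add (HasDerivAt.fun_sum (u := Finset.univ) fun j _ =>
        (hBy x j).mul (hdy (g := pd j f) (g₁ := pd j f₁) (g₂ := pd j f₂) (g₁₁ := pd j f₁₁)
          (g₁₂ := pd j f₁₂) (g₂₂ := pd j f₂₂)))
    refine h1.congr_deriv ?_
    rw [← e₁₂ x]
    simp only [hval, lieD, Finset.sum_add_distrib]
    ring
  · have h1 := (((h0 t).mul_const (f₂₂ x)).const_add
      (f₂ x + ((y - y : ℝ) : ℂ) * f₁₂ x)).add (HasDerivAt.fun_sum (u := Finset.univ) fun j _ =>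
        (hBt x j).mul (hdt (g := pd j f) (g₁ := pd j f₁) (g₂ := pd j f₂) (g₁₁ := pd j f₁₁)
          (g₁₂ := pd j f₁₂) (g₂₂ := pd j f₂₂)))
    refine h1.congr_deriv ?_
    rw [← e₂₂ x]
    simp only [hval, lieD, Finset.sum_add_distrib]
    ring

end Taylor

lemma IsTorusFun.lieD {V : (Fin n → ℝ) → Fin n → ℂ} {f : (Fin n → ℝ) → ℂ}
    (hV : ∀ j, IsTorusFun fun x => V x j) (hf : IsTorusFun f) : IsTorusFun (lieD V f) :=
  IsTorusFun.sum fun j _ => (hV j).mul (hf.pd j)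

lemma lieD_neg (V : (Fin n → ℝ) → Fin n → ℂ) {f : (Fin n → ℝ) → ℂ} (hf : ContDiff ℝ ∞ f)
    (x : Fin n → ℝ) : lieD V (fun z => -1 * f z) x = -lieD V f x := by
  simp only [lieD, pd_const_mul _ hf]
  rw [← Finset.sum_neg_distrib]
  exact Finset.sum_congr rfl fun j _ => by ring

/-- The equations and their first derivatives determine the Taylor coefficients of `ψ` from `f` one
after another. Only the mixed coefficient is prescribed twice, and the two prescriptions differ by
the curvature field applied to `f`. -/
lemma linearCompatibleAt_of_laxAt (hA : ∀ j, IsWaveFun fun y t x => A y t x j)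
    (hB : ∀ j, IsWaveFun fun y t x => B y t x j) {y t : ℝ} (h : LaxAt A B y t) :
    LinearCompatibleAt A B y t := by
  intro f hf
  have hA0 := fun j => (hA j).isTorusFun y t
  have hB0 := fun j => (hB j).isTorusFun y t
  have hn : ∀ {g : (Fin n → ℝ) → ℂ}, IsTorusFun g → IsTorusFun fun x => -1 * g x :=
    fun hg => (IsTorusFun.const _).mul hg
  set Ay : (Fin n → ℝ) → Fin n → ℂ := fun x j => deriv (fun s => A s t x j) y
  set At : (Fin n → ℝ) → Fin n → ℂ := fun x j => deriv (fun s => A y s x j) t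
  set By : (Fin n → ℝ) → Fin n → ℂ := fun x j => deriv (fun s => B s t x j) y
  set Bt : (Fin n → ℝ) → Fin n → ℂ := fun x j => deriv (fun s => B y s x j) t
  have hAy : ∀ j, IsTorusFun fun x => Ay x j := fun j => (hA j).deriv_y.isTorusFun y t
  have hAt : ∀ j, IsTorusFun fun x => At x j := fun j => (hA j).deriv_t.isTorusFun y t
  have hBy : ∀ j, IsTorusFun fun x => By x j := fun j => (hB j).deriv_y.isTorusFun y t
  have hBt : ∀ j, IsTorusFun fun x => Bt x j := fun j => (hB j).deriv_t.isTorusFun y t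
  have dAy : ∀ x j, HasDerivAt (fun s => A s t x j) (Ay x j) y := fun x j =>
    ((hA j).hasDerivAt_y y t x).differentiableAt.hasDerivAt
  have dAt : ∀ x j, HasDerivAt (fun s => A y s x j) (At x j) t := fun x j =>
    ((hA j).hasDerivAt_t y t x).differentiableAt.hasDerivAt
  have dBy : ∀ x j, HasDerivAt (fun s => B s t x j) (By x j) y := fun x j =>
    ((hB j).hasDerivAt_y y t x).differentiableAt.hasDerivAt
  have dBt : ∀ x j, HasDerivAt (fun s => B y s x j) (Bt x j) t := fun x j =>
    ((hB j).hasDerivAt_t y t x).differentiableAt.hasDerivAt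
  set f₁ : (Fin n → ℝ) → ℂ := fun x => -1 * lieD (A y t) f x
  set f₂ : (Fin n → ℝ) → ℂ := fun x => -1 * lieD (B y t) f x
  have hf₁ : IsTorusFun f₁ := hn (.lieD hA0 hf)
  have hf₂ : IsTorusFun f₂ := hn (.lieD hB0 hf)
  set f₁₁ : (Fin n → ℝ) → ℂ := fun x => -1 * (lieD Ay f x + lieD (A y t) f₁ x)
  set f₁₂ : (Fin n → ℝ) → ℂ := fun x => -1 * (lieD By f x + lieD (B y t) f₁ x)
  set f₂₂ : (Fin n → ℝ) → ℂ := fun x => -1 * (lieD Bt f x + lieD (B y t) f₂ x)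
  have hf₁₁ : IsTorusFun f₁₁ := hn ((IsTorusFun.lieD hAy hf).add (.lieD hA0 hf₁))
  have hf₁₂ : IsTorusFun f₁₂ := hn ((IsTorusFun.lieD hBy hf).add (.lieD hB0 hf₁))
  have hf₂₂ : IsTorusFun f₂₂ := hn ((IsTorusFun.lieD hBt hf).add (.lieD hB0 hf₂))
  -- The coefficient `f₁₂` was defined by the `y`-derivative of the `t`-equation; the Lax relation
  -- shows that it also satisfies the `t`-derivative of the `y`-equation.
  have hcross : ∀ x, f₁₂ x + lieD At f x + lieD (A y t) f₂ x = 0 := by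
    intro x
    have h1 : ∀ j, By x j - At x j + fieldBracket (A y t) (B y t) x j = 0 := by
      intro j
      obtain ⟨u, v, hu, hv, huv⟩ := h x
      rw [← (hasDerivAt_pi.1 hu j).unique (dBy x j), ← (hasDerivAt_pi.1 hv j).unique (dAt x j)]
      exact congrFun huv j
    have h2 := lieD_fieldBracket (fun j => (hA0 j).1) (fun j => (hB0 j).1) hf.1 x
    have h3 : lieD By f x - lieD At f x + lieD (fieldBracket (A y t) (B y t)) f x = 0 := by
      simp only [lieD, ← Finset.sum_sub_distrib, ← Finset.sum_add_distrib, ← sub_mul, ← add_mul, h1,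
        zero_mul, Finset.sum_const_zero]
    have h4 := lieD_neg (B y t) (IsTorusFun.lieD hA0 hf).1 x
    have h5 := lieD_neg (A y t) (IsTorusFun.lieD hB0 hf).1 x
    change -1 * (lieD By f x + lieD (B y t) f₁ x) + _ + _ = _
    rw [h4, h5]
    rw [h2] at h3
    linear_combination -h3
  refine ⟨taylorWave y t f f₁ f₂ f₁₁ f₁₂ f₂₂, isWaveFun_taylorWave y t hf hf₁ hf₂ hf₁₁ hf₁₂ hf₂₂,
    funext fun x => by simp [taylorWave], ?_, ?_⟩
  · exact vanishes_opT_taylorWave hf hf₁ hf₂ hf₁₁ hf₁₂ hf₂₂ dBy dBt (fun x => by simp only [f₂]; ring)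
      (fun x => by simp only [f₁₂]; ring) (fun x => by simp only [f₂₂]; ring)
  · have h1 := vanishes_opT_taylorWave (B := fun t y => A y t) hf hf₂ hf₁ hf₂₂ hf₁₂ hf₁₁
      (y := t) (t := y) dAt dAy (fun x => by simp only [f₁]; ring) hcross
      (fun x => by simp only [f₁₁]; ring)
    have e : ∀ y' t', opY A (taylorWave y t f f₁ f₂ f₁₁ f₁₂ f₂₂) y' t' =
        opT (fun t y => A y t) (taylorWave t y f f₂ f₁ f₂₂ f₁₂ f₁₁) t' y' := by
      intro y' t'
      funext x
      simp only [opY, opT, taylorWave_swap y t]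
    intro x
    simp only [e]
    exact ⟨(h1 x).1, (h1 x).2.2, (h1 x).2.1⟩

/-! ### Locality in the parameters -/

section Congr

variable {A' B' : ℝ → ℝ → (Fin n → ℝ) → Fin n → ℂ} {y t : ℝ}

lemma eventually_y {Q : ℝ × ℝ → Prop} (h : ∀ᶠ w in 𝓝 (y, t), Q w) : ∀ᶠ s in 𝓝 y, Q (s, t) :=
  (Continuous.tendsto (by fun_prop : Continuous fun s : ℝ => (s, t)) y).eventually h

lemma eventually_t {Q : ℝ × ℝ → Prop} (h : ∀ᶠ w in 𝓝 (y, t), Q w) : ∀ᶠ s in 𝓝 t, Q (y, s) :=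
  (Continuous.tendsto (by fun_prop : Continuous fun s : ℝ => (y, s)) t).eventually h

lemma LaxAt.congr (hA : ∀ᶠ w : ℝ × ℝ in 𝓝 (y, t), A' w.1 w.2 = A w.1 w.2)
    (hB : ∀ᶠ w : ℝ × ℝ in 𝓝 (y, t), B' w.1 w.2 = B w.1 w.2) (h : LaxAt A B y t) :
    LaxAt A' B' y t := by
  intro x
  obtain ⟨u, v, hu, hv, huv⟩ := h x
  refine ⟨u, v, hu.congr_of_eventuallyEq ?_, hv.congr_of_eventuallyEq ?_, ?_⟩
  · exact (eventually_y hB).mono fun _ hs => congrFun hs x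
  · exact (eventually_t hA).mono fun _ hs => congrFun hs x
  · have h1 := hA.self_of_nhds
    have h2 := hB.self_of_nhds
    simp only at h1 h2
    rwa [h1, h2]

lemma eventually_opY_eq (hA : ∀ᶠ w : ℝ × ℝ in 𝓝 (y, t), A' w.1 w.2 = A w.1 w.2)
    (ψ : ℝ → ℝ → (Fin n → ℝ) → ℂ) :
    ∀ᶠ w : ℝ × ℝ in 𝓝 (y, t), opY A' ψ w.1 w.2 = opY A ψ w.1 w.2 :=
  hA.mono fun w hw => funext fun x => by simp only [opY, hw]

lemma eventually_opT_eq (hB : ∀ᶠ w : ℝ × ℝ in 𝓝 (y, t), B' w.1 w.2 = B w.1 w.2)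
    (ψ : ℝ → ℝ → (Fin n → ℝ) → ℂ) :
    ∀ᶠ w : ℝ × ℝ in 𝓝 (y, t), opT B' ψ w.1 w.2 = opT B ψ w.1 w.2 :=
  hB.mono fun w hw => funext fun x => by simp only [opT, hw]

lemma opY_congr {r r' : ℝ → ℝ → (Fin n → ℝ) → ℂ} (hA : A' y t = A y t)
    (hr : ∀ᶠ w : ℝ × ℝ in 𝓝 (y, t), r' w.1 w.2 = r w.1 w.2) (x : Fin n → ℝ) :
    opY A' r' y t x = opY A r y t x := by
  have h1 : (fun s => r' s t x) =ᶠ[𝓝 y] fun s => r s t x :=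
    (eventually_y hr).mono fun _ hs => congrFun hs x
  have h2 : r' y t = r y t := hr.self_of_nhds
  rw [opY, opY, h1.deriv_eq, h2, hA]

lemma opT_congr {r r' : ℝ → ℝ → (Fin n → ℝ) → ℂ} (hB : B' y t = B y t)
    (hr : ∀ᶠ w : ℝ × ℝ in 𝓝 (y, t), r' w.1 w.2 = r w.1 w.2) (x : Fin n → ℝ) :
    opT B' r' y t x = opT B r y t x := by
  have h1 : (fun s => r' y s x) =ᶠ[𝓝 t] fun s => r y s x :=
    (eventually_t hr).mono fun _ hs => congrFun hs x
  have h2 : r' y t = r y t := hr.self_of_nhds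
  rw [opT, opT, h1.deriv_eq, h2, hB]

lemma OpsCommuteAt.congr (hA : ∀ᶠ w : ℝ × ℝ in 𝓝 (y, t), A' w.1 w.2 = A w.1 w.2)
    (hB : ∀ᶠ w : ℝ × ℝ in 𝓝 (y, t), B' w.1 w.2 = B w.1 w.2) (h : OpsCommuteAt A B y t) :
    OpsCommuteAt A' B' y t := by
  intro ψ hψ x
  rw [opT_congr hB.self_of_nhds (eventually_opY_eq hA ψ),
    opY_congr hA.self_of_nhds (eventually_opT_eq hB ψ), h ψ hψ x]

lemma VanishesToFirstOrderAt.congr {r r' : ℝ → ℝ → (Fin n → ℝ) → ℂ}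
    (hr : ∀ᶠ w : ℝ × ℝ in 𝓝 (y, t), r' w.1 w.2 = r w.1 w.2) (h : VanishesToFirstOrderAt r y t) :
    VanishesToFirstOrderAt r' y t := fun x =>
  ⟨(congrFun hr.self_of_nhds x).trans (h x).1,
    (h x).2.1.congr_of_eventuallyEq ((eventually_y hr).mono fun _ hs => congrFun hs x),
    (h x).2.2.congr_of_eventuallyEq ((eventually_t hr).mono fun _ hs => congrFun hs x)⟩

lemma LinearCompatibleAt.congr (hA : ∀ᶠ w : ℝ × ℝ in 𝓝 (y, t), A' w.1 w.2 = A w.1 w.2)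
    (hB : ∀ᶠ w : ℝ × ℝ in 𝓝 (y, t), B' w.1 w.2 = B w.1 w.2) (h : LinearCompatibleAt A B y t) :
    LinearCompatibleAt A' B' y t := by
  intro f hf
  obtain ⟨ψ, hψ, hψf, h1, h2⟩ := h f hf
  exact ⟨ψ, hψ, hψf, h1.congr (eventually_opT_eq hB ψ), h2.congr (eventually_opY_eq hA ψ)⟩

lemma HasCompleteSolutionsAt.congr (hA : ∀ᶠ w : ℝ × ℝ in 𝓝 (y, t), A' w.1 w.2 = A w.1 w.2)
    (hB : ∀ᶠ w : ℝ × ℝ in 𝓝 (y, t), B' w.1 w.2 = B w.1 w.2) (h : HasCompleteSolutionsAt A B y t) :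
    HasCompleteSolutionsAt A' B' y t := by
  intro x ξ
  obtain ⟨ψ, hψ, hev, hg⟩ := h x ξ
  refine ⟨ψ, hψ, ?_, hg⟩
  filter_upwards [hev, eventually_opT_eq hB ψ, eventually_opY_eq hA ψ] with w hw h1 h2 z
  rw [h1, h2]
  exact hw z

/-- The zero-curvature relation, the commutation of the operators and the compatibility of the
linear system are equivalent, for coefficients that are smooth near `(y, t)`. -/
lemma lax_tfae (hA : ∀ j, IsWaveFun fun y t x => A y t x j)
    (hB : ∀ j, IsWaveFun fun y t x => B y t x j)
    (hA' : ∀ᶠ w : ℝ × ℝ in 𝓝 (y, t), A' w.1 w.2 = A w.1 w.2)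
    (hB' : ∀ᶠ w : ℝ × ℝ in 𝓝 (y, t), B' w.1 w.2 = B w.1 w.2) :
    [LaxAt A' B' y t, OpsCommuteAt A' B' y t, LinearCompatibleAt A' B' y t].TFAE ∧
      (HasCompleteSolutionsAt A' B' y t → LaxAt A' B' y t) := by
  have hA'' := hA'.mono fun w hw => hw.symm
  have hB'' := hB'.mono fun w hw => hw.symm
  refine ⟨?_, fun h => (laxAt_of_hasCompleteSolutionsAt hA hB (h.congr hA'' hB'')).congr hA' hB'⟩
  tfae_have 1 → 2 := fun h => (opsCommuteAt_of_laxAt hA hB (h.congr hA'' hB'')).congr hA' hB'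
  tfae_have 2 → 1 := fun h => (laxAt_of_opsCommuteAt hA hB (h.congr hA'' hB'')).congr hA' hB'
  tfae_have 1 → 3 := fun h => (linearCompatibleAt_of_laxAt hA hB (h.congr hA'' hB'')).congr hA' hB'
  tfae_have 3 → 1 := fun h => (laxAt_of_linearCompatibleAt hA hB (h.congr hA'' hB'')).congr hA' hB'
  tfae_finish

end Congr

end LoopTorus

namespace LoopTorus

/-! ### The Lax relation along the commuting flows -/

section LaxFlow

variable {n p q : ℕ} {U : Set (Loop n)} {h h' : Loop n → ℂ}

lemma SmoothFam.isWaveFun_extend {P : ℝ × ℝ → Loop n} (hP : SmoothFam P) (lam : ℂ) (j : Fin n) :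
    IsWaveFun fun y t x => LoopTorus.extend (P (y, t)) lam x j :=
  ⟨hP.extend lam j, fun y t x i => (isTorusFun_extend (P (y, t)) lam j).2 x i⟩

/-- The family may leave `U`, where the gradient is not controlled. A localized family provides
globally smooth coefficients with the same germ at `(y, t)`, and all the conditions depend only on
that germ. -/
lemma IsSmoothFunctionalOn.exists_wave_laxField (hU : IsOpen[Diffeology.dTopology] U)
    (hh : IsSmoothFunctionalOn p q U h) {L : ℝ → ℝ → Loop n} (hL : IsSmoothFamily L) {y t : ℝ}
    (hm : L y t ∈ U) (lam : ℂ) :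
    ∃ A : ℝ → ℝ → (Fin n → ℝ) → Fin n → ℂ, (∀ j, IsWaveFun fun y t x => A y t x j) ∧
      ∀ᶠ w : ℝ × ℝ in 𝓝 (y, t), laxField p q h L lam w.1 w.2 = A w.1 w.2 := by
  have hP : SmoothFam fun w : ℝ × ℝ => L w.1 w.2 := hL
  obtain ⟨Q, hQ, hQU, hQe⟩ := hP.exists_localization hU (w₀ := (y, t)) hm
  refine ⟨fun y t => extend (gradPlus p q h (Q (y, t))) lam,
    fun j => (hh.smooth_grad.smoothFam hQ hQU).Pplus.isWaveFun_extend lam j, ?_⟩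
  filter_upwards [hQe] with w hw
  rw [Prod.mk.eta, hw]
  rfl

lemma IsCasimirOn.hasDerivAt_extend_gradPlus (hU : IsOpen[Diffeology.dTopology] U)
    (hh : IsCasimirOn p q U h) {c : ℝ → Loop n} (hc : SmoothFam c) {s₀ : ℝ} (hs : c s₀ ∈ U)
    (hd : HasLoopDerivAt c (flowField p q h' (c s₀)) s₀) (lam : ℂ) (x : Fin n → ℝ) :
    HasDerivAt (fun s => extend (gradPlus p q h (c s)) lam x)
      (extend (Pplus n (bracket (-gradPlus p q h' (c s₀)) (grad p q h (c s₀)))) lam x) s₀ := by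
  rw [flowField_eq] at hd
  have hg := hh.hasLoopDerivAt_gradPlus hU hc hs hd
  obtain ⟨Q, hQ, hQU, hQe⟩ := hc.exists_localization hU hs
  have he : (fun s => gradPlus p q h (Q s)) =ᶠ[𝓝 s₀] fun s => gradPlus p q h (c s) :=
    hQe.fun_comp (gradPlus p q h)
  have hQs : SmoothFam fun s => gradPlus p q h (Q s) := (hh.smooth_grad.smoothFam hQ hQU).Pplus
  refine (hQs.hasDerivAt_extend (hg.congr he) lam x).congr_of_eventuallyEq ?_
  filter_upwards [he] with s hs'
  rw [hs']

/-- Along the two flows the projected gradients evolve by the first two terms of the zero-curvature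
identity. Evaluating that identity at `λ` gives the Lax relation, because on the closed disc
evaluation commutes with the commutator of loops in the plus part. -/
lemma IsCasimirOn.laxAt (hU : IsOpen[Diffeology.dTopology] U) (hh : IsCasimirOn p q U h)
    (hh' : IsCasimirOn p q U h') {L : ℝ → ℝ → Loop n} (hL : IsSmoothFamily L) {y t : ℝ}
    (hm : L y t ∈ U) (hS : SolvesAt (flowField p q h) (flowField p q h') L y t) {lam : ℂ}
    (hlam : ‖lam‖ ≤ 1) : LaxAt (laxField p q h L lam) (laxField p q h' L lam) y t := by
  have hP : SmoothFam fun w : ℝ × ℝ => L w.1 w.2 := hL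
  refine fun x => ⟨_, _,
    hh'.hasDerivAt_extend_gradPlus hU (hP.comp (g := fun s => (s, t)) (by fun_prop)) hm hS.1 lam x,
    hh.hasDerivAt_extend_gradPlus hU (hP.comp (g := fun s => (y, s)) (by fun_prop)) hm hS.2 lam x,
    ?_⟩
  have hb := fieldBracket_extend (Pplus_mem (grad p q h (L y t))) (Pplus_mem (grad p q h' (L y t)))
    hlam x
  funext i
  have hi := congrArg (extendForm lam x i) (hh.gradPlus_curvature hU hh' hm)
  rw [map_add, map_sub, map_zero] at hi
  refine Eq.trans ?_ hi
  exact congrArg (_ + ·) (congrFun hb i)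

/-- By the chain rule, the derivatives along the curves `L y ·` and `L · t` are those along straight
lines in the flow directions, where commutation is known. -/
lemma IsCasimirOn.compatibleAt (hU : IsOpen[Diffeology.dTopology] U) (hh : IsCasimirOn p q U h)
    (hh' : IsCasimirOn p q U h') {L : ℝ → ℝ → Loop n} (hL : IsSmoothFamily L) {y t : ℝ}
    (hm : L y t ∈ U) (hS : SolvesAt (flowField p q h) (flowField p q h') L y t) :
    CompatibleAt (flowField p q h) (flowField p q h') L y t := by
  have hP : SmoothFam fun w : ℝ × ℝ => L w.1 w.2 := hL
  obtain ⟨v, h1, h2⟩ := hh.flow_commute hU hh' hm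
  exact ⟨v,
    (hh.smoothMapOn_flowField hU).hasLoopDerivAt_comp hU
      (hP.comp (g := fun s => (y, s)) (by fun_prop)) hm hS.2 h2,
    (hh'.smoothMapOn_flowField hU).hasLoopDerivAt_comp hU
      (hP.comp (g := fun s => (s, t)) (by fun_prop)) hm hS.1 h1⟩

end LaxFlow

end LoopTorus

end

/-! ### Assembly of the proposition. -/

theorem proposition3p1 (n p q : ℕ) (U : Set (Loop n)) (hU : IsOpen[Diffeology.dTopology] U)
    (hy ht : Loop n → ℂ) (hyC : IsCasimirOn p q U hy) (htC : IsCasimirOn p q U ht) :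
    -- the right-hand sides are smooth vector fields on `U`
    (SmoothMapOn U (flowField p q hy) ∧ SmoothMapOn U (flowField p q ht)) ∧
    -- the evolutions are Hamiltonian for the deformed bracket
    (∀ f, IsSmoothFunctionalOn p q U f → ∀ c, IsSmoothCurve c → ∀ s : ℝ, c s ∈ U →
      (HasLoopDerivAt c (flowField p q hy (c s)) s →
        HasDerivAt (fun r => f (c r)) (poissonR p q hy f (c s)) s) ∧
      (HasLoopDerivAt c (flowField p q ht (c s)) s →
        HasDerivAt (fun r => f (c r)) (poissonR p q ht f (c s)) s)) ∧
    -- they commute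
    (∀ l ∈ U, poissonR p q hy ht l = 0 ∧
      CommuteAt (flowField p q hy) (flowField p q ht) l) ∧
    ∀ L, IsSmoothFamily L → ∀ y t : ℝ, L y t ∈ U →
      -- the Lax relation is the compatibility condition of the linear system for `ψ`
      (∀ lam : ℂ, ‖lam‖ ≤ 1 →
        [LaxAt (laxField p q hy L lam) (laxField p q ht L lam) y t,
          OpsCommuteAt (laxField p q hy L lam) (laxField p q ht L lam) y t,
          LinearCompatibleAt (laxField p q hy L lam) (laxField p q ht L lam) y t].TFAE ∧
        (HasCompleteSolutionsAt (laxField p q hy L lam) (laxField p q ht L lam) y t →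
          LaxAt (laxField p q hy L lam) (laxField p q ht L lam) y t)) ∧
      -- where both evolution equations hold, their compatibility is equivalent to the Lax relation
      -- and to the compatibility of the linear system for all `λ`, and the Lax relation holds
      (SolvesAt (flowField p q hy) (flowField p q ht) L y t →
        [CompatibleAt (flowField p q hy) (flowField p q ht) L y t,
          ∀ lam : ℂ, ‖lam‖ ≤ 1 → LaxAt (laxField p q hy L lam) (laxField p q ht L lam) y t,
          ∀ lam : ℂ, ‖lam‖ ≤ 1 → OpsCommuteAt (laxField p q hy L lam) (laxField p q ht L lam) y t,
          ∀ lam : ℂ, ‖lam‖ ≤ 1 →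
            LinearCompatibleAt (laxField p q hy L lam) (laxField p q ht L lam) y t].TFAE ∧
        ∀ lam : ℂ, ‖lam‖ ≤ 1 → LaxAt (laxField p q hy L lam) (laxField p q ht L lam) y t) := by
  refine ⟨⟨hyC.smoothMapOn_flowField hU, htC.smoothMapOn_flowField hU⟩,
    fun f hf c hc s hs => ⟨hyC.hamiltonian hU hf hc hs, htC.hamiltonian hU hf hc hs⟩,
    fun l hl => ⟨hyC.poissonR_eq_zero htC hl, hyC.flow_commute hU htC hl⟩,
    fun L hL y t hm => ?_⟩
  have key : ∀ lam : ℂ,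
      [LaxAt (laxField p q hy L lam) (laxField p q ht L lam) y t,
        OpsCommuteAt (laxField p q hy L lam) (laxField p q ht L lam) y t,
        LinearCompatibleAt (laxField p q hy L lam) (laxField p q ht L lam) y t].TFAE ∧
      (HasCompleteSolutionsAt (laxField p q hy L lam) (laxField p q ht L lam) y t →
        LaxAt (laxField p q hy L lam) (laxField p q ht L lam) y t) := fun lam => by
    obtain ⟨A, hA, hA'⟩ := hyC.exists_wave_laxField hU hL hm lam
    obtain ⟨B, hB, hB'⟩ := htC.exists_wave_laxField hU hL hm lam
    exact lax_tfae hA hB hA' hB'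
  refine ⟨fun lam _ => key lam, fun hS => ?_⟩
  have hLax : ∀ lam : ℂ, ‖lam‖ ≤ 1 →
      LaxAt (laxField p q hy L lam) (laxField p q ht L lam) y t :=
    fun lam hlam => hyC.laxAt hU htC hL hm hS hlam
  refine ⟨?_, hLax⟩
  -- On solutions of both systems, the Lax relation and the compatibility of the flows both hold
  -- outright, which closes the cycle; the two middle implications are the equivalences for each
  -- fixed `λ`.
  tfae_have 1 → 2 := fun _ => hLax
  tfae_have 2 → 3 := fun H lam hlam => ((key lam).1.out 0 1).1 (H lam hlam)
  tfae_have 3 → 4 := fun H lam hlam => ((key lam).1.out 1 2).1 (H lam hlam)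
  tfae_have 4 → 1 := fun _ => hyC.compatibleAt hU htC hL hm hS
  tfae_finish
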